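/- Let \[ M=\begin{pmatrix} -1&0&-1&-1&-1&0&0&0\\ 1&1&1&0&1&0&1&0\\ 0&0&0&0&0&0&1&0\\ 0&0&0&0&1&0&0&0\\ 1&0&0&0&0&0&-1&-1\\ -1&-1&0&0&-1&-1&0&0\\ -1&-1&0&0&0&0&0&1\\ 0&1&0&0&0&1&0&0 \end{pmatrix}. \] Then $M$ has order exactly $9$. Let $G=\mathbb Z_9$ act on $\mathbb Z^8$ with a generator acting by left multiplication $v\mapsto Mv$, and let $\Gamma=\mathbb Z^8\rtimes G$ be the corresponding semidirect product. Then $\Gamma$ is an $8$-dimensional crystallographic group with translation lattice $\mathbb Z^8$ and holonomy group $\mathbb Z_9$; that is, $\Gamma$ is isomorphic to a discrete group of isometries of $\mathbb R^8$ acting properly discontinuously and cocompactly, in such a way that the elements of $\Gamma$ acting as translations are exactly those of $\mathbb Z^8$. Moreover, as abelian groups, \[ H^4(\Gamma,\mathbb Z)\cong \mathbb Z^8\oplus\mathbb Z_9^2\oplus\mathbb Z_3^4, \qquad \bigoplus_{i+j=4}H^i\bigl(G,H^j(\mathbb Z^8,\mathbb Z)\bigr)\cong \mathbb Z^8\oplus\mathbb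 Z_9\oplus\mathbb Z_3^6, \] where $G$ acts on $H^j(\mathbb Z^8,\mathbb Z)$ through its action on $\mathbb Z^8$. In particular $H^4(\Gamma,\mathbb Z)$ and $\bigoplus_{i+j=4}H^i(G,H^j(\mathbb Z^8,\mathbb Z))$ are not isomorphic, so $\Gamma$ is a counterexample, with holonomy of odd order, to the conjecture that $H^k(L\rtimes G,\mathbb Z)\cong\bigoplus_{i+j=k}H^i(G,H^j(L,\mathbb Z))$ for every finite cyclic group $G$, every finitely generated $\mathbb ZG$-lattice $L$ and every $k\ge 0$. -/

import Mathlib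

open CategoryTheory

noncomputable section

namespace Crystal

/-! ### Crystallographic groups -/

/-- The subgroup of translations in the isometry group of `ℝⁿ`. -/
def translations (n : ℕ) :
    Subgroup (EuclideanSpace ℝ (Fin n) ≃ᵢ EuclideanSpace ℝ (Fin n)) where
  carrier := {g | ∃ v, ∀ x, g x = v + x}
  one_mem' := ⟨0, fun x => (zero_add x).symm⟩
  mul_mem' := by
    rintro a b ⟨v, hv⟩ ⟨w, hw⟩
    refine ⟨v + w, fun x => ?_⟩
    rw [IsometryEquiv.mul_apply, hw, hv, add_assoc]
  inv_mem' := by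
    rintro a ⟨v, hv⟩
    refine ⟨-v, fun x => a.injective ?_⟩
    rw [IsometryEquiv.apply_inv_self, hv, add_neg_cancel_left]

/-- A group of isometries of `ℝⁿ` is crystallographic if it acts properly discontinuously and
cocompactly (proper discontinuity on `ℝⁿ` includes discreteness in the isometry group). -/
structure IsCrystallographic (n : ℕ)
    (S : Subgroup (EuclideanSpace ℝ (Fin n) ≃ᵢ EuclideanSpace ℝ (Fin n))) : Prop where
  properlyDiscontinuous : ∀ K : Set (EuclideanSpace ℝ (Fin n)), IsCompact K →
    {g | g ∈ S ∧ ((g '' K) ∩ K).Nonempty}.Finite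
  cocompact : ∃ K : Set (EuclideanSpace ℝ (Fin n)), IsCompact K ∧ ∀ x, ∃ g ∈ S, g x ∈ K

/-! ### Group cohomology of a semidirect product and of its lattice -/

/-- `H^j(L, ℤ)` with trivial coefficients, for a group `L`. -/
abbrev intCohomology (L : Type) [Group L] (j : ℕ) : ModuleCat ℤ :=
  groupCohomology (Rep.trivial ℤ L ℤ) j

/-- The pull-back `f^* : H^j(L', ℤ) → H^j(L, ℤ)` along a homomorphism `f : L → L'`. -/
def pullback {L L' : Type} [Group L] [Group L'] (f : L →* L') (j : ℕ) :
    intCohomology L' j ⟶ intCohomology L j :=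
  groupCohomology.map (A := Rep.trivial ℤ L' ℤ) (B := Rep.trivial ℤ L ℤ) f
    (Rep.ofHom ⟨LinearMap.id, fun _ => rfl⟩) j

theorem pullback_id (L : Type) [Group L] (j : ℕ) :
    pullback (MonoidHom.id L) j = 𝟙 (intCohomology L j) :=
  groupCohomology.map_id _

theorem pullback_comp {L L' L'' : Type} [Group L] [Group L'] [Group L'']
    (f : L' →* L'') (g : L →* L') (j : ℕ) :
    pullback (f.comp g) j = pullback f j ≫ pullback g j := by
  unfold pullback
  rw [← groupCohomology.map_comp]
  rfl

/-- If `G` acts on `L` by automorphisms, then `G` acts on the left on `H^j(L, ℤ)`, where `g` acts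
as the pull-back along the automorphism `g⁻¹` of `L`. -/
def cohomologyRep {L G : Type} [Group L] [Group G] (φ : G →* MulAut L) (j : ℕ) : Rep ℤ G :=
  Rep.of (X := intCohomology L j)
    { toFun := fun g => (pullback (φ g⁻¹).toMonoidHom j).hom
      map_one' := by
        have h : (φ (1 : G)⁻¹).toMonoidHom = MonoidHom.id L := by
          ext x; simp
        rw [h, pullback_id]
        rfl
      map_mul' := by
        intro a b
        have h : (φ (a * b)⁻¹).toMonoidHom
            = (φ b⁻¹).toMonoidHom.comp (φ a⁻¹).toMonoidHom := by
          ext x; simp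
        rw [h, pullback_comp]
        rfl }

/-- `⨁_{i+j=k} H^i(G, H^j(L, ℤ))`. -/
abbrev cohomologySum {L G : Type} [Group L] [Group G] (φ : G →* MulAut L) (k : ℕ) : Type :=
  DirectSum (Finset.HasAntidiagonal.antidiagonal k) fun p => groupCohomology (cohomologyRep φ p.1.2) p.1.1

/-! ### The action of a cyclic group on `ℤⁿ` through an integral matrix -/

theorem pow_val_add {n m : ℕ} [NeZero m] {A : Matrix (Fin n) (Fin n) ℤ} (hA : A ^ m = 1)
    (a b : ZMod m) : A ^ (a + b).val = A ^ a.val * A ^ b.val := by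
  rw [ZMod.val_add, ← pow_add, ← pow_eq_pow_mod _ hA]

/-- For `A ^ m = 1`, the cyclic group of order `m` (written multiplicatively) acts on the lattice
`ℤⁿ`, its generator acting as `v ↦ A v`. -/
def matrixAction {n m : ℕ} [NeZero m] (A : Matrix (Fin n) (Fin n) ℤ) (hA : A ^ m = 1) :
    Multiplicative (ZMod m) →* MulAut (Multiplicative (Fin n → ℤ)) where
  toFun g :=
    { toFun := fun v => Multiplicative.ofAdd ((A ^ g.toAdd.val).mulVec v.toAdd)
      invFun := fun v => Multiplicative.ofAdd ((A ^ (-g.toAdd).val).mulVec v.toAdd)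
      left_inv := fun v => by
        dsimp only
        rw [toAdd_ofAdd, Matrix.mulVec_mulVec, ← pow_val_add hA, neg_add_cancel, ZMod.val_zero,
          pow_zero, Matrix.one_mulVec, ofAdd_toAdd]
      right_inv := fun v => by
        dsimp only
        rw [toAdd_ofAdd, Matrix.mulVec_mulVec, ← pow_val_add hA, add_neg_cancel, ZMod.val_zero,
          pow_zero, Matrix.one_mulVec, ofAdd_toAdd]
      map_mul' := fun v w => by
        rw [toAdd_mul, Matrix.mulVec_add, ofAdd_add] }
  map_one' := by
    ext1 v
    change Multiplicative.ofAdd ((A ^ (0 : ZMod m).val).mulVec v.toAdd) = v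
    rw [ZMod.val_zero, pow_zero, Matrix.one_mulVec, ofAdd_toAdd]
  map_mul' g h := by
    ext1 v
    change Multiplicative.ofAdd ((A ^ (g.toAdd + h.toAdd).val).mulVec v.toAdd) =
      Multiplicative.ofAdd ((A ^ g.toAdd.val).mulVec ((A ^ h.toAdd.val).mulVec v.toAdd))
    rw [Matrix.mulVec_mulVec, ← pow_val_add hA]

/-! ### The example -/

/-- The holonomy matrix. -/
def holonomyMatrix : Matrix (Fin 8) (Fin 8) ℤ :=
  !![-1,  0, -1, -1, -1,  0,  0,  0;
      1,  1,  1,  0,  1,  0,  1,  0;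
      0,  0,  0,  0,  0,  0,  1,  0;
      0,  0,  0,  0,  1,  0,  0,  0;
      1,  0,  0,  0,  0,  0, -1, -1;
     -1, -1,  0,  0, -1, -1,  0,  0;
     -1, -1,  0,  0,  0,  0,  0,  1;
      0,  1,  0,  0,  0,  1,  0,  0]

theorem holonomyMatrix_pow : holonomyMatrix ^ 9 = 1 := by
  decide +kernel

/-- The lattice `ℤ⁸`, written multiplicatively. -/
abbrev Lattice : Type := Multiplicative (Fin 8 → ℤ)

/-- The cyclic group of order nine, written multiplicatively. -/
abbrev Holonomy : Type := Multiplicative (ZMod 9)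

/-- The action of the cyclic group of order nine on `ℤ⁸` generated by `holonomyMatrix`. -/
def holonomyAction : Holonomy →* MulAut Lattice :=
  matrixAction holonomyMatrix holonomyMatrix_pow

/-- The group `ℤ⁸ ⋊ ℤ₉`. -/
abbrev CrystalGroup : Type := Lattice ⋊[holonomyAction] Holonomy

end Crystal

end

noncomputable section

namespace Crystal

open groupCohomology

/-! Write L = ℤ⁸, C = ℤ₉, Γ = L ⋊ C, and let Fun be the module of integral functions on C, which is
coinduced from L. By Shapiro's lemma Hⁿ(Γ, Fun) ≅ Hⁿ(L, ℤ), which is free of rank `Nat.choose 8 n`.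
Antisymmetrized cocycles give explicit coordinates on it, in which right translation by the
generator acts by the n-th compound matrix of its action on linear forms.

Upper bound for the torsion. The sequences 0 → ℤ → Fun → I → 0 and 0 → I → Fun → ℤ → 0 are used
alternately. They bound the order of the kernel of H⁴(Γ, ℤ) → H⁴(Γ, Fun) by the product of the
orders of the Tate groups of C in H³(L), H²(L), H¹(L), H⁰(L) (`ker_constMap_four`). Integer matrix
certificates show that these groups are ℤ₃², ℤ₃², ℤ₃², ℤ₉, so the bound is 3⁸. The same certificates
compute the groups Hⁱ(C, Hʲ(L)). The image of H⁴(Γ, ℤ) has finite index in the invariants of H⁴(L),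
hence is free of rank 8 and splits off.

Lower bound for the torsion. Six 3-cocycles of Γ modulo 9 have Bocksteins in H⁴(Γ, ℤ), and these are
evaluated on finite cyclic subgroups of Γ (`exists_bockstein`). Five of the cocycles are cup
products. The sixth, `exoticCocycle`, restricts to a trilinear form on L that is invariant under C
only up to a coboundary (`IsTrilinearDatum`). Its Bockstein lies over H¹(C, H³(L)) ≅ ℤ₃² but has
order 9, so an extension in the filtration of H⁴(Γ, ℤ) is not split. The values on the cyclic
subgroups span a copy of ℤ₉² ⊕ ℤ₃⁴, of order exactly 3⁸. The upper bound is therefore attained and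
the torsion is this group (`ker_constMap_equiv`).

The two groups differ because three times the torsion is ℤ₃² in one and ℤ₃ in the other. The
crystallographic structure comes from averaging a scalar product over the finite group. -/

/-- A morphism of modules from a map that respects addition and the scalars. -/
def homOfSMul {R : Type} [CommRing R] (M N : ModuleCat R) (l : M →+ N)
    (h : ∀ (r : R) (x : M), l (r • x) = r • l x) : M ⟶ N :=
  ModuleCat.ofHom { toFun := l, map_add' := l.map_add, map_smul' := h }

theorem hom_eq_zero {R : Type} [CommRing R] {M N : ModuleCat R} (f : M ⟶ N)
    (h : ∀ x, f x = 0) : f = 0 :=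
  ModuleCat.hom_ext (LinearMap.ext h)

/-- Additive maps between `ℤ`-modules are linear. -/
def intHom (M N : ModuleCat ℤ) (l : M →+ N) : M ⟶ N :=
  homOfSMul M N l fun r x => by simpa using map_intCast_smul l ℤ ℤ r x

/-! ### Cohomology classes represented by inhomogeneous cocycles. -/

section Classes

variable {G : Type} [Group G] {A : Rep ℤ G}

/-- The cohomology class of a cocycle. -/
def cohomClass {n : ℕ} (f : (Fin n → G) → A) (h : inhomogeneousCochains.d A n f = 0) :
    groupCohomology A n :=
  π A n (cocyclesMk f h)

theorem exists_cohomClass {n : ℕ} (x : groupCohomology A n) :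
    ∃ (f : (Fin n → G) → A) (h : inhomogeneousCochains.d A n f = 0), x = cohomClass f h := by
  induction x using groupCohomology_induction_on with
  | h c =>
    have hc : inhomogeneousCochains.d A n (iCocycles A n c) = 0 := by
      have := congr($((inhomogeneousCochains A).iCycles_d n (n + 1)) c)
      rw [inhomogeneousCochains.d_def] at this
      exact this
    refine ⟨iCocycles A n c, hc, ?_⟩
    unfold cohomClass
    congr 1
    apply (ModuleCat.mono_iff_injective (iCocycles A n)).1 inferInstance
    rw [iCocycles_mk]

/-- Outside m + 1 = n the differential is zero by the shape of the complex. This covers n = 0, where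
the predecessor of the degree is the degree itself. -/
theorem comp_intHom_eq_zero {n : ℕ} {B : Type} [AddCommGroup B] (l : ((Fin n → G) → A) →+ B)
    (hl : ∀ m, m + 1 = n → ∀ h : (Fin m → G) → A, l ((inhomogeneousCochains A).d m n h) = 0)
    (m : ℕ) : (inhomogeneousCochains A).d m n ≫
      intHom ((inhomogeneousCochains A).X n) (ModuleCat.of ℤ B) l = 0 := by
  by_cases hn : m + 1 = n
  · exact hom_eq_zero _ fun h => hl m hn h
  · rw [(inhomogeneousCochains A).shape _ _ hn, Limits.zero_comp]

/-- An additive map on cochains that vanishes on coboundaries gives an additive map on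
cohomology. -/
def descend {n : ℕ} {B : Type} [AddCommGroup B] (l : ((Fin n → G) → A) →+ B)
    (hl : ∀ m, m + 1 = n → ∀ h : (Fin m → G) → A, l ((inhomogeneousCochains A).d m n h) = 0) :
    groupCohomology A n →+ B :=
  ((inhomogeneousCochains A).homologyι n ≫ (inhomogeneousCochains A).descOpcycles
    (intHom ((inhomogeneousCochains A).X n) (ModuleCat.of ℤ B) l)
    ((ComplexShape.up ℕ).prev n) rfl (comp_intHom_eq_zero l hl _)).hom.toAddMonoidHom

theorem descend_cohomClass {n : ℕ} {B : Type} [AddCommGroup B] (l : ((Fin n → G) → A) →+ B)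
    (hl) (f : (Fin n → G) → A) (h : inhomogeneousCochains.d A n f = 0) :
    descend l hl (cohomClass f h) = l f := by
  have h1 := (inhomogeneousCochains A).homology_π_ι_assoc n
    ((inhomogeneousCochains A).descOpcycles
    (intHom ((inhomogeneousCochains A).X n) (ModuleCat.of ℤ B) l)
    ((ComplexShape.up ℕ).prev n) rfl (comp_intHom_eq_zero l hl _))
  rw [HomologicalComplex.p_descOpcycles] at h1
  exact congr($h1 (cocyclesMk f h)).trans (congrArg l (iCocycles_mk f h))

theorem map_cohomClass {H : Type} [Group H] {B : Rep ℤ H} (φ : H →* G) (ψ : Rep.res φ A ⟶ B)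
    {n : ℕ} (f : (Fin n → G) → A) (h : inhomogeneousCochains.d A n f = 0) :
    ∃ h', groupCohomology.map φ ψ n (cohomClass f h) =
      cohomClass (fun l => ψ.hom (f (φ ∘ l))) h' := by
  have hc : (inhomogeneousCochains.d B n) ((cochainsMap φ ψ).f n f) = 0 := by
    have := congr($((cochainsMap φ ψ).comm n (n + 1)) f)
    rw [inhomogeneousCochains.d_def, inhomogeneousCochains.d_def, ConcreteCategory.comp_apply,
      ConcreteCategory.comp_apply] at this
    exact this.trans ((congrArg _ h).trans (map_zero _))
  refine ⟨hc, ?_⟩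
  unfold cohomClass
  rw [π_map_apply]
  congr 1
  apply (ModuleCat.mono_iff_injective (iCocycles B n)).1 inferInstance
  refine (congr($(HomologicalComplex.cyclesMap_i (cochainsMap φ ψ) n) (cocyclesMk f h))).trans ?_
  refine Eq.trans ?_ (iCocycles_mk _ hc).symm
  exact congrArg ((cochainsMap φ ψ).f n) (iCocycles_mk f h)

theorem cohomClass_eq_zero {n : ℕ} (g : (Fin n → G) → A)
    (h : inhomogeneousCochains.d A (n + 1) (inhomogeneousCochains.d A n g) = 0) :
    cohomClass (inhomogeneousCochains.d A n g) h = 0 := by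
  have h1 := congr($((inhomogeneousCochains A).toCycles_comp_homologyπ n (n + 1)) g)
  refine Eq.trans ?_ h1
  rw [ModuleCat.comp_apply]
  unfold cohomClass
  congr 1
  apply (ModuleCat.mono_iff_injective (iCocycles A (n + 1))).1 inferInstance
  rw [iCocycles_mk]
  have := congr($((inhomogeneousCochains A).toCycles_i n (n + 1)) g)
  rw [inhomogeneousCochains.d_def] at this
  exact this.symm

theorem cohomClass_add {n : ℕ} (f g : (Fin n → G) → A) (hf : inhomogeneousCochains.d A n f = 0)
    (hg : inhomogeneousCochains.d A n g = 0) :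
    ∃ h, cohomClass f hf + cohomClass g hg = cohomClass (f + g) h := by
  have h : inhomogeneousCochains.d A n (f + g) = 0 := by rw [map_add, hf, hg, add_zero]
  refine ⟨h, ?_⟩
  unfold cohomClass
  rw [← map_add]
  congr 1
  apply (ModuleCat.mono_iff_injective (iCocycles A n)).1 inferInstance
  rw [map_add, iCocycles_mk, iCocycles_mk, iCocycles_mk]

end Classes

/-! ### Products with operator-valued one-cocycles. -/

section Operators

variable {k G : Type} [CommRing k] [Group G] {A : Rep k G}

/-- The product of an operator-valued one-cochain `E` and a cochain `f`. -/
def opCup {n : ℕ} (E : G → (A →ₗ[k] A)) (f : (Fin n → G) → A) : (Fin (n + 1) → G) → A :=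
  fun γ => E (γ 0) (A.ρ (γ 0) (f (Fin.tail γ)))

theorem tail_contractNth_succ {n : ℕ} (γ : Fin (n + 2) → G) (i : Fin (n + 1)) :
    Fin.tail (Fin.contractNth i.succ (· * ·) γ) = Fin.contractNth i (· * ·) (Fin.tail γ) := by
  funext a
  simp only [Fin.tail, Fin.contractNth, Fin.val_succ, add_lt_add_iff_right, add_left_inj]
  rfl

/-- The hypothesis says that `E` is a one-cocycle in End(A) for the conjugation action, so this is
the Leibniz rule with dE = 0. Only the first contraction merges the argument of `E` with another
one, and there the cocycle identity splits it into two terms. -/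
theorem d_opCup {n : ℕ} (E : G → (A →ₗ[k] A))
    (hE : ∀ g h x, E (g * h) (A.ρ g (A.ρ h x)) = E g (A.ρ g (A.ρ h x)) + A.ρ g (E h (A.ρ h x)))
    (f : (Fin n → G) → A) (γ : Fin (n + 2) → G) :
    inhomogeneousCochains.d A (n + 1) (opCup E f) γ =
      - E (γ 0) (A.ρ (γ 0) (inhomogeneousCochains.d A n f (Fin.tail γ))) := by
  rw [inhomogeneousCochains.d_hom_apply, inhomogeneousCochains.d_hom_apply, Fin.sum_univ_succ]
  have h0 : opCup E f (Fin.contractNth 0 (· * ·) γ) =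
      E (γ 0 * γ 1) (A.ρ (γ 0) (A.ρ (γ 1) (f (Fin.tail (Fin.tail γ))))) := by
    have : Fin.tail (Fin.contractNth 0 (· * ·) γ) = Fin.tail (Fin.tail γ) := by
      funext a
      simp [Fin.tail, Fin.contractNth]
    unfold opCup
    rw [this, Fin.contractNth_apply_of_eq _ _ _ _ rfl]
    simp [Rep.ρ_mul]
  have h1 (i : Fin (n + 1)) : opCup E f (Fin.contractNth i.succ (· * ·) γ) =
      E (γ 0) (A.ρ (γ 0) (f (Fin.contractNth i (· * ·) (Fin.tail γ)))) := by
    unfold opCup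
    rw [tail_contractNth_succ, Fin.contractNth_apply_of_lt _ _ _ _ (by simp)]
    rfl
  have h2 : A.ρ (γ 0) (opCup E f fun i => γ i.succ) =
      A.ρ (γ 0) (E (γ 1) (A.ρ (γ 1) (f (Fin.tail (Fin.tail γ))))) := rfl
  have h3 : (f fun i => Fin.tail γ i.succ) = f (Fin.tail (Fin.tail γ)) := rfl
  have h4 : Fin.tail γ 0 = γ 1 := rfl
  rw [h0, hE, h2, h3, h4]
  simp only [h1, Fin.val_succ, Fin.val_zero, map_add, map_sum, map_smul, pow_succ _ (_ + 1),
    mul_neg_one, neg_smul, Finset.sum_neg_distrib]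
  simp only [zero_add, pow_one, neg_smul, one_smul, neg_add]
  abel

theorem d_opCup_eq_zero {n : ℕ} (E : G → (A →ₗ[k] A))
    (hE : ∀ g h x, E (g * h) (A.ρ g (A.ρ h x)) = E g (A.ρ g (A.ρ h x)) + A.ρ g (E h (A.ρ h x)))
    (f : (Fin n → G) → A) (hf : inhomogeneousCochains.d A n f = 0) :
    inhomogeneousCochains.d A (n + 1) (opCup E f) = 0 := by
  funext γ
  refine (d_opCup E hE f γ).trans ?_
  rw [hf]
  change - E (γ 0) (A.ρ (γ 0) 0) = 0
  rw [map_zero, map_zero, neg_zero]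

end Operators

/-! ### Antisymmetrization and products of linear forms on an abelian group. -/

section Antisymmetrization

variable {L : Type} [CommGroup L]

/-- The alternating sum of the values of a cochain on the permutations of a tuple. -/
def antisymm {n : ℕ} (e : Fin n → L) : ((Fin n → L) → ℤ) →+ ℤ where
  toFun f := ∑ σ : Equiv.Perm (Fin n), (σ.sign : ℤ) * f (e ∘ σ)
  map_zero' := by simp
  map_add' f g := by simp [mul_add, Finset.sum_add_distrib]

/-- Since L is commutative, exchanging the two multiplied arguments does not change the contracted
tuple, while it reverses the sign of the permutation. -/
theorem antisymm_comp_contractNth {n : ℕ} (e : Fin (n + 1) → L) (h : (Fin n → L) → ℤ)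
    (i : Fin (n + 1)) (hi : (i : ℕ) < n) :
    ∑ σ : Equiv.Perm (Fin (n + 1)), (σ.sign : ℤ) * h (Fin.contractNth i (· * ·) (e ∘ σ)) = 0 := by
  set j : Fin (n + 1) := ⟨i + 1, by omega⟩
  have hij : i ≠ j := by simp [j, Fin.ext_iff]
  have key (x : Fin (n + 1) → L) :
      Fin.contractNth i (· * ·) (x ∘ Equiv.swap i j) = Fin.contractNth i (· * ·) x := by
    funext a
    rcases lt_trichotomy (a : ℕ) i with ha | ha | ha
    · rw [Fin.contractNth_apply_of_lt _ _ _ _ ha, Fin.contractNth_apply_of_lt _ _ _ _ ha]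
      simp only [Function.comp_apply]
      rw [Equiv.swap_apply_of_ne_of_ne] <;> simp [j, Fin.ext_iff] <;> omega
    · rw [Fin.contractNth_apply_of_eq _ _ _ _ ha, Fin.contractNth_apply_of_eq _ _ _ _ ha]
      have h1 : a.castSucc = i := Fin.ext ha
      have h2 : a.succ = j := Fin.ext (by simp [j, ha])
      simp only [Function.comp_apply, h1, h2, Equiv.swap_apply_left, Equiv.swap_apply_right]
      exact mul_comm _ _
    · rw [Fin.contractNth_apply_of_gt _ _ _ _ ha, Fin.contractNth_apply_of_gt _ _ _ _ ha]
      simp only [Function.comp_apply]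
      rw [Equiv.swap_apply_of_ne_of_ne] <;> simp [j, Fin.ext_iff] <;> omega
  have h1 := Equiv.sum_comp (Equiv.mulRight (Equiv.swap i j)) fun σ : Equiv.Perm (Fin (n + 1)) =>
    (σ.sign : ℤ) * h (Fin.contractNth i (· * ·) (e ∘ σ))
  have h2 : ∀ σ : Equiv.Perm (Fin (n + 1)),
      ((Equiv.mulRight (Equiv.swap i j) σ).sign : ℤ) *
        h (Fin.contractNth i (· * ·) (e ∘ (Equiv.mulRight (Equiv.swap i j) σ))) =
      - ((σ.sign : ℤ) * h (Fin.contractNth i (· * ·) (e ∘ σ))) := by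
    intro σ
    rw [Equiv.coe_mulRight, Equiv.Perm.sign_mul, Equiv.Perm.sign_swap hij, Equiv.Perm.coe_mul,
      ← Function.comp_assoc, key]
    simp
  simp only [h2, Finset.sum_neg_distrib] at h1
  omega

/-- The inner faces vanish by commutativity. The two outer faces are exchanged by the cyclic
rotation, whose sign (-1)ⁿ is opposite to the sign (-1)ⁿ⁺¹ of the last face, so they cancel. -/
theorem antisymm_d {n : ℕ} (e : Fin (n + 1) → L) (h : (Fin n → L) → ℤ) :
    antisymm e (inhomogeneousCochains.d (Rep.trivial ℤ L ℤ) n h) = 0 := by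
  have h1 (g : Fin (n + 1) → L) : inhomogeneousCochains.d (Rep.trivial ℤ L ℤ) n h g =
      h (Fin.tail g) + (∑ i : Fin n,
        (-1) ^ ((i : ℕ) + 1) * h (Fin.contractNth i.castSucc (· * ·) g) +
        (-1) ^ (n + 1) * h (Fin.init g)) := by
    rw [inhomogeneousCochains.d_hom_apply, Fin.sum_univ_castSucc]
    congr 2
    have : Fin.contractNth (Fin.last n) (· * ·) g = Fin.init g := by
      funext a
      rw [Fin.contractNth_apply_of_lt _ _ _ _ (by simp)]
      rfl
    rw [this]
    simp
  have h2 : ∑ σ : Equiv.Perm (Fin (n + 1)), (σ.sign : ℤ) * h (Fin.init (e ∘ σ)) =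
      (-1) ^ n * ∑ σ : Equiv.Perm (Fin (n + 1)), (σ.sign : ℤ) * h (Fin.tail (e ∘ σ)) := by
    rw [← Equiv.sum_comp (Equiv.mulRight (finRotate (n + 1))), Finset.mul_sum]
    refine Finset.sum_congr rfl fun σ _ => ?_
    have : Fin.init (e ∘ (σ * finRotate (n + 1))) = Fin.tail (e ∘ σ) := by
      funext a
      simp [Fin.init, Fin.tail]
    rw [Equiv.coe_mulRight, this, Equiv.Perm.sign_mul, sign_finRotate]
    push_cast
    ring
  change ∑ σ : Equiv.Perm (Fin (n + 1)), (σ.sign : ℤ) *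
    (inhomogeneousCochains.d (Rep.trivial ℤ L ℤ) n h (e ∘ σ)) = 0
  simp only [h1, mul_add, Finset.sum_add_distrib, Finset.mul_sum]
  rw [Finset.sum_comm]
  have h3 : ∀ i : Fin n, ∑ σ : Equiv.Perm (Fin (n + 1)), (σ.sign : ℤ) *
      ((-1) ^ ((i : ℕ) + 1) * h (Fin.contractNth i.castSucc (· * ·) (e ∘ σ))) = 0 := by
    intro i
    simp only [mul_left_comm _ ((-1 : ℤ) ^ _)]
    rw [← Finset.mul_sum, antisymm_comp_contractNth e h _ (by simp), mul_zero]
  rw [Finset.sum_eq_zero fun i _ => h3 i, zero_add]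
  simp only [mul_left_comm _ ((-1 : ℤ) ^ _)]
  rw [← Finset.mul_sum, h2, ← mul_assoc, ← pow_add, show n + 1 + n = 2 * n + 1 by ring]
  simp [pow_succ, pow_mul]

end Antisymmetrization

section Forms

variable {L : Type} [CommGroup L]

/-- The cocycle `(l₁, …, lₙ) ↦ h₁(l₁) ⋯ hₙ(lₙ)`. -/
def formCochain {n : ℕ} (h : Fin n → (L →* Multiplicative ℤ)) : (Fin n → L) → ℤ :=
  fun l => ∏ a, (h a (l a)).toAdd

theorem d_formCochain {n : ℕ} (h : Fin n → (L →* Multiplicative ℤ)) :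
    inhomogeneousCochains.d (Rep.trivial ℤ L ℤ) n (formCochain h) = 0 := by
  induction n with
  | zero =>
    funext l
    rw [inhomogeneousCochains.d_hom_apply]
    simp [formCochain]
    rfl
  | succ n ih =>
    have h1 : formCochain h = opCup (A := Rep.trivial ℤ L ℤ)
        (fun l => LinearMap.mulLeft ℤ (h 0 l).toAdd) (formCochain (Fin.tail h)) := by
      funext l
      simp only [formCochain, Fin.prod_univ_succ]
      rfl
    rw [h1]
    refine d_opCup_eq_zero _ (fun g g' x => ?_) _ (ih _)
    change (h 0 (g * g')).toAdd * x = (h 0 g).toAdd * x + (h 0 g').toAdd * x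
    rw [map_mul, toAdd_mul, add_mul]

theorem antisymm_formCochain {n : ℕ} (h : Fin n → (L →* Multiplicative ℤ)) (e : Fin n → L) :
    antisymm e (formCochain h) = (Matrix.of fun b a => (h a (e b)).toAdd).det := by
  rw [Matrix.det_apply']
  rfl

/-- The antisymmetrization on cohomology with trivial coefficients. -/
def altMap {J : Type} {n : ℕ} (e : J → Fin n → L) : intCohomology L n →+ (J → ℤ) :=
  AddMonoidHom.mk' (fun x j => descend (antisymm (e j))
    (fun m hm h => by subst hm; rw [inhomogeneousCochains.d_def]; exact antisymm_d _ _) x)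
    (fun x y => by funext j; exact map_add _ x y)

theorem altMap_cohomClass {J : Type} {n : ℕ} (e : J → Fin n → L) (f : (Fin n → L) → ℤ)
    (hf : inhomogeneousCochains.d (Rep.trivial ℤ L ℤ) n f = 0) (j : J) :
    altMap e (cohomClass f hf) j = antisymm (e j) f :=
  descend_cohomClass (A := Rep.trivial ℤ L ℤ) (antisymm (e j))
    (fun m hm h => by subst hm; rw [inhomogeneousCochains.d_def]; exact antisymm_d _ _) f hf

end Forms

/-! ### The coinduced module of functions on the quotient and its cocycles. -/

section FunctionModule

variable {L C : Type} [CommGroup L] [Group C] (φ : C →* MulAut L)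

/-- The module of integral functions on the quotient `C` of `L ⋊ C`. -/
abbrev funRep : Rep ℤ (L ⋊[φ] C) :=
  Rep.of (X := C → ℤ)
    { toFun := fun γ => LinearMap.funLeft ℤ ℤ (fun k => γ.right⁻¹ * k)
      map_one' := by ext f k; simp
      map_mul' := fun γ γ' => by ext f k; simp [mul_assoc] }

/-- Right translation by `c`. -/
def rightTranslation (c : C) : funRep φ ⟶ funRep φ :=
  Rep.ofHom ⟨LinearMap.funLeft ℤ ℤ (fun k => k * c), fun γ => by
    ext f k; simp [mul_assoc]⟩

/-- Restriction to `L` followed by evaluation at `1`. -/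
def resEval (n : ℕ) : groupCohomology (funRep φ) n ⟶ intCohomology L n :=
  groupCohomology.map (A := funRep φ) (B := Rep.trivial ℤ L ℤ) SemidirectProduct.inl
    (Rep.ofHom ⟨LinearMap.proj 1, fun l => by ext f; change f _ = f _; simp⟩) n

/-- The product of the crossed homomorphisms `L ⋊ C → Fun(C, ℤ)` that extend the `hₐ`. -/
def twistedForm : {n : ℕ} → (Fin n → (L →* Multiplicative ℤ)) → (Fin n → L ⋊[φ] C) → (C → ℤ)
  | 0, _ => fun _ => 1
  | _ + 1, h => opCup (A := funRep φ)
      (fun γ => LinearMap.mulLeft ℤ (fun k => (h 0 (φ k⁻¹ γ.left)).toAdd))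
      (twistedForm (Fin.tail h))

/-- A homomorphism h on L extends to the crossed homomorphism sending γ to the function k ↦ h(φ(k⁻¹)
γ.left). The factor k⁻¹ is what makes it compatible with the twisted multiplication of the
semidirect product. -/
theorem d_twistedForm {n : ℕ} (h : Fin n → (L →* Multiplicative ℤ)) :
    inhomogeneousCochains.d (funRep φ) n (twistedForm φ h) = 0 := by
  induction n with
  | zero =>
    funext γ k
    rw [inhomogeneousCochains.d_hom_apply]
    simp [twistedForm, funRep]
    rfl
  | succ n ih =>
    refine d_opCup_eq_zero _ (fun g g' x => ?_) _ (ih _)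
    funext k
    have key : (h 0 (φ k⁻¹ (g * g').left)).toAdd = (h 0 (φ k⁻¹ g.left)).toAdd +
        (h 0 (φ (g.right⁻¹ * k)⁻¹ g'.left)).toAdd := by
      rw [← toAdd_mul, ← map_mul (h 0), SemidirectProduct.mul_left, mul_inv_rev, inv_inv,
        map_mul φ, MulAut.mul_apply, map_mul (φ k⁻¹)]
    exact (congrArg (fun y => y * (x (g'.right⁻¹ * (g.right⁻¹ * k)) : ℤ)) key).trans
      (add_mul _ _ _)

/-- The value at k of the extended form is the form pulled back by φ(k⁻¹). Hence right translation
of functions realizes the action of C on the cohomology of L. -/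
theorem twistedForm_inl {n : ℕ} (h : Fin n → (L →* Multiplicative ℤ)) (l : Fin n → L) (k : C) :
    twistedForm φ h (SemidirectProduct.inl ∘ l) k =
      formCochain (fun a => (h a).comp (φ k⁻¹).toMonoidHom) l := by
  induction n with
  | zero => simp [twistedForm, formCochain]
  | succ n ih =>
    have := ih (Fin.tail h) (Fin.tail l)
    simp only [formCochain, Fin.prod_univ_succ] at this ⊢
    refine Eq.trans ?_ (congrArg (fun x => (h 0 (φ k⁻¹ (l 0))).toAdd * x) this)
    simp only [twistedForm, opCup]
    change _ * twistedForm φ (Fin.tail h) (SemidirectProduct.inl ∘ Fin.tail l) ((1 : C)⁻¹ * k) = _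
    rw [inv_one, one_mul]
    rfl

end FunctionModule

/-! ### Coordinates on free modules and the action of C by compound matrices. -/

section FreeModules

/-- A surjection between free abelian groups of the same finite rank is bijective. -/
theorem bijective_of_surjective_of_card {A J J' : Type} [AddCommGroup A] [Fintype J] [Fintype J']
    (f : A →+ (J → ℤ)) (hf : Function.Surjective f) (e : A ≃+ (J' → ℤ))
    (hJ : Fintype.card J' = Fintype.card J) : Function.Bijective f := by
  let σ : J ≃ J' := (Fintype.equivOfCardEq hJ).symm
  let g : (J → ℤ) →+ (J → ℤ) :=
    f.comp (e.symm.toAddMonoidHom.comp (LinearEquiv.funCongrLeft ℤ ℤ σ.symm).toAddMonoidHom)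
  have hg : Function.Surjective g := hf.comp (e.symm.surjective.comp (LinearEquiv.surjective _))
  have hb : Function.Bijective g.toIntLinearMap :=
    OrzechProperty.bijective_of_surjective_endomorphism g.toIntLinearMap hg
  have h2 : Function.Bijective (e.symm.toAddMonoidHom.comp
      (LinearEquiv.funCongrLeft ℤ ℤ σ.symm).toAddMonoidHom) :=
    e.symm.bijective.comp (LinearEquiv.bijective _)
  exact (Function.Bijective.of_comp_iff f h2).1 hb

variable {A J : Type} [AddCommGroup A] [Fintype J] [DecidableEq J]

theorem surjective_of_dual (f : A →+ (J → ℤ)) (w : J → A) (hw : ∀ i, f (w i) = Pi.single i 1) :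
    Function.Surjective f := fun c =>
  ⟨∑ i, c i • w i, by
    rw [map_sum]
    funext j
    simp [hw, Pi.single_apply]⟩

/-- Coordinates are row vectors and matrices act from the right, with the i-th row given by the
image of the i-th dual element. This convention is kept throughout. -/
theorem apply_eq_vecMul (f : A →+ (J → ℤ)) (hf : Function.Injective f) (w : J → A)
    (hw : ∀ i, f (w i) = Pi.single i 1) (R : A →+ A) (M : Matrix J J ℤ)
    (hR : ∀ i, f (R (w i)) = M i) (x : A) : f (R x) = Matrix.vecMul (f x) M := by
  have hx : x = ∑ i, f x i • w i := by
    apply hf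
    rw [map_sum]
    funext j
    simp [hw, Pi.single_apply]
  conv_lhs => rw [hx]
  rw [map_sum, map_sum]
  funext j
  simp [hR, Matrix.vecMul, dotProduct]

end FreeModules

/-- A family of homomorphisms to `ℤ` with a dual family of elements. -/
structure Coords (L : Type) [CommGroup L] (ι : Type) [DecidableEq ι] where
  X : ι → (L →* Multiplicative ℤ)
  e : ι → L
  dual : ∀ a b, (X a (e b)).toAdd = if a = b then 1 else 0

/-- A family of `n`-tuples whose minors in the identity matrix are those of the family of
increasing `n`-tuples. -/
def IsMinorIndex {ι J : Type} [DecidableEq ι] [DecidableEq J] {n : ℕ} (t : J → Fin n → ι) : Prop :=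
  ∀ i j, ((1 : Matrix ι ι ℤ).submatrix (t i) (t j)).det = if i = j then 1 else 0

/-- The matrix of minors of `A` for a family of tuples. -/
def minors {ι J : Type} {n : ℕ} (t : J → Fin n → ι) (A : Matrix ι ι ℤ) : Matrix J J ℤ :=
  Matrix.of fun i j => (A.submatrix (t i) (t j)).det

section Action

variable {L C ι J : Type} [CommGroup L] [Group C] (φ : C →* MulAut L) [DecidableEq ι]
  (K : Coords L ι) [Fintype J] [DecidableEq J] {n : ℕ} (t : J → Fin n → ι)

/-- The class of the product of the coordinates of a tuple. -/
def formClass (h : Fin n → (L →* Multiplicative ℤ)) : intCohomology L n :=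
  cohomClass (formCochain h) (d_formCochain h)

theorem altMap_formClass (h : Fin n → (L →* Multiplicative ℤ)) (e : J → Fin n → L) (j : J) :
    altMap e (formClass h) j = (Matrix.of fun a b => (h a (e j b)).toAdd).det := by
  rw [formClass, altMap_cohomClass, antisymm_formCochain, ← Matrix.det_transpose]
  rfl

theorem altMap_formClass_coords (ht : IsMinorIndex t) (i : J) :
    altMap (fun j a => K.e (t j a)) (formClass fun a => K.X (t i a)) = Pi.single i 1 := by
  funext j
  rw [altMap_formClass, Pi.single_apply]
  simp only [K.dual, eq_comm (a := j)]
  exact ht i j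

/-- The products of coordinates give surjectivity. The abstract isomorphism `E` enters only through
its rank, since a surjection between free groups of equal finite rank is bijective. An induction
that loses track of explicit isomorphisms is therefore enough. -/
theorem altMap_bijective (ht : IsMinorIndex t) {J' : Type} [Fintype J']
    (E : intCohomology L n ≃+ (J' → ℤ)) (hJ : Fintype.card J' = Fintype.card J) :
    Function.Bijective (altMap (n := n) fun j a => K.e (t j a)) :=
  bijective_of_surjective_of_card _
    (surjective_of_dual _ _ (altMap_formClass_coords K t ht)) E hJ

/-- The class of the product of crossed homomorphisms. -/
def twistedClass (h : Fin n → (L →* Multiplicative ℤ)) : groupCohomology (funRep φ) n :=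
  cohomClass (twistedForm φ h) (d_twistedForm φ h)

theorem resEval_twistedClass (h : Fin n → (L →* Multiplicative ℤ)) :
    resEval φ n (twistedClass φ h) = formClass h := by
  obtain ⟨h1, h2⟩ := map_cohomClass (A := funRep φ) (B := Rep.trivial ℤ L ℤ)
    SemidirectProduct.inl (Rep.ofHom ⟨LinearMap.proj 1, fun l => by ext f; change f _ = f _; simp⟩)
    (twistedForm φ h) (d_twistedForm φ h)
  refine h2.trans ?_
  unfold formClass
  congr 1
  funext l
  refine (twistedForm_inl φ h l 1).trans ?_
  simp
  rfl

/-- Translating by c and then evaluating at 1 is evaluating at c, where the twisted form is the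
pull-back by φ(c⁻¹). -/
theorem rightTranslation_twistedClass (c : C) (h : Fin n → (L →* Multiplicative ℤ)) :
    resEval φ n (groupCohomology.map (MonoidHom.id _) (rightTranslation φ c) n
      (twistedClass φ h)) = formClass fun a => (h a).comp (φ c⁻¹).toMonoidHom := by
  obtain ⟨h1, h2⟩ := map_cohomClass (A := funRep φ) (B := funRep φ)
    (MonoidHom.id _) (rightTranslation φ c) (twistedForm φ h) (d_twistedForm φ h)
  obtain ⟨h3, h4⟩ := map_cohomClass (A := funRep φ) (B := Rep.trivial ℤ L ℤ)
    SemidirectProduct.inl (Rep.ofHom ⟨LinearMap.proj 1, fun l => by ext f; change f _ = f _; simp⟩)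
    _ h1
  refine (congrArg _ h2).trans (h4.trans ?_)
  unfold formClass
  congr 1
  funext l
  refine Eq.trans ?_ (twistedForm_inl φ h l c)
  change twistedForm φ h _ (1 * c) = _
  rw [one_mul]
  rfl

/-- Coordinates on the cohomology of `Fun(C, ℤ)`. -/
def twistedAltMap : groupCohomology (funRep φ) n →+ (J → ℤ) :=
  (altMap fun j a => K.e (t j a)).comp (resEval φ n).hom.toAddMonoidHom

theorem twistedAltMap_apply (x : groupCohomology (funRep φ) n) :
    twistedAltMap φ K t x = altMap (fun j a => K.e (t j a)) (resEval φ n x) := rfl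

theorem twistedAltMap_twistedClass (ht : IsMinorIndex t) (i : J) :
    twistedAltMap φ K t (twistedClass φ fun a => K.X (t i a)) = Pi.single i 1 := by
  rw [twistedAltMap_apply, resEval_twistedClass, altMap_formClass_coords K t ht]

theorem twistedAltMap_bijective (ht : IsMinorIndex t) {J' : Type} [Fintype J']
    (E : groupCohomology (funRep φ) n ≃+ (J' → ℤ)) (hJ : Fintype.card J' = Fintype.card J) :
    Function.Bijective (twistedAltMap (n := n) φ K t) :=
  bijective_of_surjective_of_card _
    (surjective_of_dual _ _ (twistedAltMap_twistedClass φ K t ht)) E hJ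

/-- The matrix of the pull-back along the inverse of `c`. -/
def Coords.actMatrix (c : C) : Matrix ι ι ℤ :=
  Matrix.of fun a b => (K.X a (φ c⁻¹ (K.e b))).toAdd

theorem altMap_formClass_comp (c : C) (i : J) :
    altMap (fun j a => K.e (t j a)) (formClass fun a => (K.X (t i a)).comp (φ c⁻¹).toMonoidHom) =
      minors t (K.actMatrix φ c) i := by
  funext j
  rw [altMap_formClass]
  rfl

/-- The map on cohomology induced by a right translation. -/
def rightTranslationMap (n : ℕ) (c : C) :
    groupCohomology (funRep φ) n →+ groupCohomology (funRep φ) n :=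
  (groupCohomology.map (MonoidHom.id _) (rightTranslation φ c) n).hom.toAddMonoidHom

/-- The action is read on the explicit twisted classes, so Shapiro's isomorphism never has to be
followed through it. -/
theorem twistedAltMap_rightTranslation (ht : IsMinorIndex t)
    (hb : Function.Injective (twistedAltMap (n := n) φ K t)) (c : C)
    (x : groupCohomology (funRep φ) n) :
    twistedAltMap φ K t (rightTranslationMap φ n c x) =
      Matrix.vecMul (twistedAltMap φ K t x) (minors t (K.actMatrix φ c)) :=
  apply_eq_vecMul (twistedAltMap (n := n) φ K t) hb
    (fun i => twistedClass φ fun a => K.X (t i a)) (twistedAltMap_twistedClass φ K t ht)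
    (rightTranslationMap φ n c) _ (fun i =>
      (congrArg _ (rightTranslation_twistedClass φ c _)).trans
        (altMap_formClass_comp φ K t c i)) x

theorem pullback_formClass (c : C) (h : Fin n → (L →* Multiplicative ℤ)) :
    pullback (φ c⁻¹).toMonoidHom n (formClass h) =
      formClass fun a => (h a).comp (φ c⁻¹).toMonoidHom := by
  obtain ⟨h1, h2⟩ := map_cohomClass (A := Rep.trivial ℤ L ℤ) (B := Rep.trivial ℤ L ℤ)
    (φ c⁻¹).toMonoidHom (Rep.ofHom ⟨LinearMap.id, fun _ => rfl⟩)
    (formCochain h) (d_formCochain _)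
  exact h2

theorem altMap_pullback (ht : IsMinorIndex t)
    (hb : Function.Injective (altMap (n := n) fun j a => K.e (t j a))) (c : C)
    (x : intCohomology L n) :
    altMap (fun j a => K.e (t j a)) (pullback (φ c⁻¹).toMonoidHom n x) =
      Matrix.vecMul (altMap (fun j a => K.e (t j a)) x) (minors t (K.actMatrix φ c)) := by
  refine apply_eq_vecMul (altMap (n := n) fun j a => K.e (t j a)) hb
    (fun i => formClass fun a => K.X (t i a)) (altMap_formClass_coords K t ht)
    (pullback (φ c⁻¹).toMonoidHom n).hom.toAddMonoidHom _ (fun i => ?_) x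
  rw [← altMap_formClass_comp, ← pullback_formClass]
  rfl

end Action

/-! ### Shapiro's lemma for functions on the quotient. -/

section Shapiro

variable {L C : Type} [CommGroup L] [Group C] (φ : C →* MulAut L)

/-- The copy of `L` in `L ⋊ C`. -/
abbrev leftSubgroup : Subgroup (L ⋊[φ] C) := (SemidirectProduct.inl : L →* L ⋊[φ] C).range

theorem mem_leftSubgroup (γ : L ⋊[φ] C) : γ ∈ leftSubgroup φ ↔ γ.right = 1 := by
  change γ ∈ (SemidirectProduct.inl : L →* L ⋊[φ] C).range ↔ _
  rw [SemidirectProduct.range_inl_eq_ker_rightHom]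
  rfl

/-- Functions on `C` are coinduced from `L`. -/
def funEquivCoind : (C → ℤ) ≃ₗ[ℤ]
    Representation.coindV (leftSubgroup φ).subtype (Rep.trivial ℤ (leftSubgroup φ) ℤ).ρ where
  toFun f := ⟨fun γ => f γ.right⁻¹, fun s γ => by
    have := (mem_leftSubgroup φ s.1).1 s.2
    simp [this]⟩
  map_add' f g := rfl
  map_smul' c f := rfl
  invFun F k := F.1 (SemidirectProduct.inr k⁻¹)
  left_inv f := by ext k; simp
  right_inv F := by
    ext γ
    -- Invariance under L moves γ to the element of the complement with the same image in C.
    have h := F.2 ⟨SemidirectProduct.inl γ.left⁻¹, ⟨γ.left⁻¹, rfl⟩⟩ γ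
    refine Eq.trans (congrArg F.1 ?_) h
    ext <;> simp

/-- Functions on `C` form a coinduced representation. -/
def funRepIso : funRep φ ≅ Rep.coind (leftSubgroup φ).subtype (Rep.trivial ℤ (leftSubgroup φ) ℤ) :=
  Rep.mkIso (Representation.Equiv.mk (funEquivCoind φ) fun γ => by
    refine LinearMap.ext fun f => Subtype.ext (funext fun γ' => ?_)
    change f (γ.right⁻¹ * γ'.right⁻¹) = f (γ' * γ).right⁻¹
    simp)

/-- Shapiro's lemma for the module of functions on the quotient. -/
def shapiro (n : ℕ) : groupCohomology (funRep φ) n ≃+ intCohomology L n :=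
  (((groupCohomology.functor ℤ _ n).mapIso (funRepIso φ)) ≪≫
    groupCohomology.coindIso (Rep.trivial ℤ (leftSubgroup φ) ℤ) n ≪≫
    (groupCohomology.mapIso (A := Rep.trivial ℤ L ℤ) (B := Rep.trivial ℤ (leftSubgroup φ) ℤ)
      (MonoidHom.ofInjective SemidirectProduct.inl_injective).symm
      (LinearEquiv.refl ℤ ℤ) (fun _ => rfl) n)).toLinearEquiv.toAddEquiv

end Shapiro

/-! ### Long exact sequences in the coefficients, minors and splittings. -/

section Exactness

variable {G : Type} [Group G]

theorem shortExact_of_exact {k : Type} [CommRing k] {X : ShortComplex (Rep.{0} k G)} (hf :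
    Function.Injective X.f.hom)
    (hg : Function.Surjective X.g.hom) (h : ∀ x, X.g.hom x = 0 → ∃ y, X.f.hom y = x) :
    X.ShortExact where
  exact := by
    rw [← ShortComplex.exact_map_iff_of_faithful X (forget₂ (Rep k G) (ModuleCat k)),
      ShortComplex.moduleCat_exact_iff]
    exact h
  mono_f := (Rep.mono_iff_injective _).2 hf
  epi_g := (Rep.epi_iff_surjective _).2 hg

variable {X : ShortComplex (Rep.{0} ℤ G)} (hX : X.ShortExact) (n : ℕ)

/-- The maps on cohomology induced by a map of coefficients. -/
def coeffMap {A B : Rep ℤ G} (f : A ⟶ B) (n : ℕ) : groupCohomology A n →+ groupCohomology B n :=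
  (groupCohomology.map (MonoidHom.id G) f n).hom.toAddMonoidHom

theorem coeffMap_comp {A B C : Rep ℤ G} (f : A ⟶ B) (g : B ⟶ C) (n : ℕ) (x : groupCohomology A n) :
    coeffMap (f ≫ g) n x = coeffMap g n (coeffMap f n x) :=
  congr($(groupCohomology.map_id_comp f g n) x)

theorem coeffMap_id {A : Rep ℤ G} (n : ℕ) (x : groupCohomology A n) : coeffMap (𝟙 A) n x = x :=
  congr($(groupCohomology.map_id n) x)

theorem coeffMap_cohomClass {A B : Rep ℤ G} (f : A ⟶ B) {n : ℕ} (c : (Fin n → G) → A)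
    (h : inhomogeneousCochains.d A n c = 0) :
    ∃ h', coeffMap f n (cohomClass c h) = cohomClass (fun γ => f.hom (c γ)) h' :=
  map_cohomClass (MonoidHom.id G) f c h

theorem coeffMap_add {A B : Rep ℤ G} (f g : A ⟶ B) (n : ℕ) (x : groupCohomology A n) :
    coeffMap (f + g) n x = coeffMap f n x + coeffMap g n x := by
  obtain ⟨c, h, rfl⟩ := exists_cohomClass x
  obtain ⟨h1, e1⟩ := coeffMap_cohomClass f c h
  obtain ⟨h2, e2⟩ := coeffMap_cohomClass g c h
  obtain ⟨h3, e3⟩ := coeffMap_cohomClass (f + g) c h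
  obtain ⟨h4, e4⟩ := cohomClass_add _ _ h1 h2
  rw [e1, e2, e3, e4]
  rfl

/-- The connecting homomorphism. -/
def connecting : groupCohomology X.X₃ n →+ groupCohomology X.X₁ (n + 1) :=
  (groupCohomology.δ hX n (n + 1) rfl).hom.toAddMonoidHom

include hX in
theorem exists_of_coeffMap_eq_zero (x : groupCohomology X.X₂ n) (h : coeffMap X.g n x = 0) :
    ∃ y, coeffMap X.f n y = x :=
  (ShortComplex.moduleCat_exact_iff _).1 (mapShortComplex₂_exact hX n) x h

theorem exists_of_coeffMap_f_eq_zero (x : groupCohomology X.X₁ (n + 1))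
    (h : coeffMap X.f (n + 1) x = 0) : ∃ y, connecting hX n y = x :=
  (ShortComplex.moduleCat_exact_iff _).1 (mapShortComplex₁_exact hX (i := n) rfl) x h

theorem exists_of_connecting_eq_zero (x : groupCohomology X.X₃ n) (h : connecting hX n x = 0) :
    ∃ y, coeffMap X.g n y = x :=
  (ShortComplex.moduleCat_exact_iff _).1 (mapShortComplex₃_exact hX (i := n) rfl) x h

theorem connecting_coeffMap (x : groupCohomology X.X₂ n) :
    connecting hX n (coeffMap X.g n x) = 0 :=
  congr($((mapShortComplex₃ hX (i := n) rfl).zero) x)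

theorem coeffMap_connecting (x : groupCohomology X.X₃ n) :
    coeffMap X.f (n + 1) (connecting hX n x) = 0 :=
  congr($((mapShortComplex₁ hX (i := n) rfl).zero) x)

include hX in
theorem coeffMap_zero_injective : Function.Injective (coeffMap X.f 0) := by
  have := hX.mono_f
  exact (ModuleCat.mono_iff_injective _).1 (mono_map_0_of_mono X.f)

end Exactness

section MinorIndex

/-- The increasing enumeration of a finite set. -/
def subsetIndex (n j : ℕ) (s : {s : Finset (Fin n) // s.card = j}) : Fin j → Fin n :=
  s.1.orderEmbOfFin s.2

/-- Two distinct subsets of the same size have an element of the first outside the second. It gives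
a zero row in the minor of the identity matrix. -/
theorem isMinorIndex_subsetIndex (n j : ℕ) : IsMinorIndex (subsetIndex n j) := by
  intro s s'
  split_ifs with h
  · subst h
    rw [Matrix.submatrix_one (subsetIndex n j s) (s.1.orderEmbOfFin s.2).injective,
      Matrix.det_one]
  · have h1 : ¬ s.1 ⊆ s'.1 := fun h' =>
      h (Subtype.ext (Finset.eq_of_subset_of_card_le h' (by rw [s.2, s'.2])))
    obtain ⟨x, hx, hx'⟩ := Finset.not_subset.1 h1
    have hr : x ∈ Set.range (s.1.orderEmbOfFin s.2) := by
      rw [Finset.range_orderEmbOfFin]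
      exact hx
    obtain ⟨a, ha⟩ := hr
    refine Matrix.det_eq_zero_of_row_eq_zero a fun b => ?_
    rw [Matrix.submatrix_apply, Matrix.one_apply_ne]
    intro hab
    refine hx' ?_
    rw [← ha]
    change subsetIndex n j s a ∈ _
    rw [hab]
    exact Finset.orderEmbOfFin_mem _ _ _

theorem card_subsetIndex (n j : ℕ) :
    Fintype.card {s : Finset (Fin n) // s.card = j} = n.choose j := by
  rw [Fintype.card_finset_len, Fintype.card_fin]

theorem minors_one {ι J : Type} [DecidableEq ι] [DecidableEq J] {n : ℕ} {t : J → Fin n → ι}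
    (ht : IsMinorIndex t) : minors t (1 : Matrix ι ι ℤ) = 1 := by
  ext i j
  rw [Matrix.one_apply]
  exact ht i j

end MinorIndex

section Splitting

/-- An extension of a finitely generated free abelian group splits. -/
theorem exists_addEquiv_prod {A B J : Type} [AddCommGroup A] [AddCommGroup B] [Fintype J]
    [DecidableEq J] (f : A →+ B) (g : B →+ (J → ℤ)) (hf : Function.Injective f)
    (hg : Function.Surjective g) (h0 : ∀ a, g (f a) = 0) (h : ∀ b, g b = 0 → ∃ a, f a = b) :
    Nonempty (B ≃+ A × (J → ℤ)) := by
  choose w hw using fun i : J => hg (Pi.single i 1)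
  let s : (J → ℤ) →+ B :=
    { toFun := fun c => ∑ i, c i • w i
      map_zero' := by simp
      map_add' := by intro c c'; simp [add_smul, Finset.sum_add_distrib] }
  have hs (c : J → ℤ) : g (s c) = c := by
    change g (∑ i, c i • w i) = c
    rw [map_sum]
    funext j
    simp [hw, Pi.single_apply]
  refine ⟨(AddEquiv.ofBijective (f.coprod s) ⟨?_, ?_⟩).symm⟩
  · rw [injective_iff_map_eq_zero]
    rintro ⟨a, c⟩ hac
    rw [AddMonoidHom.coprod_apply] at hac
    have h1 := congrArg g hac
    rw [map_add, h0, hs, zero_add, map_zero] at h1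
    dsimp only at h1
    subst h1
    rw [map_zero, add_zero] at hac
    have h2 : a = 0 := hf (hac.trans (map_zero f).symm)
    rw [h2]
    rfl
  · intro b
    obtain ⟨a, ha⟩ := h (b - s (g b)) (by rw [map_sub, hs, sub_self])
    exact ⟨(a, g b), by rw [AddMonoidHom.coprod_apply, ha, sub_add_cancel]⟩

end Splitting

/-! ### The integral cohomology of ℤⁿ, by adjoining one infinite cyclic factor at a time. -/

section InfiniteCyclic

variable {L C : Type} [CommGroup L] [Group C] (φ : C →* MulAut L)

/-- The constant functions. -/
def constMap : Rep.trivial ℤ (L ⋊[φ] C) ℤ ⟶ funRep φ :=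
  Rep.ofHom ⟨LinearMap.pi fun _ => LinearMap.id, fun γ => by ext; rfl⟩

theorem constMap_injective : Function.Injective (constMap φ).hom := fun _ _ h => congrFun h 1

/-- The difference of a right translation and the identity. -/
def diffMap (c : C) : funRep φ ⟶ funRep φ := rightTranslation φ c - 𝟙 _

theorem coeffMap_diffMap (c : C) (n : ℕ) (x : groupCohomology (funRep φ) n) :
    coeffMap (diffMap φ c) n x = rightTranslationMap φ n c x - x := by
  have h := coeffMap_add (diffMap φ c) (𝟙 _) n x
  rw [coeffMap_id, diffMap, sub_add_cancel] at h
  exact eq_sub_of_add_eq h.symm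

/-- Summation on the integers. -/
theorem exists_diff_eq (f : ℤ → ℤ) : ∃ h : ℤ → ℤ, ∀ k, h (k + 1) - h k = f k := by
  refine ⟨fun k => ∑ i ∈ Finset.range k.toNat, f i -
    ∑ i ∈ Finset.range (-k).toNat, f (-1 - i), fun k => ?_⟩
  obtain ⟨n, rfl | rfl⟩ := k.eq_nat_or_neg
  · simp only [Int.toNat_natCast, Int.toNat_neg_natCast, Finset.range_zero, Finset.sum_empty]
    rw [show ((n : ℤ) + 1).toNat = n + 1 by omega, show (-((n : ℤ) + 1)).toNat = 0 by omega,
      Finset.sum_range_succ]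
    simp
  · cases n with
    | zero => simp
    | succ n =>
      beta_reduce
      rw [show (-((n + 1 : ℕ) : ℤ) + 1).toNat = 0 by omega,
        show (-((n + 1 : ℕ) : ℤ)).toNat = 0 by omega,
        show (-(-((n + 1 : ℕ) : ℤ) + 1)).toNat = n by omega,
        show (- -((n + 1 : ℕ) : ℤ)).toNat = n + 1 by omega, Finset.sum_range_succ]
      have : (-1 - (n : ℤ)) = -((n + 1 : ℕ) : ℤ) := by push_cast; ring
      rw [this]
      simp

variable (φ : Multiplicative ℤ →* MulAut L)

/-- The sequence `0 → ℤ → Fun(ℤ, ℤ) → Fun(ℤ, ℤ) → 0`. -/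
def intSequence : ShortComplex (Rep ℤ (L ⋊[φ] Multiplicative ℤ)) :=
  ShortComplex.mk (constMap φ) (diffMap φ (Multiplicative.ofAdd 1))
    (Rep.hom_ext (Representation.IntertwiningMap.ext
      (LinearMap.ext fun x => funext fun _ => sub_self (x : ℤ))))

theorem intSequence_shortExact : (intSequence φ).ShortExact := by
  refine shortExact_of_exact (constMap_injective φ) (fun f => ?_) (fun f hf => ?_)
  · obtain ⟨h, hh⟩ := exists_diff_eq fun k => f (Multiplicative.ofAdd k)
    exact ⟨fun k => h k.toAdd, funext fun k => hh k.toAdd⟩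
  · have h1 : ∀ k : ℤ, f (Multiplicative.ofAdd (k + 1)) = f (Multiplicative.ofAdd k) := fun k =>
      sub_eq_zero.1 (congrFun hf (Multiplicative.ofAdd k))
    refine ⟨f 1, funext fun k => ?_⟩
    change f 1 = f k
    have h2 : ∀ k : ℤ, f (Multiplicative.ofAdd k) = f 1 := fun k => by
      induction k using Int.induction_on with
      | zero => rfl
      | succ i ih => rw [h1, ih]
      | pred i ih => rw [← ih, ← h1, sub_add_cancel]
    exact (h2 k.toAdd).symm

end InfiniteCyclic

section FreeAbelian

/-- The coordinates of `ℤⁿ`. -/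
def stdCoords (n : ℕ) : Coords (Multiplicative (Fin n → ℤ)) (Fin n) where
  X a := AddMonoidHom.toMultiplicative (Pi.evalAddMonoidHom (fun _ => ℤ) a)
  e b := Multiplicative.ofAdd (Pi.single b 1)
  dual a b := by
    change Pi.single (M := fun _ => ℤ) b 1 a = _
    rw [Pi.single_apply]

/-- The cohomology in degree zero. -/
def cohomologyZero (L : Type) [Group L] : intCohomology L 0 ≃+ ℤ :=
  (H0IsoOfIsTrivial (Rep.trivial ℤ L ℤ)).toLinearEquiv.toAddEquiv

theorem nonempty_fin_one (A : Type) [AddCommGroup A] (e : A ≃+ ℤ) (m : ℕ) (hm : m = 1) :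
    Nonempty (A ≃+ (Fin m → ℤ)) := by
  subst hm
  exact ⟨e.trans (LinearEquiv.funUnique (Fin 1) ℤ ℤ).symm.toAddEquiv⟩

/-- `ℤⁿ⁺¹` as a direct product. -/
def latticeSuccEquiv (n : ℕ) : Multiplicative (Fin (n + 1) → ℤ) ≃*
    Multiplicative (Fin n → ℤ) ⋊[(1 : Multiplicative ℤ →* _)] Multiplicative ℤ where
  toFun v := ⟨Multiplicative.ofAdd (Fin.tail v.toAdd), Multiplicative.ofAdd (v.toAdd 0)⟩
  invFun γ := Multiplicative.ofAdd (Fin.cons γ.right.toAdd γ.left.toAdd)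
  left_inv v := Fin.cons_self_tail v.toAdd
  right_inv _ := rfl
  map_mul' _ _ := rfl

/-- This is the Wang sequence of L × ℤ. The action is trivial, so right translation is the identity
in coordinates and the difference map induces zero. The long exact sequence then breaks into short
ones, which split because H^{n+1}(L) is free. -/
theorem cohomology_semidirect_int {L ι J₁ J₂ : Type} [CommGroup L] [DecidableEq ι] [Fintype J₁]
    [DecidableEq J₁] [Fintype J₂] [DecidableEq J₂] (K : Coords L ι) (n : ℕ)
    (t₁ : J₁ → Fin n → ι) (t₂ : J₂ → Fin (n + 1) → ι) (ht₁ : IsMinorIndex t₁)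
    (ht₂ : IsMinorIndex t₂) (E₁ : intCohomology L n ≃+ (J₁ → ℤ))
    (E₂ : intCohomology L (n + 1) ≃+ (J₂ → ℤ)) :
    Nonempty (intCohomology (L ⋊[(1 : Multiplicative ℤ →* MulAut L)] Multiplicative ℤ) (n + 1) ≃+
      (J₁ → ℤ) × (J₂ → ℤ)) := by
  have hact (c : Multiplicative ℤ) : K.actMatrix (1 : Multiplicative ℤ →* MulAut L) c = 1 := by
    ext a b
    rw [Matrix.one_apply]
    exact K.dual a b
  have hR {m : ℕ} {J : Type} [Fintype J] [DecidableEq J] (t : J → Fin m → ι)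
      (ht : IsMinorIndex t) (E : intCohomology L m ≃+ (J → ℤ)) (c : Multiplicative ℤ)
      (x : groupCohomology (funRep (1 : Multiplicative ℤ →* MulAut L)) m) :
      coeffMap (diffMap (1 : Multiplicative ℤ →* MulAut L) c) m x = 0 := by
    have hb := twistedAltMap_bijective (1 : Multiplicative ℤ →* MulAut L) K t ht ((shapiro 1
        m).trans E) rfl
    rw [coeffMap_diffMap, sub_eq_zero]
    apply hb.1
    rw [twistedAltMap_rightTranslation _ _ _ ht hb.1, hact, minors_one ht, Matrix.vecMul_one]
  have hX := intSequence_shortExact (1 : Multiplicative ℤ →* MulAut L)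
  let E₂' := (shapiro (1 : Multiplicative ℤ →* MulAut L) (n + 1)).trans E₂
  let E₁' := (shapiro (1 : Multiplicative ℤ →* MulAut L) n).trans E₁
  obtain ⟨e⟩ := exists_addEquiv_prod (connecting hX n)
    (E₂'.toAddMonoidHom.comp (coeffMap (constMap 1) (n + 1)))
    ((injective_iff_map_eq_zero _).2 fun x hx => by
      obtain ⟨y, rfl⟩ := exists_of_connecting_eq_zero hX n x hx
      exact hR t₁ ht₁ E₁ _ y)
    (fun c => by
      obtain ⟨y, hy⟩ := exists_of_coeffMap_eq_zero hX (n + 1) (E₂'.symm c) (hR t₂ ht₂ E₂ _ _)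
      exact ⟨y, (congrArg E₂' hy).trans (E₂'.apply_symm_apply c)⟩)
    (fun x => (congrArg E₂' (coeffMap_connecting hX n x)).trans (map_zero E₂'))
    (fun x hx => exists_of_coeffMap_f_eq_zero hX n x
      (E₂'.injective (hx.trans (map_zero E₂').symm)))
  exact ⟨e.trans (AddEquiv.prodCongr E₁' (AddEquiv.refl _))⟩

/-- The integral cohomology of `ℤⁿ`. -/
theorem cohomology_lattice (n : ℕ) :
    ∀ j, Nonempty (intCohomology (Multiplicative (Fin n → ℤ)) j ≃+ (Fin (n.choose j) → ℤ)) := by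
  induction n with
  | zero =>
    intro j
    cases j with
    | zero => exact nonempty_fin_one _ (cohomologyZero _) _ rfl
    | succ j =>
      have h := ModuleCat.subsingleton_of_isZero
        (isZero_groupCohomology_succ_of_subsingleton (Rep.trivial ℤ (Multiplicative (Fin 0 → ℤ)) ℤ)
            j)
      have h2 : IsEmpty (Fin (Nat.choose 0 (j + 1))) := by
        rw [Nat.choose_zero_succ]
        infer_instance
      exact ⟨{ toFun := 0, invFun := 0, left_inv := fun _ => Subsingleton.elim _ _,
               right_inv := fun _ => Subsingleton.elim _ _, map_add' := fun _ _ => (add_zero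
                   _).symm }⟩
  | succ n ih =>
    intro j
    cases j with
    | zero => exact nonempty_fin_one _ (cohomologyZero _) _ (Nat.choose_zero_right _)
    | succ j =>
      have hE (i : ℕ) : Nonempty (intCohomology (Multiplicative (Fin n → ℤ)) i ≃+
          ({s : Finset (Fin n) // s.card = i} → ℤ)) := by
        obtain ⟨E⟩ := ih i
        exact ⟨E.trans (LinearEquiv.funCongrLeft ℤ ℤ
          (Fintype.equivFinOfCardEq (card_subsetIndex n i))).toAddEquiv⟩
      obtain ⟨E₁⟩ := hE j
      obtain ⟨E₂⟩ := hE (j + 1)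
      obtain ⟨E⟩ := cohomology_semidirect_int (stdCoords n) j (subsetIndex n j)
        (subsetIndex n (j + 1)) (isMinorIndex_subsetIndex n j)
        (isMinorIndex_subsetIndex n (j + 1)) E₁ E₂
      let F := (groupCohomology.mapIso
        (A := Rep.trivial ℤ _ ℤ) (B := Rep.trivial ℤ _ ℤ)
        (latticeSuccEquiv n) (LinearEquiv.refl ℤ ℤ) (fun _ => rfl) (j + 1)).toLinearEquiv.toAddEquiv
      have hc : Fintype.card ({s : Finset (Fin n) // s.card = j} ⊕
          {s : Finset (Fin n) // s.card = j + 1}) = (n + 1).choose (j + 1) := by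
        rw [Fintype.card_sum, card_subsetIndex, card_subsetIndex, Nat.choose_succ_succ]
      exact ⟨(F.trans E).trans ((LinearEquiv.sumArrowLequivProdArrow _ _ ℤ ℤ).symm.trans
        (LinearEquiv.funCongrLeft ℤ ℤ (Fintype.equivFinOfCardEq hc).symm)).toAddEquiv⟩

end FreeAbelian

/-! ### A bound for the kernel of H⁴(Γ, ℤ) → H⁴(Γ, Fun), for a finite cyclic quotient. -/

section Counting

/-- With one representative w(b) chosen for each value b of f, every θ(y) is θ(w(f y)) plus an
element of S. -/
theorem range_finite_of_fibres {H A B : Type} [AddCommGroup H] [AddCommGroup A] [AddCommGroup B]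
    [Finite B] (θ : H →+ A) (f : H →+ B) {S : Set A} (hS : S.Finite)
    (h : ∀ y, f y = 0 → θ y ∈ S) :
    (Set.range θ).Finite ∧ (Set.range θ).ncard ≤ Nat.card B * S.ncard := by
  classical
  let w : B → H := fun b => if hb : ∃ y, f y = b then hb.choose else 0
  have hw (y : H) : f (w (f y)) = f y := by
    have hb : ∃ y', f y' = f y := ⟨y, rfl⟩
    simp only [w, dif_pos hb]
    exact hb.choose_spec
  have hsub : Set.range θ ⊆ (fun p : B × A => θ (w p.1) + p.2) '' (Set.univ ×ˢ S) := by
    rintro _ ⟨y, rfl⟩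
    refine ⟨(f y, θ (y - w (f y))), ⟨Set.mem_univ _, h _ ?_⟩, ?_⟩
    · rw [map_sub, hw, sub_self]
    · rw [map_sub]
      exact add_sub_cancel _ _
  have hfin : ((Set.univ : Set B) ×ˢ S).Finite := Set.finite_univ.prod hS
  refine ⟨(hfin.image _).subset hsub, ?_⟩
  calc _ ≤ _ := Set.ncard_le_ncard hsub (hfin.image _)
    _ ≤ _ := Set.ncard_image_le hfin
    _ = _ := by rw [Set.ncard_prod, Set.ncard_univ]

end Counting

theorem rep_hom_ext {k G : Type} [CommRing k] [Group G] {A B : Rep.{0} k G} {f g : A ⟶ B}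
    (h : ∀ x, f.hom x = g.hom x) : f = g :=
  Rep.hom_ext (Representation.IntertwiningMap.ext (LinearMap.ext h))

theorem rep_hom_comm {k G : Type} [CommRing k] [Group G] {A B : Rep.{0} k G} (f : A ⟶ B) (γ : G)
    (x : A) : f.hom (A.ρ γ x) = B.ρ γ (f.hom x) :=
  congr($(f.hom.isIntertwining' γ) x)

section FiniteCyclic

variable {L : Type} [CommGroup L] {m : ℕ} [NeZero m] (φ : Multiplicative (ZMod m) →* MulAut L)

/-- Summation over the finite cyclic group. -/
def sumMap : funRep φ ⟶ Rep.trivial ℤ (L ⋊[φ] Multiplicative (ZMod m)) ℤ :=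
  Rep.ofHom ⟨{ toFun := fun f : Multiplicative (ZMod m) → ℤ => ∑ k, f k
               map_add' := fun _ _ => Finset.sum_add_distrib
               map_smul' := fun _ _ => (Finset.mul_sum _ _ _).symm },
    fun γ => LinearMap.ext fun f : Multiplicative (ZMod m) → ℤ =>
      Equiv.sum_comp (Equiv.mulLeft γ.right⁻¹) f⟩

/-- The functions with vanishing sum. -/
abbrev augRep : Rep ℤ (L ⋊[φ] Multiplicative (ZMod m)) :=
  (funRep φ).subrepresentation (LinearMap.ker (sumMap φ).hom.toLinearMap) fun γ f hf => by
    have hf' : (sumMap φ).hom f = 0 := hf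
    change (sumMap φ).hom ((funRep φ).ρ γ f) = 0
    rw [rep_hom_comm, hf', map_zero]

/-- The inclusion of the functions with vanishing sum. -/
def augInclusion : augRep φ ⟶ funRep φ :=
  Rep.ofHom ⟨(LinearMap.ker (sumMap φ).hom.toLinearMap).subtype, fun _ => rfl⟩

theorem augInclusion_injective : Function.Injective (augInclusion φ).hom :=
  fun _ _ h => Subtype.ext h

theorem sumMap_diffMap (c : Multiplicative (ZMod m)) (f : Multiplicative (ZMod m) → ℤ) :
    (sumMap φ).hom ((diffMap φ c).hom f) = 0 := by
  change ∑ k, (f (k * c) - f k) = 0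
  rw [Finset.sum_sub_distrib, sub_eq_zero]
  exact Equiv.sum_comp (Equiv.mulRight c) f

/-- The difference of a right translation and the identity, with values in the functions of
vanishing sum. -/
def augDiff (c : Multiplicative (ZMod m)) : funRep φ ⟶ augRep φ :=
  Rep.ofHom ⟨(diffMap φ c).hom.toLinearMap.codRestrict _ (sumMap_diffMap φ c), fun γ =>
    LinearMap.ext fun f => Subtype.ext (rep_hom_comm (diffMap φ c) γ f)⟩

theorem augDiff_comp (c : Multiplicative (ZMod m)) :
    augDiff φ c ≫ augInclusion φ = diffMap φ c := rep_hom_ext fun _ => rfl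

/-- The sequence `0 → ℤ → Fun(C, ℤ) → I → 0`. -/
abbrev constSequence : ShortComplex (Rep ℤ (L ⋊[φ] Multiplicative (ZMod m))) :=
  ShortComplex.mk (constMap φ) (augDiff φ (Multiplicative.ofAdd 1))
    (rep_hom_ext fun x => Subtype.ext (funext fun _ => sub_self (x : ℤ)))

theorem exists_diff_eq_of_sum_eq_zero (f : ZMod m → ℤ) (hf : ∑ k, f k = 0) :
    ∃ h : ZMod m → ℤ, ∀ k, h (k + 1) - h k = f k := by
  refine ⟨fun k => ∑ i ∈ Finset.range k.val, f i, fun k => ?_⟩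
  have hm : 0 < m := Nat.pos_of_neZero m
  have hsum : ∑ i ∈ Finset.range m, f i = 0 := by
    rw [← hf, Finset.sum_range]
    refine Fintype.sum_bijective (fun i : Fin m => ((i : ℕ) : ZMod m)) ?_ _ _ fun _ => rfl
    refine (Fintype.bijective_iff_injective_and_card _).2 ⟨fun i j hij => ?_, by simp⟩
    have := congrArg ZMod.val hij
    rw [ZMod.val_natCast_of_lt i.2, ZMod.val_natCast_of_lt j.2] at this
    exact Fin.ext this
  have hk : ((k.val : ℕ) : ZMod m) = k := ZMod.natCast_zmod_val k
  have hlt := ZMod.val_lt k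
  have hs : ∑ i ∈ Finset.range (k.val + 1), f i = ∑ i ∈ Finset.range k.val, f i + f k := by
    rw [Finset.sum_range_succ, hk]
  rcases Nat.lt_or_ge (k.val + 1) m with h | h
  · have hv : (k + 1).val = k.val + 1 := by
      conv_lhs => rw [← hk, ← Nat.cast_succ]
      exact ZMod.val_natCast_of_lt h
    beta_reduce
    rw [hv, hs, add_sub_cancel_left]
  -- At the wrap-around the partial sums must return to zero, which is the vanishing of the total
  -- sum.
  · have he : k.val + 1 = m := by omega
    have hv : k + 1 = 0 := by
      rw [← hk, ← Nat.cast_succ, Nat.succ_eq_add_one, he, ZMod.natCast_self]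
    beta_reduce
    rw [he, hsum] at hs
    rw [hv, ZMod.val_zero, Finset.range_zero, Finset.sum_empty, zero_sub]
    linarith

theorem constSequence_shortExact : (constSequence φ).ShortExact := by
  refine shortExact_of_exact (constMap_injective φ) (fun f : augRep φ => ?_)
    (fun (f : Multiplicative (ZMod m) → ℤ) hf => ?_)
  · obtain ⟨h, hh⟩ := exists_diff_eq_of_sum_eq_zero
      (fun k => (f.1 : Multiplicative (ZMod m) → ℤ) (Multiplicative.ofAdd k))
      ((Equiv.sum_comp Multiplicative.ofAdd (f.1 : Multiplicative (ZMod m) → ℤ)).trans f.2)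
    exact ⟨fun k : Multiplicative (ZMod m) => h k.toAdd,
      Subtype.ext (funext fun k : Multiplicative (ZMod m) => hh k.toAdd)⟩
  · have h1 : ∀ k : ZMod m, f (Multiplicative.ofAdd (k + 1)) = f (Multiplicative.ofAdd k) :=
      fun k => sub_eq_zero.1 (congrFun (congrArg Subtype.val hf) (Multiplicative.ofAdd k))
    refine ⟨f 1, funext fun k : Multiplicative (ZMod m) => ?_⟩
    change f 1 = f k
    have h2 : ∀ n : ℕ, f (Multiplicative.ofAdd (n : ZMod m)) = f 1 := fun n => by
      induction n with
      | zero => rw [Nat.cast_zero]; rfl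
      | succ i ih => rw [Nat.cast_succ, h1, ih]
    have h3 := h2 k.toAdd.val
    rw [ZMod.natCast_zmod_val] at h3
    exact h3.symm

/-- The sequence `0 → I → Fun(C, ℤ) → ℤ → 0`. -/
abbrev augSequence : ShortComplex (Rep ℤ (L ⋊[φ] Multiplicative (ZMod m))) :=
  ShortComplex.mk (augInclusion φ) (sumMap φ) (rep_hom_ext fun f => f.2)

theorem augSequence_shortExact : (augSequence φ).ShortExact := by
  refine shortExact_of_exact (augInclusion_injective φ) (fun x => ?_) (fun f hf => ⟨⟨f, hf⟩, rfl⟩)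
  refine ⟨Pi.single (M := fun _ => ℤ) (1 : Multiplicative (ZMod m)) x, ?_⟩
  change ∑ k, Pi.single (M := fun _ => ℤ) (1 : Multiplicative (ZMod m)) x k = x
  rw [Finset.sum_pi_single']
  simp

/-- The norm of the group of right translations. -/
def normMap : funRep φ ⟶ funRep φ := sumMap φ ≫ constMap φ

theorem coeffMap_zero {G : Type} [Group G] (A B : Rep ℤ G) (n : ℕ) (x : groupCohomology A n) :
    coeffMap (0 : A ⟶ B) n x = 0 := by
  have h := coeffMap_add (0 : A ⟶ B) 0 n x
  rw [add_zero] at h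
  exact left_eq_add.1 h

theorem coeffMap_sum {G : Type} [Group G] {A B : Rep ℤ G} {ι : Type} (s : Finset ι)
    (f : ι → (A ⟶ B)) (n : ℕ) (x : groupCohomology A n) :
    coeffMap (∑ i ∈ s, f i) n x = ∑ i ∈ s, coeffMap (f i) n x := by
  classical
  induction s using Finset.induction_on with
  | empty => exact coeffMap_zero A B n x
  | insert i s hi ih => rw [Finset.sum_insert hi, Finset.sum_insert hi, coeffMap_add, ih]

/-- Summing a function over C and spreading the result as a constant is the sum of all its right
translates. The composite Fun → ℤ → Fun therefore induces the norm on cohomology. -/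
theorem coeffMap_normMap (n : ℕ) (x : groupCohomology (funRep φ) n) :
    coeffMap (normMap φ) n x = ∑ k, rightTranslationMap φ n k x := by
  have h : normMap φ = ∑ k, rightTranslation φ k := by
    refine rep_hom_ext fun f => ?_
    have h2 : ∀ s : Finset (Multiplicative (ZMod m)),
        (∑ k ∈ s, rightTranslation φ k).hom f = ∑ k ∈ s, (rightTranslation φ k).hom f := fun s => by
      classical
      induction s using Finset.induction_on with
      | empty => rfl
      | insert i s hi ih =>
        rw [Finset.sum_insert hi, Finset.sum_insert hi, ← ih]
        rfl
    refine Eq.trans ?_ (h2 _).symm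
    funext k
    change ∑ c, f c = (∑ c, (rightTranslation φ c).hom f : Multiplicative (ZMod m) → ℤ) k
    rw [Finset.sum_apply]
    exact (Equiv.sum_comp (Equiv.mulLeft k) (f : Multiplicative (ZMod m) → ℤ)).symm
  rw [h, coeffMap_sum]
  rfl

variable {A B : Type} [AddCommGroup A] [AddCommGroup B] [Finite B]

/-- Bound for the image of the connecting homomorphism of the first sequence. -/
theorem range_connecting_const (n : ℕ)
    (θ : groupCohomology (Rep.trivial ℤ (L ⋊[φ] Multiplicative (ZMod m)) ℤ) (n + 2) →+ A)
    (p : groupCohomology (funRep φ) (n + 1) →+ B)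
    (hp : ∀ x, coeffMap (normMap φ) (n + 1) x = 0 → p x = 0 →
      ∃ v, coeffMap (diffMap φ (Multiplicative.ofAdd 1)) (n + 1) v = x)
    (hS : (Set.range fun z => θ (connecting (constSequence_shortExact φ) (n + 1)
      (connecting (augSequence_shortExact φ) n z))).Finite) :
    (Set.range fun y => θ (connecting (constSequence_shortExact φ) (n + 1) y)).Finite ∧
    (Set.range fun y => θ (connecting (constSequence_shortExact φ) (n + 1) y)).ncard ≤
      Nat.card B * (Set.range fun z => θ (connecting (constSequence_shortExact φ) (n + 1)
      (connecting (augSequence_shortExact φ) n z))).ncard := by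
  refine range_finite_of_fibres (θ.comp (connecting (constSequence_shortExact φ) (n + 1)))
    (p.comp (coeffMap (augInclusion φ) (n + 1))) hS fun y hy => ?_
  -- The image of y in the cohomology of Fun has zero norm, because it dies already under summation.
  -- If p kills it, it is a difference, so y and a class coming from Fun have the same image. Their
  -- difference comes from the connecting map of the other sequence, and the class coming from Fun
  -- is killed by the present connecting map.
  obtain ⟨v, hv⟩ := hp (coeffMap (augInclusion φ) (n + 1) y) (by
    have h := augSequence_shortExact φ
    rw [normMap, coeffMap_comp, ← coeffMap_comp (augInclusion φ) (sumMap φ),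
      (augSequence φ).zero, coeffMap_zero, map_zero]) hy
  rw [← augDiff_comp, coeffMap_comp] at hv
  obtain ⟨z, hz⟩ := exists_of_coeffMap_f_eq_zero (augSequence_shortExact φ) n
    (y - coeffMap (augDiff φ (Multiplicative.ofAdd 1)) (n + 1) v) (by
      rw [map_sub]
      exact sub_eq_zero.2 hv.symm)
  refine ⟨z, ?_⟩
  have h := connecting_coeffMap (constSequence_shortExact φ) (n + 1) v
  change θ (connecting (constSequence_shortExact φ) (n + 1) _) = _
  rw [hz, map_sub]
  exact congrArg θ ((congrArg (_ - ·) h).trans (sub_zero _))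

/-- Bound for the image of the connecting homomorphism of the second sequence. -/
theorem range_connecting_aug (n : ℕ) (θ : groupCohomology (augRep φ) (n + 1) →+ A)
    (p : groupCohomology (funRep φ) n →+ B)
    (hp : ∀ x, coeffMap (diffMap φ (Multiplicative.ofAdd 1)) n x = 0 → p x = 0 →
      ∃ v, coeffMap (normMap φ) n v = x) {S : Set A} (hS : S.Finite)
    (h : ∀ z, coeffMap (constMap φ) n z = 0 →
      θ (connecting (augSequence_shortExact φ) n z) ∈ S) :
    (Set.range fun y => θ (connecting (augSequence_shortExact φ) n y)).Finite ∧
    (Set.range fun y => θ (connecting (augSequence_shortExact φ) n y)).ncard ≤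
      Nat.card B * S.ncard := by
  refine range_finite_of_fibres (θ.comp (connecting (augSequence_shortExact φ) n))
    (p.comp (coeffMap (constMap φ) n)) hS fun z hz => ?_
  -- The image of z in Fun is fixed by translation. If p kills it, it is a norm, so z can be
  -- corrected by a summation class, which the connecting map kills, until it lies in the kernel of
  -- `constMap`.
  obtain ⟨v, hv⟩ := hp (coeffMap (constMap φ) n z) (by
    rw [← augDiff_comp, coeffMap_comp, ← coeffMap_comp (constMap φ), (constSequence φ).zero,
      coeffMap_zero, map_zero]) hz
  rw [normMap, coeffMap_comp] at hv
  have h2 := h (z - coeffMap (sumMap φ) n v) (by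
    rw [map_sub]
    exact sub_eq_zero.2 hv.symm)
  rw [map_sub] at h2
  have h3 := connecting_coeffMap (augSequence_shortExact φ) n v
  have h4 : connecting (augSequence_shortExact φ) n z -
      connecting (augSequence_shortExact φ) n (coeffMap (sumMap φ) n v) =
      connecting (augSequence_shortExact φ) n z := (congrArg (_ - ·) h3).trans (sub_zero _)
  exact (congrArg (θ · ∈ S) h4).mp h2

/-- The kernel of the map from the integral cohomology to the cohomology of the module of
functions is bounded by the Tate cohomology of the cyclic group. -/
theorem ker_constMap_four {B₀ B₁ B₂ B₃ : Type} [AddCommGroup B₀] [AddCommGroup B₁]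
    [AddCommGroup B₂] [AddCommGroup B₃] [Finite B₀] [Finite B₁] [Finite B₂] [Finite B₃]
    (p₀ : groupCohomology (funRep φ) 0 →+ B₀) (p₁ : groupCohomology (funRep φ) 1 →+ B₁)
    (p₂ : groupCohomology (funRep φ) 2 →+ B₂) (p₃ : groupCohomology (funRep φ) 3 →+ B₃)
    (h₀ : ∀ x, coeffMap (diffMap φ (Multiplicative.ofAdd 1)) 0 x = 0 → p₀ x = 0 →
      ∃ v, coeffMap (normMap φ) 0 v = x)
    (h₁ : ∀ x, coeffMap (normMap φ) 1 x = 0 → p₁ x = 0 →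
      ∃ v, coeffMap (diffMap φ (Multiplicative.ofAdd 1)) 1 v = x)
    (h₂ : ∀ x, coeffMap (diffMap φ (Multiplicative.ofAdd 1)) 2 x = 0 → p₂ x = 0 →
      ∃ v, coeffMap (normMap φ) 2 v = x)
    (h₃ : ∀ x, coeffMap (normMap φ) 3 x = 0 → p₃ x = 0 →
      ∃ v, coeffMap (diffMap φ (Multiplicative.ofAdd 1)) 3 v = x) :
    {x | coeffMap (constMap φ) 4 x = 0}.Finite ∧
    {x | coeffMap (constMap φ) 4 x = 0}.ncard ≤
      Nat.card B₃ * (Nat.card B₂ * (Nat.card B₁ * Nat.card B₀)) := by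
  have hc := constSequence_shortExact φ
  have ha := augSequence_shortExact φ
  -- The chain starts in degree 0, where the constants inject. Going up by the two sequences
  -- alternately multiplies the bound by one Tate group at each step.
  obtain ⟨f0, c0⟩ := range_connecting_aug φ 0 (((connecting hc 3).comp (connecting ha 2)).comp
    (connecting hc 1)) p₀ h₀ (Set.finite_singleton 0) (fun z hz => by
      have : z = 0 := coeffMap_zero_injective hc (hz.trans (map_zero _).symm)
      rw [this, map_zero, map_zero]
      exact Set.mem_singleton 0)
  obtain ⟨f1, c1⟩ := range_connecting_const φ 0 ((connecting hc 3).comp (connecting ha 2)) p₁ h₁ f0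
  -- The exceptional set is the range from the previous step, since in degree 2 the kernel of
  -- `constMap` is the range of the connecting map from degree 1.
  obtain ⟨f2, c2⟩ := range_connecting_aug φ 2 (connecting hc 3) p₂ h₂ f1 (fun z hz => by
      obtain ⟨y, hy⟩ := exists_of_coeffMap_f_eq_zero hc 1 z hz
      exact ⟨y, congrArg (fun z => connecting hc 3 (connecting ha 2 z)) hy⟩)
  obtain ⟨f3, c3⟩ := range_connecting_const φ 2 (AddMonoidHom.id _) p₃ h₃ f2
  have hker : {x | coeffMap (constMap φ) 4 x = 0} = Set.range fun y => connecting hc 3 y :=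
    Set.ext fun x => ⟨exists_of_coeffMap_f_eq_zero hc 3 x, by
      rintro ⟨y, rfl⟩
      exact coeffMap_connecting hc 3 y⟩
  rw [hker]
  refine ⟨f3, c3.trans (Nat.mul_le_mul_left _ (c2.trans (Nat.mul_le_mul_left _
    (c1.trans (Nat.mul_le_mul_left _ (c0.trans ?_))))))⟩
  rw [Set.ncard_singleton, mul_one]

end FiniteCyclic

/-! ### The cohomology of a finite cyclic group in matrix form. -/

section Matrices

variable {J : Type} [Fintype J] [DecidableEq J]

/-- The norm `1 + A + ⋯ + A ^ (m - 1)`. -/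
def cyclicNorm (m : ℕ) (A : Matrix J J ℤ) : Matrix J J ℤ := ∑ i ∈ Finset.range m, A ^ i

/-- A homomorphism that identifies the homology of a pair of matrices, acting on row vectors. -/
structure IsHomologyMap {B : Type} [AddCommGroup B] (P Q : Matrix J J ℤ) (p : (J → ℤ) →+ B) :
    Prop where
  exact : ∀ w, Matrix.vecMul w P = 0 → p w = 0 → ∃ v, Matrix.vecMul v Q = w
  vanish : ∀ v, p (Matrix.vecMul v Q) = 0
  surjective : ∀ b, ∃ w, Matrix.vecMul w P = 0 ∧ p w = b

/-- A basis, given by the rows of `B`, of the row vectors annihilated by `P`. -/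
structure IsKernelBasis {I : Type} [Fintype I] [DecidableEq I] (P : Matrix J J ℤ)
    (B : Matrix I J ℤ) (E : Matrix J I ℤ) : Prop where
  mul_eq_zero : B * P = 0
  mul_eq_one : B * E = 1
  eq_of_mul_eq_zero : ∀ w, Matrix.vecMul w P = 0 → Matrix.vecMul (Matrix.vecMul w E) B = w

theorem sum_multiplicative_zmod {m : ℕ} [NeZero m] {X : Type} [AddCommMonoid X]
    (f : Multiplicative (ZMod m) → X) :
    ∑ k, f k = ∑ i ∈ Finset.range m, f (Multiplicative.ofAdd 1 ^ i) := by
  rw [Finset.sum_range]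
  symm
  refine Fintype.sum_bijective (fun i : Fin m => (Multiplicative.ofAdd (1 : ZMod m)) ^ (i : ℕ)) ?_
      _ _
    fun _ => rfl
  refine (Fintype.bijective_iff_injective_and_card _).2 ⟨fun i j hij => ?_, ?_⟩
  · have h : ((i : ℕ) : ZMod m) = ((j : ℕ) : ZMod m) := by
      have := congrArg Multiplicative.toAdd hij
      simpa using this
    have := congrArg ZMod.val h
    rw [ZMod.val_natCast_of_lt i.2, ZMod.val_natCast_of_lt j.2] at this
    exact Fin.ext this
  · rw [Fintype.card_fin]
    exact (ZMod.card m).symm.trans (Fintype.card_congr Multiplicative.ofAdd)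

theorem iterate_eq_vecMul_pow {X : Type} (w : X → J → ℤ) (R : ℕ → X → X) (A : Matrix J J ℤ)
    (h0 : ∀ x, R 0 x = x) (h : ∀ i x, w (R (i + 1) x) = Matrix.vecMul (w (R i x)) A) (i : ℕ) (x :
        X) :
    w (R i x) = Matrix.vecMul (w x) (A ^ i) := by
  induction i with
  | zero => rw [h0, pow_zero, Matrix.vecMul_one]
  | succ i ih => rw [h, ih, Matrix.vecMul_vecMul, pow_succ]

theorem sum_vecMul_pow (m : ℕ) (A : Matrix J J ℤ) (v : J → ℤ) :
    ∑ i ∈ Finset.range m, Matrix.vecMul v (A ^ i) = Matrix.vecMul v (cyclicNorm m A) := by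
  rw [cyclicNorm]
  induction m with
  | zero => simp
  | succ m ih => rw [Finset.sum_range_succ, Finset.sum_range_succ, ih, Matrix.vecMul_add]

theorem nonempty_addEquiv_of_surjective {X H B : Type} [AddCommGroup X] [AddCommGroup H]
    [AddCommGroup B] (f : X →+ H) (p : X →+ B) (hf : Function.Surjective f)
    (hp : Function.Surjective p) (h : ∀ x, f x = 0 ↔ p x = 0) : Nonempty (H ≃+ B) :=
  ⟨(QuotientAddGroup.quotientKerEquivOfSurjective f hf).symm.trans
    ((QuotientAddGroup.quotientAddEquivOfEq (AddSubgroup.ext fun x => h x)).trans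
      (QuotientAddGroup.quotientKerEquivOfSurjective p hp))⟩

end Matrices

section CyclicCohomology

variable {k : Type} [CommRing k] {m : ℕ} [NeZero m] (A : Rep.{0} k (Multiplicative (ZMod m))) {J :
    Type} [Fintype J]
  [DecidableEq J] (W : A ≃+ (J → ℤ)) (Am : Matrix J J ℤ)

theorem mem_zpowers_ofAdd_one (x : Multiplicative (ZMod m)) :
    x ∈ Subgroup.zpowers (Multiplicative.ofAdd (1 : ZMod m)) := by
  refine ⟨(x.toAdd.val : ℤ), ?_⟩
  change Multiplicative.ofAdd ((x.toAdd.val : ℤ) • (1 : ZMod m)) = x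
  simp

theorem equiv_sub_apply
    (hW : ∀ x, W (A.ρ (Multiplicative.ofAdd 1) x) = Matrix.vecMul (W x) Am) (x : A) :
    W (A.ρ (Multiplicative.ofAdd 1) x - x) = Matrix.vecMul (W x) (Am - 1) := by
  rw [map_sub, hW, Matrix.vecMul_sub, Matrix.vecMul_one]

theorem equiv_norm_apply
    (hW : ∀ x, W (A.ρ (Multiplicative.ofAdd 1) x) = Matrix.vecMul (W x) Am) (x : A) :
    W (A.norm.hom x) = Matrix.vecMul (W x) (cyclicNorm m Am) := by
  have h : A.norm.hom x = ∑ k, A.ρ k x := by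
    rw [Rep.norm_apply, Representation.norm, LinearMap.sum_apply]
  rw [h, sum_multiplicative_zmod fun k => A.ρ k x, map_sum, ← sum_vecMul_pow]
  refine Finset.sum_congr rfl fun i _ => ?_
  refine iterate_eq_vecMul_pow (J := J) W (fun i x => A.ρ (Multiplicative.ofAdd 1 ^ i) x) Am (fun x
      => ?_)
    (fun i x => ?_) i x
  · simp
  · rw [← hW, pow_succ', map_mul]
    rfl

variable {B : Type} [AddCommGroup B] (p : (J → ℤ) →+ B)

/-- Periodicity identifies odd cohomology with the kernel of the norm modulo differences. The
coordinates `W` carry this quotient to the homology of the pair of matrices described by p. -/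
theorem cohomology_odd
    (hW : ∀ x, W (A.ρ (Multiplicative.ofAdd 1) x) = Matrix.vecMul (W x) Am)
    (hp : IsHomologyMap (cyclicNorm m Am) (Am - 1) p) (i : ℕ) (hi : Odd i) :
    Nonempty (groupCohomology A i ≃+ B) := by
  -- The projection is a homology projection composed with isomorphisms, hence surjective.
  have hπ := (ModuleCat.epi_iff_surjective (Rep.FiniteCyclicGroup.groupCohomologyπOdd A
    (Multiplicative.ofAdd 1) mem_zpowers_ofAdd_one i hi)).1
    (epi_comp' (@IsIso.epi_of_iso _ _ _ _ _ (Iso.isIso_inv _)) (epi_comp' inferInstance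
        inferInstance))
  refine nonempty_addEquiv_of_surjective (Rep.FiniteCyclicGroup.groupCohomologyπOdd A
    (Multiplicative.ofAdd 1) mem_zpowers_ofAdd_one i hi).hom.toAddMonoidHom
    ((p.comp W.toAddMonoidHom).comp (LinearMap.ker A.norm.hom.toLinearMap).subtype.toAddMonoidHom)
    hπ (fun b => ?_) (fun x => ?_)
  · obtain ⟨w, hw, hb⟩ := hp.surjective b
    refine ⟨⟨W.symm w, ?_⟩, ?_⟩
    · change A.norm.hom (W.symm w) = 0
      apply W.injective
      rw [equiv_norm_apply A W Am hW, W.apply_symm_apply, hw, map_zero]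
    · change p (W (W.symm w)) = b
      rw [W.apply_symm_apply, hb]
  · refine (Rep.FiniteCyclicGroup.groupCohomologyπOdd_eq_zero_iff A _ _ i hi x).trans ?_
    change (∃ v, A.ρ (Multiplicative.ofAdd 1) v - v = x.1) ↔ p (W x.1) = 0
    constructor
    · rintro ⟨v, hv⟩
      rw [← hv, equiv_sub_apply A W Am hW, hp.vanish]
    · intro h
      have hx : A.norm.hom x.1 = 0 := x.2
      obtain ⟨v, hv⟩ := hp.exact (W x.1) (by
        rw [← equiv_norm_apply A W Am hW, hx, map_zero]) h
      refine ⟨W.symm v, W.injective ?_⟩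
      rw [equiv_sub_apply A W Am hW, W.apply_symm_apply, hv]

theorem cohomology_even
    (hW : ∀ x, W (A.ρ (Multiplicative.ofAdd 1) x) = Matrix.vecMul (W x) Am)
    (hp : IsHomologyMap (Am - 1) (cyclicNorm m Am) p) (i : ℕ) [NeZero i] (hi : Even i) :
    Nonempty (groupCohomology A i ≃+ B) := by
  have hπ := (ModuleCat.epi_iff_surjective (Rep.FiniteCyclicGroup.groupCohomologyπEven A
    (Multiplicative.ofAdd 1) mem_zpowers_ofAdd_one i hi)).1
    (epi_comp' (@IsIso.epi_of_iso _ _ _ _ _ (Iso.isIso_inv _)) (epi_comp' inferInstance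
        inferInstance))
  refine nonempty_addEquiv_of_surjective (Rep.FiniteCyclicGroup.groupCohomologyπEven A
    (Multiplicative.ofAdd 1) mem_zpowers_ofAdd_one i hi).hom.toAddMonoidHom
    ((p.comp W.toAddMonoidHom).comp (LinearMap.ker (A.applyAsHom (Multiplicative.ofAdd 1) -
      𝟙 A).hom.toLinearMap).subtype.toAddMonoidHom)
    hπ (fun b => ?_) (fun x => ?_)
  · obtain ⟨w, hw, hb⟩ := hp.surjective b
    refine ⟨⟨W.symm w, ?_⟩, ?_⟩
    · change A.ρ (Multiplicative.ofAdd 1) (W.symm w) - W.symm w = 0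
      apply W.injective
      rw [equiv_sub_apply A W Am hW, W.apply_symm_apply, hw, map_zero]
    · change p (W (W.symm w)) = b
      rw [W.apply_symm_apply, hb]
  · refine (Rep.FiniteCyclicGroup.groupCohomologyπEven_eq_zero_iff A _ _ i hi x).trans ?_
    change (∃ v, A.norm.hom v = x.1) ↔ p (W x.1) = 0
    constructor
    · rintro ⟨v, hv⟩
      rw [← hv, equiv_norm_apply A W Am hW, hp.vanish]
    · intro h
      have hx : A.ρ (Multiplicative.ofAdd 1) x.1 - x.1 = 0 := x.2
      obtain ⟨v, hv⟩ := hp.exact (W x.1) (by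
        rw [← equiv_sub_apply A W Am hW, hx, map_zero]) h
      refine ⟨W.symm v, W.injective ?_⟩
      rw [equiv_norm_apply A W Am hW, W.apply_symm_apply, hv]

theorem cohomology_zero {I : Type} [Fintype I] [DecidableEq I] (Bm : Matrix I J ℤ) (E : Matrix J I
    ℤ)
    (hW : ∀ x, W (A.ρ (Multiplicative.ofAdd 1) x) = Matrix.vecMul (W x) Am)
    (hB : IsKernelBasis (Am - 1) Bm E) :
    Nonempty (groupCohomology A 0 ≃+ (I → ℤ)) := by
  let e := (Rep.FiniteCyclicGroup.groupCohomologyIso₀ A (Multiplicative.ofAdd 1)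
    mem_zpowers_ofAdd_one).toLinearEquiv.toAddEquiv
  let q : LinearMap.ker (A.applyAsHom (Multiplicative.ofAdd 1) - 𝟙 A).hom.toLinearMap →+ (I → ℤ) :=
    { toFun := fun x => Matrix.vecMul (W x.1) E
      map_zero' := by
        change Matrix.vecMul (W 0) E = 0
        rw [map_zero, Matrix.zero_vecMul]
      map_add' := fun x y => by
        change Matrix.vecMul (W (x.1 + y.1)) E = _
        rw [map_add, Matrix.add_vecMul] }
  have hx (x : LinearMap.ker (A.applyAsHom (Multiplicative.ofAdd 1) - 𝟙 A).hom.toLinearMap) :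
      Matrix.vecMul (q x) Bm = W x.1 := by
    refine hB.eq_of_mul_eq_zero _ ?_
    have hx : A.ρ (Multiplicative.ofAdd 1) x.1 - x.1 = 0 := x.2
    rw [← equiv_sub_apply A W Am hW, hx, map_zero]
  refine ⟨e.trans (AddEquiv.ofBijective q ⟨fun x y h => ?_, fun c => ?_⟩)⟩
  · exact Subtype.ext (W.injective (by rw [← hx, ← hx, h]))
  · refine ⟨⟨W.symm (Matrix.vecMul c Bm), ?_⟩, ?_⟩
    · change A.ρ (Multiplicative.ofAdd 1) (W.symm (Matrix.vecMul c Bm)) -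
        W.symm (Matrix.vecMul c Bm) = 0
      apply W.injective
      rw [equiv_sub_apply A W Am hW, W.apply_symm_apply, Matrix.vecMul_vecMul, hB.mul_eq_zero,
        Matrix.vecMul_zero, map_zero]
    · change Matrix.vecMul (W (W.symm _)) E = c
      rw [W.apply_symm_apply, Matrix.vecMul_vecMul, hB.mul_eq_one, Matrix.vecMul_one]

end CyclicCohomology

section RightTranslation

variable {L C : Type} [CommGroup L] [Group C] (φ : C →* MulAut L) (n : ℕ)

theorem rightTranslationMap_one (x : groupCohomology (funRep φ) n) :
    rightTranslationMap φ n 1 x = x := by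
  have h : rightTranslation φ 1 = 𝟙 (funRep φ) :=
    rep_hom_ext fun f => funext fun k : C => congrArg (f : C → ℤ) (mul_one k)
  change coeffMap (rightTranslation φ 1) n x = x
  rw [h, coeffMap_id]

theorem rightTranslationMap_mul (c c' : C)
    (x : groupCohomology (funRep φ) n) :
    rightTranslationMap φ n (c * c') x =
      rightTranslationMap φ n c (rightTranslationMap φ n c' x) := by
  have h : rightTranslation φ (c * c') = rightTranslation φ c' ≫ rightTranslation φ c :=
    rep_hom_ext fun f => funext fun k : C =>
      congrArg (f : C → ℤ) (mul_assoc k c c').symm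
  change coeffMap (rightTranslation φ (c * c')) n x = _
  rw [h, coeffMap_comp]
  rfl

end RightTranslation

section Coordinates

variable {L : Type} [CommGroup L] {m : ℕ} [NeZero m] (φ : Multiplicative (ZMod m) →* MulAut L)
  {ι J : Type} [DecidableEq ι] [Fintype J] [DecidableEq J] (K : Coords L ι) {n : ℕ}
  (t : J → Fin n → ι) (ht : IsMinorIndex t)
  (hb : Function.Bijective (twistedAltMap (n := n) φ K t))

include ht hb

theorem twistedAltMap_diffMap (x : groupCohomology (funRep φ) n) :
    twistedAltMap φ K t (coeffMap (diffMap φ (Multiplicative.ofAdd 1)) n x) =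
      Matrix.vecMul (twistedAltMap φ K t x)
        (minors t (K.actMatrix φ (Multiplicative.ofAdd 1)) - 1) := by
  rw [coeffMap_diffMap, map_sub, twistedAltMap_rightTranslation φ K t ht hb.1, Matrix.vecMul_sub,
    Matrix.vecMul_one]

theorem twistedAltMap_normMap (x : groupCohomology (funRep φ) n) :
    twistedAltMap φ K t (coeffMap (normMap φ) n x) =
      Matrix.vecMul (twistedAltMap φ K t x)
        (cyclicNorm m (minors t (K.actMatrix φ (Multiplicative.ofAdd 1)))) := by
  rw [coeffMap_normMap, sum_multiplicative_zmod fun k => rightTranslationMap φ n k x, map_sum,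
    ← sum_vecMul_pow]
  refine Finset.sum_congr rfl fun i _ => ?_
  refine iterate_eq_vecMul_pow (J := J) (twistedAltMap φ K t)
    (fun i => rightTranslationMap φ n (Multiplicative.ofAdd 1 ^ i)) _ (fun x => ?_) (fun i x => ?_)
        i x
  · rw [pow_zero, rightTranslationMap_one]
  · rw [pow_succ', rightTranslationMap_mul, twistedAltMap_rightTranslation φ K t ht hb.1]

end Coordinates

/-! ### Matrix certificates for Tate cohomology. -/

section Certificates

variable {J : Type} [Fintype J] [DecidableEq J] {m : ℕ} {A : Matrix J J ℤ}

theorem sub_one_mul_cyclicNorm (hA : A ^ m = 1) : (A - 1) * cyclicNorm m A = 0 := by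
  rw [cyclicNorm, mul_geom_sum, hA, sub_self]

theorem cyclicNorm_mul_sub_one (hA : A ^ m = 1) : cyclicNorm m A * (A - 1) = 0 := by
  rw [cyclicNorm, geom_sum_mul, hA, sub_self]

theorem cyclicNorm_mul {K : Type} {X : Matrix J K ℤ} (hX : A * X = X) :
    cyclicNorm m A * X = (m : ℤ) • X := by
  have h : ∀ i, A ^ i * X = X := fun i => by
    induction i with
    | zero => rw [pow_zero, Matrix.one_mul]
    | succ i ih => rw [pow_succ, Matrix.mul_assoc, hX, ih]
  rw [cyclicNorm, Matrix.sum_mul, Finset.sum_congr rfl fun i _ => h i, Finset.sum_const,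
    Finset.card_range, natCast_zsmul]

/-- The reduction modulo `d` of the product with a matrix. -/
def modMap {K : Type} (d : ℕ) (P : Matrix J K ℤ) : (J → ℤ) →+ (K → ZMod d) where
  toFun w k := (Matrix.vecMul w P k : ℤ)
  map_zero' := by
    funext k
    rw [Matrix.zero_vecMul]
    exact Int.cast_zero
  map_add' v w := by
    funext k
    rw [Matrix.add_vecMul]
    exact Int.cast_add _ _

theorem modMap_eq_zero {K : Type} {d : ℕ} {P : Matrix J K ℤ} {w : J → ℤ}
    (h : modMap d P w = 0) : ∃ u : K → ℤ, Matrix.vecMul w P = (d : ℤ) • u := by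
  choose u hu using fun k => (ZMod.intCast_zmod_eq_zero_iff_dvd _ d).1 (congrFun h k)
  exact ⟨u, funext hu⟩

theorem modMap_vecMul {I K : Type} [Fintype I] {d : ℕ} {P : Matrix J K ℤ} {X : Matrix I J ℤ}
    {P' : Matrix I K ℤ} (h : X * P = (d : ℤ) • P') (v : I → ℤ) :
    modMap d P (Matrix.vecMul v X) = 0 := by
  funext k
  change ((Matrix.vecMul (Matrix.vecMul v X) P k : ℤ) : ZMod d) = 0
  rw [Matrix.vecMul_vecMul, h, Matrix.vecMul_smul, Pi.smul_apply, smul_eq_mul, Int.cast_mul,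
    Int.cast_natCast, ZMod.natCast_self, zero_mul]

theorem modMap_lift {K : Type} [Fintype K] [DecidableEq K] {d : ℕ} [NeZero d] {P : Matrix J K ℤ}
    {S : Matrix K J ℤ} (h : S * P = 1) (b : K → ZMod d) :
    modMap d P (Matrix.vecMul (fun k => ((b k).val : ℤ)) S) = b := by
  funext k
  change ((Matrix.vecMul (Matrix.vecMul _ S) P k : ℤ) : ZMod d) = b k
  rw [Matrix.vecMul_vecMul, h, Matrix.vecMul_one, Int.cast_natCast, ZMod.natCast_zmod_val]

/-- The certificate is 1 = H(A - 1) + PS + rQ. The columns of r are fixed by A, so a row vector of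
zero norm annihilates r. If moreover wP = d·u, then w = wH(A - 1) + u(dS), and dS = S'(A - 1) is a
difference too. Conversely the rows of S have zero norm because d times them are differences, and SP
= 1 makes the residues surjective. -/
theorem isHomologyMap_odd {K R : Type} [Fintype K] [DecidableEq K] [Fintype R] {d : ℕ} [NeZero d]
    (hm : m ≠ 0) (hA : A ^ m = 1) {H : Matrix J J ℤ} {P P' : Matrix J K ℤ} {S S' : Matrix K J ℤ}
    {r : Matrix J R ℤ} {Q : Matrix R J ℤ} (h1 : H * A + P * S + r * Q = H + 1) (h2 : A * r = r)
    (h3 : S' * A = S' + (d : ℤ) • S) (h4 : A * P = P + (d : ℤ) • P') (h5 : S * P = 1) :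
    IsHomologyMap (cyclicNorm m A) (A - 1) (modMap d P) where
  exact w hw hp := by
    obtain ⟨u, hu⟩ := modMap_eq_zero hp
    have hr : Matrix.vecMul w r = 0 := by
      have h : (m : ℤ) • Matrix.vecMul w r = 0 := by
        rw [← Matrix.vecMul_smul, ← cyclicNorm_mul h2, ← Matrix.vecMul_vecMul, hw,
          Matrix.zero_vecMul]
      exact (smul_eq_zero.1 h).resolve_left (by exact_mod_cast hm)
    have h6 : H * (A - 1) + P * S + r * Q = 1 := by
      rw [mul_sub, mul_one, sub_add_eq_add_sub, sub_add_eq_add_sub, h1, add_sub_cancel_left]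
    have h7 : S' * (A - 1) = (d : ℤ) • S := by
      rw [Matrix.mul_sub, Matrix.mul_one, h3, add_sub_cancel_left]
    refine ⟨Matrix.vecMul w H + Matrix.vecMul u S', ?_⟩
    conv_rhs => rw [← Matrix.vecMul_one w, ← h6]
    rw [Matrix.add_vecMul, Matrix.vecMul_vecMul, Matrix.vecMul_vecMul, h7, Matrix.vecMul_add,
      Matrix.vecMul_add, ← Matrix.vecMul_vecMul w P, hu, ← Matrix.vecMul_vecMul w r, hr,
      Matrix.zero_vecMul, add_zero, Matrix.smul_vecMul, Matrix.vecMul_smul]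
  vanish := modMap_vecMul (P' := P') (by
    rw [Matrix.sub_mul, Matrix.one_mul, h4, add_sub_cancel_left])
  surjective b := by
    refine ⟨_, ?_, modMap_lift h5 b⟩
    have h : (d : ℤ) • (S * cyclicNorm m A) = 0 := by
      have h7 : S' * (A - 1) = (d : ℤ) • S := by
        rw [Matrix.mul_sub, Matrix.mul_one, h3, add_sub_cancel_left]
      rw [← Matrix.smul_mul, ← h7, Matrix.mul_assoc, sub_one_mul_cyclicNorm hA, Matrix.mul_zero]
    rw [Matrix.vecMul_vecMul, (smul_eq_zero.1 h).resolve_left (by exact_mod_cast NeZero.ne d),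
      Matrix.vecMul_zero]

section KernelBasis

variable {I : Type} [Fintype I] [DecidableEq I] {B : Matrix I J ℤ} {E F : Matrix J I ℤ}
  {Y : Matrix J J ℤ}

/-- The identity FB + (A - 1)Y = m puts m times every invariant vector in the row span of B. The
right inverse E of B then allows division by m. -/
theorem isKernelBasis_of_eq (hm : m ≠ 0) (h1 : F * B + A * Y = (m : ℤ) • 1 + Y) (h2 : B * A = B)
    (h3 : B * E = 1) : IsKernelBasis (A - 1) B E where
  mul_eq_zero := by rw [Matrix.mul_sub, Matrix.mul_one, h2, sub_self]
  mul_eq_one := h3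
  eq_of_mul_eq_zero w hw := by
    have h4 : F * B + (A - 1) * Y = (m : ℤ) • 1 := by
      rw [sub_mul, one_mul, ← add_sub_assoc, h1, add_sub_cancel_right]
    have h5 : (m : ℤ) • w = Matrix.vecMul (Matrix.vecMul w F) B := by
      have h := congrArg (Matrix.vecMul w) h4
      rw [Matrix.vecMul_add, ← Matrix.vecMul_vecMul w (A - 1), hw, Matrix.zero_vecMul, add_zero,
        Matrix.vecMul_smul, Matrix.vecMul_one, ← Matrix.vecMul_vecMul] at h
      exact h.symm
    have h6 : (m : ℤ) • Matrix.vecMul w E = Matrix.vecMul w F := by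
      rw [← Matrix.smul_vecMul, h5, Matrix.vecMul_vecMul _ B E, h3, Matrix.vecMul_one]
    refine smul_right_injective (J → ℤ) (r := (m : ℤ)) (by exact_mod_cast hm) ?_
    change (m : ℤ) • _ = (m : ℤ) • w
    rw [h5, ← Matrix.smul_vecMul, h6]

/-- Multiplying FB + (A - 1)Y = m by the norm kills the second term and turns F into mF. The common
factor m then cancels. -/
theorem cyclicNorm_eq_mul (hm : m ≠ 0) (hA : A ^ m = 1)
    (h1 : F * B + A * Y = (m : ℤ) • 1 + Y) (h2 : A * F = F) : cyclicNorm m A = F * B := by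
  have h4 : F * B + (A - 1) * Y = (m : ℤ) • 1 := by
    rw [sub_mul, one_mul, ← add_sub_assoc, h1, add_sub_cancel_right]
  have h := congrArg (cyclicNorm m A * ·) h4
  rw [mul_add, ← Matrix.mul_assoc, cyclicNorm_mul h2, ← Matrix.mul_assoc,
    cyclicNorm_mul_sub_one hA, Matrix.zero_mul, add_zero, Matrix.mul_smul, mul_one,
    Matrix.smul_mul] at h
  exact (smul_right_injective (Matrix J J ℤ) (r := (m : ℤ)) (by exact_mod_cast hm) h).symm

/-- Since the norm is FB, the homology is the cokernel of F in the coordinates given by the basis B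
of invariants. The relations GF + PS = 1, S'F = dS, FP = dP' and SP = 1 identify this cokernel with
(ℤ/d)ᴷ through P. -/
theorem isHomologyMap_even {K : Type} [Fintype K] [DecidableEq K] {d : ℕ} [NeZero d]
    (hm : m ≠ 0) (hA : A ^ m = 1) (h1 : F * B + A * Y = (m : ℤ) • 1 + Y) (h2 : B * A = B)
    (h3 : B * E = 1) (h4 : A * F = F) {G : Matrix I J ℤ} {P : Matrix I K ℤ} {P' : Matrix J K ℤ}
    {S : Matrix K I ℤ} {S' : Matrix K J ℤ} (h5 : G * F + P * S = 1) (h6 : S' * F = (d : ℤ) • S)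
    (h7 : F * P = (d : ℤ) • P') (h8 : S * P = 1) :
    IsHomologyMap (A - 1) (cyclicNorm m A) (modMap d (E * P)) where
  exact w hw hp := by
    obtain ⟨u, hu⟩ := modMap_eq_zero hp
    rw [← Matrix.vecMul_vecMul] at hu
    have hw' := (isKernelBasis_of_eq hm h1 h2 h3).eq_of_mul_eq_zero w hw
    rw [cyclicNorm_eq_mul hm hA h1 h4]
    refine ⟨Matrix.vecMul (Matrix.vecMul w E) G + Matrix.vecMul u S', ?_⟩
    rw [← Matrix.vecMul_vecMul, Matrix.add_vecMul, Matrix.vecMul_vecMul _ G, Matrix.vecMul_vecMul _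
        S',
      h6, Matrix.vecMul_smul, ← Matrix.smul_vecMul, ← hu, Matrix.vecMul_vecMul _ P, ←
          Matrix.vecMul_add, h5, Matrix.vecMul_one,
      hw']
  vanish v := by
    rw [cyclicNorm_eq_mul hm hA h1 h4]
    refine modMap_vecMul (P' := P') ?_ v
    rw [Matrix.mul_assoc, ← Matrix.mul_assoc B, h3, Matrix.one_mul, h7]
  surjective b := by
    have h9 : S * B * (E * P) = 1 := by
      rw [Matrix.mul_assoc, ← Matrix.mul_assoc B, h3, Matrix.one_mul, h8]
    refine ⟨_, ?_, modMap_lift h9 b⟩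
    rw [Matrix.vecMul_vecMul, Matrix.mul_assoc, Matrix.mul_sub, h2, Matrix.mul_one, sub_self,
      Matrix.mul_zero, Matrix.vecMul_zero]

end KernelBasis

end Certificates

/-! ### Compact encodings of matrices and their evaluation. -/

section Tables

/-- The matrix whose rows are given by their digits in base `b`, with an offset. -/
def digitMatrix {m n : ℕ} (b : ℕ) (off : ℤ) (rows : List ℕ) : Matrix (Fin m) (Fin n) ℤ :=
  -- The least significant digit is column 0. A row absent from the list would read as the constant
  -- -off.
  Matrix.of fun i j => ((rows.getD i 0 / b ^ (j : ℕ) % b : ℕ) : ℤ) - off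

/-- The matrix whose rows are given by their nonzero entries. -/
def sparseMatrix {m n : ℕ} (rows : List (List (Fin n × ℤ))) : Matrix (Fin m) (Fin n) ℤ :=
  Matrix.of fun i j => ((rows.getD i []).map fun p => if p.1 = j then p.2 else 0).sum

/-- A product with a sparse factor only touches the listed entries, which is how the large
certificate products below are evaluated. -/
theorem sparseMatrix_mul_apply {m n l : ℕ} (rows : List (List (Fin n × ℤ)))
    (Y : Matrix (Fin n) (Fin l) ℤ) (i : Fin m) (j : Fin l) :
    ((sparseMatrix rows : Matrix (Fin m) (Fin n) ℤ) * Y) i j =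
      ((rows.getD i []).map fun p => p.2 * Y p.1 j).sum := by
  rw [Matrix.mul_apply]
  simp only [sparseMatrix, Matrix.of_apply]
  induction rows.getD i [] with
  | nil => simp
  | cons p r ih => simp [add_mul, Finset.sum_add_distrib, ih]

theorem mul_sparseMatrix_transpose_apply {m n l : ℕ} (rows : List (List (Fin n × ℤ)))
    (Y : Matrix (Fin l) (Fin n) ℤ) (j : Fin l) (i : Fin m) :
    (Y * (sparseMatrix rows : Matrix (Fin m) (Fin n) ℤ).transpose) j i =
      ((rows.getD i []).map fun p => p.2 * Y j p.1).sum := by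
  rw [← Matrix.transpose_apply (Y * _), Matrix.transpose_mul, Matrix.transpose_transpose,
    sparseMatrix_mul_apply]
  rfl

/-- The determinant, by expansion along the first row, skipping the zero entries. -/
def laplace : (n : ℕ) → Matrix (Fin n) (Fin n) ℤ → ℤ
  | 0, _ => 1
  | n + 1, A => ∑ j : Fin (n + 1), if A 0 j = 0 then 0 else
      (-1) ^ (j : ℕ) * A 0 j * laplace n (A.submatrix Fin.succ j.succAbove)

theorem det_eq_laplace {n : ℕ} (A : Matrix (Fin n) (Fin n) ℤ) : A.det = laplace n A := by
  induction n with
  | zero => exact Matrix.det_isEmpty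
  | succ n ih =>
    rw [Matrix.det_succ_row_zero, laplace]
    refine Finset.sum_congr rfl fun j _ => ?_
    split_ifs with h
    · rw [h, mul_zero, zero_mul]
    · rw [ih]

/-- The tuples given by their digits in base `n`. -/
def digitTuple {N j n : ℕ} [NeZero n] (rows : List ℕ) (i : Fin N) (a : Fin j) : Fin n :=
  -- `Fin.ofNat` reduces modulo n and so extracts the digit.
  Fin.ofNat n (rows.getD i 0 / n ^ (a : ℕ))

/-- An increasing tuple is determined by its range, so two distinct ones have an entry of the first
missing from the second. That entry gives a zero row. -/
theorem isMinorIndex_of_strictMono {J : Type} [DecidableEq J] {n j : ℕ} {t : J → Fin j → Fin n}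
    (h1 : ∀ i, StrictMono (t i)) (h2 : Function.Injective t) : IsMinorIndex t := by
  intro s s'
  split_ifs with h
  · subst h
    rw [Matrix.submatrix_one (t s) (h1 s).injective, Matrix.det_one]
  · have h3 : ¬ Set.range (t s) ⊆ Set.range (t s') := fun hsub => by
      refine h (h2 ((StrictMono.range_inj (h1 s) (h1 s')).1 ?_))
      refine Set.eq_of_subset_of_ncard_le hsub ?_
      rw [← Set.image_univ, ← Set.image_univ, Set.ncard_image_of_injective _ (h1 s).injective,
        Set.ncard_image_of_injective _ (h1 s').injective]
    obtain ⟨_, ⟨a, rfl⟩, ha⟩ := Set.not_subset.1 h3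
    refine Matrix.det_eq_zero_of_row_eq_zero a fun b => ?_
    rw [Matrix.submatrix_apply, Matrix.one_apply_ne]
    exact fun hab => ha ⟨b, hab.symm⟩

end Tables

section Tables

/-- The rows of `formsOne`. -/
def formsOneRows : List (List (Fin 8 × ℤ)) := [
    [(1, 1)], [(2, 1)], [(3, 1)], [(4, 1)], [(5, 1)], [(0, -1), (3, -1), (6, -1), (7, 1)],
    [(7, 1)], [(6, -1), (7, -1)]]

/-- The action of the generator on the linear forms, in an adapted basis. -/
def formsOne : Matrix (Fin 8) (Fin 8) ℤ :=
  sparseMatrix formsOneRows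

/-- The increasing 1-tuples. -/
def tupleOne : Fin 8 → Fin 1 → Fin 8 :=
  digitTuple [
    0x0, 0x1, 0x2, 0x3, 0x4, 0x5, 0x6, 0x7]

/-- The increasing 2-tuples. -/
def tupleTwo : Fin 28 → Fin 2 → Fin 8 :=
  digitTuple [
    0x8, 0x10, 0x18, 0x20, 0x28, 0x30, 0x38, 0x11, 0x19, 0x21, 0x29, 0x31, 0x39, 0x1a, 0x22, 0x2a,
    0x32, 0x3a, 0x23, 0x2b, 0x33, 0x3b, 0x2c, 0x34, 0x3c, 0x35, 0x3d, 0x3e]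

/-- The increasing 3-tuples. -/
def tupleThree : Fin 56 → Fin 3 → Fin 8 :=
  digitTuple [
    0x88, 0xc8, 0x108, 0x148, 0x188, 0x1c8, 0xd0, 0x110, 0x150, 0x190, 0x1d0, 0x118, 0x158, 0x198,
    0x1d8, 0x160, 0x1a0, 0x1e0, 0x1a8, 0x1e8, 0x1f0, 0xd1, 0x111, 0x151, 0x191, 0x1d1, 0x119,
    0x159, 0x199, 0x1d9, 0x161, 0x1a1, 0x1e1, 0x1a9, 0x1e9, 0x1f1, 0x11a, 0x15a, 0x19a, 0x1da,
    0x162, 0x1a2, 0x1e2, 0x1aa, 0x1ea, 0x1f2, 0x163, 0x1a3, 0x1e3, 0x1ab, 0x1eb, 0x1f3, 0x1ac,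
    0x1ec, 0x1f4, 0x1f5]

/-- The increasing 4-tuples. -/
def tupleFour : Fin 70 → Fin 4 → Fin 8 :=
  digitTuple [
    0x688, 0x888, 0xa88, 0xc88, 0xe88, 0x8c8, 0xac8, 0xcc8, 0xec8, 0xb08, 0xd08, 0xf08, 0xd48,
    0xf48, 0xf88, 0x8d0, 0xad0, 0xcd0, 0xed0, 0xb10, 0xd10, 0xf10, 0xd50, 0xf50, 0xf90, 0xb18,
    0xd18, 0xf18, 0xd58, 0xf58, 0xf98, 0xd60, 0xf60, 0xfa0, 0xfa8, 0x8d1, 0xad1, 0xcd1, 0xed1,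
    0xb11, 0xd11, 0xf11, 0xd51, 0xf51, 0xf91, 0xb19, 0xd19, 0xf19, 0xd59, 0xf59, 0xf99, 0xd61,
    0xf61, 0xfa1, 0xfa9, 0xb1a, 0xd1a, 0xf1a, 0xd5a, 0xf5a, 0xf9a, 0xd62, 0xf62, 0xfa2, 0xfaa,
    0xd63, 0xf63, 0xfa3, 0xfab, 0xfac]

/-- The rows of `formsTwo`. -/
def formsTwoRows : List (List (Fin 28 × ℤ)) := [
    [(7, 1)], [(8, 1)], [(9, 1)], [(10, 1)], [(0, 1), (8, -1), (11, -1), (12, 1)], [(12, 1)],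
    [(11, -1), (12, -1)], [(13, 1)], [(14, 1)], [(15, 1)], [(1, 1), (13, -1), (16, -1), (17, 1)],
    [(17, 1)], [(16, -1), (17, -1)], [(18, 1)], [(19, 1)], [(2, 1), (20, -1), (21, 1)], [(21, 1)],
    [(20, -1), (21, -1)], [(22, 1)], [(3, 1), (18, 1), (23, -1), (24, 1)], [(24, 1)],
    [(23, -1), (24, -1)], [(4, 1), (19, 1), (25, -1), (26, 1)], [(26, 1)], [(25, -1), (26, -1)],
    [(6, -1), (21, -1), (27, -1)], [(5, 1), (6, 1), (20, 1), (21, 1), (27, 2)], [(27, 1)]]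

/-- The action on the alternating forms of degree two. -/
def formsTwo : Matrix (Fin 28) (Fin 28) ℤ :=
  sparseMatrix formsTwoRows

/-- The columns of `formsThree`. -/
def formsThreeCols : List (List (Fin 56 × ℤ)) := [
    [(3, -1)], [(8, -1)], [(12, -1)], [(15, -1)], [(19, -1)], [(18, 1), (19, -1)], [(23, -1)],
    [(27, -1)], [(30, -1)], [(34, -1)], [(33, 1), (34, -1)], [(37, -1)], [(40, -1)], [(44, -1)],
    [(43, 1), (44, -1)], [(46, -1)], [(50, -1)], [(49, 1), (50, -1)], [(53, -1)],
    [(52, 1), (53, -1)], [(55, -1)], [(0, 1), (3, -1)], [(1, 1)], [(2, 1)], [(3, -1), (5, -1)],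
    [(3, 1), (4, 1), (5, -1)], [(6, 1), (12, 1)], [(7, 1), (15, 1)], [(8, -1), (10, -1), (19, 1)],
    [(8, 1), (9, 1), (10, -1), (18, -1), (19, 1)], [(11, 1)], [(12, -1), (14, -1)],
    [(12, 1), (13, 1), (14, -1)], [(15, -1), (17, -1)], [(15, 1), (16, 1), (17, -1)],
    [(18, -1), (19, 2), (20, 1)], [(21, 1), (27, 1)], [(22, 1), (30, 1)],
    [(23, -1), (25, -1), (34, 1)], [(23, 1), (24, 1), (25, -1), (33, -1), (34, 1)], [(26, 1)],
    [(27, -1), (29, -1)], [(27, 1), (28, 1), (29, -1)], [(30, -1), (32, -1)],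
    [(30, 1), (31, 1), (32, -1)], [(33, -1), (34, 2), (35, 1)], [(36, 1), (46, -1)],
    [(37, -1), (39, -1), (50, -1)], [(37, 1), (38, 1), (39, -1), (49, 1), (50, -1)],
    [(40, -1), (42, -1), (53, -1)], [(40, 1), (41, 1), (42, -1), (52, 1), (53, -1)],
    [(43, -1), (44, 2), (45, 1), (55, -1)], [(46, -1), (48, -1)], [(46, 1), (47, 1), (48, -1)],
    [(49, -1), (50, 2), (51, 1)], [(52, -1), (53, 2), (54, 1)]]

/-- The action on the alternating forms of degree three. -/
def formsThree : Matrix (Fin 56) (Fin 56) ℤ :=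
  (sparseMatrix formsThreeCols).transpose

/-- The rows of `formsFour`. -/
def formsFourRows : List (List (Fin 70 × ℤ)) := [
    [(35, 1)], [(36, 1)], [(0, 1), (37, -1), (38, 1)], [(38, 1)], [(37, -1), (38, -1)], [(39, 1)],
    [(1, 1), (35, 1), (40, -1), (41, 1)], [(41, 1)], [(40, -1), (41, -1)],
    [(2, 1), (36, 1), (42, -1), (43, 1)], [(43, 1)], [(42, -1), (43, -1)],
    [(4, -1), (38, -1), (44, -1)], [(3, 1), (4, 1), (37, 1), (38, 1), (44, 2)], [(44, 1)],
    [(45, 1)], [(5, 1), (46, -1), (47, 1)], [(47, 1)], [(46, -1), (47, -1)],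
    [(6, 1), (48, -1), (49, 1)], [(49, 1)], [(48, -1), (49, -1)], [(8, -1), (50, -1)],
    [(7, 1), (8, 1), (50, 2)], [(50, 1)], [(9, 1), (45, -1), (51, -1), (52, 1)], [(52, 1)],
    [(51, -1), (52, -1)], [(11, -1), (47, 1), (53, -1)],
    [(10, 1), (11, 1), (46, -1), (47, -1), (53, 2)], [(53, 1)], [(13, -1), (49, 1), (54, -1)],
    [(12, 1), (13, 1), (48, -1), (49, -1), (54, 2)], [(54, 1)], [(14, 1), (50, -1)], [(55, 1)],
    [(15, 1), (56, -1), (57, 1)], [(57, 1)], [(56, -1), (57, -1)], [(16, 1), (58, -1), (59, 1)],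
    [(59, 1)], [(58, -1), (59, -1)], [(18, -1), (60, -1)], [(17, 1), (18, 1), (60, 2)], [(60, 1)],
    [(19, 1), (55, -1), (61, -1), (62, 1)], [(62, 1)], [(61, -1), (62, -1)],
    [(21, -1), (57, 1), (63, -1)], [(20, 1), (21, 1), (56, -1), (57, -1), (63, 2)], [(63, 1)],
    [(23, -1), (59, 1), (64, -1)], [(22, 1), (23, 1), (58, -1), (59, -1), (64, 2)], [(64, 1)],
    [(24, 1), (60, -1)], [(25, 1), (65, -1), (66, 1)], [(66, 1)], [(65, -1), (66, -1)],
    [(27, -1), (67, -1)], [(26, 1), (27, 1), (67, 2)], [(67, 1)], [(29, -1), (68, -1)],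
    [(28, 1), (29, 1), (68, 2)], [(68, 1)], [(30, 1)], [(32, -1), (66, -1), (69, -1)],
    [(31, 1), (32, 1), (65, 1), (66, 1), (69, 2)], [(69, 1)], [(33, 1), (67, 1)],
    [(34, 1), (68, 1)]]

/-- The action on the alternating forms of degree four. -/
def formsFour : Matrix (Fin 70) (Fin 70) ℤ :=
  sparseMatrix formsFourRows

/-- A partial inverse of the difference map, in degree one. -/
def homotopyOne : Matrix (Fin 8) (Fin 8) ℤ :=
  digitMatrix 4 1 [
    0x5400, 0x5401, 0x5405, 0x5415, 0x5455, 0x5555, 0x53ea, 0x5555]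

/-- The residues that detect the homology, in degree one. -/
def residueOne : Matrix (Fin 8) (Fin 2) ℤ :=
  digitMatrix 5 3 [
    0x13, 0x13, 0x13, 0x13, 0x13, 0x13, 0x14, 0x17]

/-- Representatives of the homology, in degree one. -/
def torsionOne : Matrix (Fin 2) (Fin 8) ℤ :=
  digitMatrix 2 0 [
    0x20, 0x80]

/-- Primitives of multiples of the representatives, in degree one. -/
def torsionLiftOne : Matrix (Fin 2) (Fin 8) ℤ :=
  digitMatrix 4 1 [
    0x63ea, 0x2555]

/-- Quotients of residues of boundaries, in degree one. -/
def residueQuotOne : Matrix (Fin 8) (Fin 2) ℤ :=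
  digitMatrix 3 1 [
    0x4, 0x4, 0x4, 0x4, 0x4, 0x4, 0x5, 0x2]

/-- A basis of the invariants, in degree two. -/
def invariantsTwo : Matrix (Fin 4) (Fin 28) ℤ :=
  digitMatrix 7 3 [
    0x30c11cdb9d8a51116efc, 0x30b3ff944f84b93083b3, 0x33464b1a668ff066f404, 0x3e9e3bfedbc704d3dde7]

/-- Coordinates of the invariants, in degree two. -/
def coordinatesTwo : Matrix (Fin 28) (Fin 4) ℤ :=
  digitMatrix 2 0 [
    0x0, 0x0, 0x0, 0x0, 0x0, 0x0, 0x0, 0x0, 0x0, 0x0, 0x0, 0x0, 0x0, 0x0, 0x0, 0x0, 0x0, 0x0, 0x0,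
    0x0, 0x0, 0x2, 0x0, 0x0, 0x1, 0x0, 0x4, 0x8]

/-- Coordinates of the orbit sums, in degree two. -/
def orbitSumTwo : Matrix (Fin 28) (Fin 4) ℤ :=
  digitMatrix 13 3 [
    0x4ed3, 0x170, 0x1c98, 0x1bbe, 0x1c0a, 0x225, 0x225, 0x4ed3, 0x170, 0x1c98, 0x1bbe, 0x4f62,
    0x225, 0x4ed3, 0x170, 0x1c98, 0x225, 0x4f62, 0x4ed3, 0x170, 0x225, 0x225, 0x4ed3, 0x4f62,
    0x225, 0x225, 0x4f62, 0x6921]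

/-- A primitive of the norm, in degree two. -/
def primitiveTwo : Matrix (Fin 28) (Fin 28) ℤ :=
  digitMatrix 28 12 [
    0x5ed588b2940235e7dadf6aafef7f27b00a, 0x1667cfdd24e86d5a97628498c99c672e27,
    0x2b6cb58386a5d1e6b615a009de5c4cd5ec, 0x2b4aa1937b6dbe6a1f2bfee3159abecee2,
    0x2b4a751f66232ebdf1904dad7faf00c2e1, 0xc5e37d704a1426397d13e14c4504a1f1c,
    0xbf83b7434f3672a4ca2c8bddc189b671c, 0x4a183463591eb4fbcebb0f1d6d47d7a435,
    0x20f98e707a70a82fa7e8682e91000bee6a, 0x2b4ab6b7ec169370a3edd9727ed8eb5c4c,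
    0x2b4a96769df5f7c14ce27e0b5f35b69dc7, 0x54aa081b15965ed96e6ace82b3e0b2c31c,
    0x16cdec817e97c33192227e14c459859b1c, 0x355ae0141e3b340fc296b38b0756b35857,
    0x2b8b4d03cff8e304b86e4bc7701079adb1, 0x2b28b7ec518754fa91c61331b63b85c71c,
    0x20d7a4c928e068c641273e84339e5cf71c, 0x3fca9ec621a95d3d79c957b0d43472c31c,
    0x209d8bc4e357b323b99e753b859b634c79, 0x361d0b9725811dda21c762b145041e6cf8,
    0x2bad55d67284a5fcc1a3662bc882859b1c, 0x2b475973a2d6eaa44245afedbc9e5cf71c,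
    0xbe03775a877734c81e16cdc936413409b, 0x160bcc1b18cb6dd636686bd6d03472c31c,
    0x361d0a80f672769538637414c882859b1c, 0x402661fa937c7a2c7c57a0a9bc9e5cf71c,
    0x12c661cbbd87f685f3eb796d03472c31c, 0x2b4aa193c10803566d2b1c71c71c71c71c]

/-- A partial inverse of the norm, in degree two. -/
def homotopyTwo : Matrix (Fin 4) (Fin 28) ℤ :=
  digitMatrix 3 1 [
    0xa67358b3f9a, 0xa67358b3f98, 0xa67358b3f97, 0xa67358b3f98]

/-- The residues that detect the homology, in degree two. -/
def residueTwo : Matrix (Fin 4) (Fin 2) ℤ :=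
  digitMatrix 8 4 [
    0xf, 0x5, 0x16, 0x2c]

/-- Representatives of the homology, in degree two. -/
def torsionTwo : Matrix (Fin 2) (Fin 4) ℤ :=
  digitMatrix 5 0 [
    0x1f9, 0x7d]

/-- Primitives of multiples of the representatives, in degree two. -/
def torsionLiftTwo : Matrix (Fin 2) (Fin 28) ℤ :=
  digitMatrix 4 2 [
    0xaaaaaaaaaaaa93, 0xaaaaaaaaaaa6aa]

/-- Quotients of residues of boundaries, in degree two. -/
def residueQuotTwo : Matrix (Fin 28) (Fin 2) ℤ :=
  digitMatrix 7 3 [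
    0x18, 0x18, 0x17, 0x2d, 0x3, 0x11, 0x11, 0x18, 0x18, 0x17, 0x2d, 0x26, 0x11, 0x18, 0x18, 0x17,
    0x11, 0x26, 0x18, 0x18, 0x11, 0x11, 0x18, 0x26, 0x11, 0x11, 0x26, 0x2d]

/-- A partial inverse of the difference map, in degree three. -/
def homotopyThree : Matrix (Fin 56) (Fin 56) ℤ :=
  digitMatrix 11 5 [
    0x1a812d339f988e129ddeddbca0993815c41936119ab436499,
    0x1a812d339f9891a506aad0320f9fc67850d31da3bb1ee88dc,
    0x1a812d340026c4d9e28ce5968b273b2870e525d23414698df,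
    0x1a812d32de7c3262301e0ff8ad7a2d86681e947fb5404a729,
    0x1a812d333f0a5e718a88693b633f0d514c9b1b5ad455474bd,
    0x1a812d339f9891a456caf8fb282e830f571ac9ed41fdfa498,
    0x1a812d339f9891a506aad0320f6229f8d6e9cd3705940740e,
    0x1a812d339f9891a506aad0320f9fc78c1e74717503bbd800d,
    0x1a812d339f9895376f76c2a65e11533121682f0e76def03e4,
    0x1a812d339f9895376f76c2a640f1d780833f39effd652e3d5,
    0x1a812d339f988e129ddeddbdfb6d32348a314a46c99d0ef18,
    0x1a812d340026c4e0b14e3a2af4e5ae8a5167f1b115f128498,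
    0x1a812d339f98953e3e38115e60ca37fc5ec72a4e9b3fb96b1,
    0x1a812d340026c8731a1a262b71e4cbdbc796dcf5ef625058c,
    0x1a812d333f0a5ad6f33b7ad01805408ca67d9292c9866d773,
    0x1a812d351f677134ece3f8b9ed483f090c9dab674c8daaacf,
    0x1a812d33fe8ad3ba81f3e18153d62ee1eff4522b1b695575a,
    0x1a812d33a0668dc71fc515e202b5d657b2c457414f751f52a,
    0x1a812d33a06686a0ee8bfb7632b325984472a1f9fab9e1d55,
    0x1a812d33fe8ad74d9a5f16f53ff6f6a068f42ffed9cf16a3b,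
    0x1a812d339eca9916061ddb42d3c9150c7ffac277b7edc2cb9,
    0x1a812d339f988e129ddeddbca0993815c41936119ab43649a,
    0x1a812d339f9891a506aad0320f9fc67850d31da3bb1ee88e7,
    0x1a812d340026c4d9e28ce5968b273b2870e525d2341469958,
    0x1a812d340026c4d932ad0e5fa371c643b7a76f16f517dc5cf,
    0x1a812d333f0a5e718a88693b633f0d514c9b1b5ad4554adee,
    0x1a812d339f9891a506aad0320f6229f8d6e9cd370595b7c37,
    0x1a812d339f9891a506aad0320f9fc78c1e74717503ce6d9d0,
    0x1a812d339f9891a506aad031f2804cef4decd027db0079c7f,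
    0x1a812d339f9895376f76c2a640f1d780833f39f0062de5100,
    0x1a812d340026c4e0b14e3a2af4e5ae8a5167f1b53ccf91deb,
    0x1a812d339f9891a506aacf9aa4f54a3bed48cd49dd03b0dad,
    0x1a812d340026c8731a1a262b71e4cbdbc796deec4e8237dc7,
    0x1a812d333fd8536d72477932d853516ab82a3babbe047ffe0,
    0x1a812d33fe8ad3ba81f3e18153d62ee1effe861bae4a0721b,
    0x1a812d339eca9916061ddb42d3c9150ec77f4437dc7f144aa,
    0x1a812d339f988e129ddeddbca099382ed6cac9532cf2b6bf5,
    0x1a812d339f9891a506aad0320f9fc78c1e74717503ce6d9d0,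
    0x1a812d339f9891a456caf8fb282866bd081362e4fe7773027,
    0x1a812d340026c4d932ad0e5fa372489fe8e80d02500dc03f0,
    0x1a812d339f9891a506aad0320f9fc78c1e74717503ce6d9d0,
    0x1a812d339f988e129ddeddbc9df372dac3d5baa940957c025,
    0x1a812d339f9891a506aad0320f9fc78c1e74717503ce6d9d0,
    0x1a812d333f0a5ad6f33b73b7180760ca5871f6230e6487058,
    0x1a812d339f9891a506aad0320f9fc78c1e74717503ce6d9d0,
    0x1a812d339eca9916063faefe3451ec5ae8674c1d6d547225d,
    0x1a812d339f988e129f52f6c9c67a787440c32030661dbf2a6,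
    0x1a812d333f0a5e694c0a52a889ac1d925dd535b77cd25656d,
    0x1a812d339f9891a506aad0320f9fc78c1e74717503ce6d9d0,
    0x1a812d339f988db8ae50d6125708953a4a41d688e640aec0e,
    0x1a812d339f9891a506aad0320f9fc78c1e74717503ce6d9d0,
    0x1a812d339f96e1717e453dc855299f7a977ba795790621f18,
    0x1a812d3217029d4bc6e437cb5afd3be265cdebe375cdffb1c,
    0x1a812d339f9891a506aad0320f9fc78c1e74717503ce6d9d0,
    0x1a812d05fd305a784243ba016b21b19d7bb3b5989fdbde021,
    0x1a803fedf43fa2cdd6c58bbb2343eeab9306bbe9c6099c37e]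

/-- The residues that detect the homology, in degree three. -/
def residueThree : Matrix (Fin 56) (Fin 2) ℤ :=
  digitMatrix 7 3 [
    0x18, 0x18, 0x16, 0x19, 0x18, 0x19, 0x18, 0x18, 0x18, 0x18, 0x18, 0x19, 0x6, 0xb, 0x1e, 0x16,
    0x18, 0x17, 0x19, 0x17, 0x18, 0x18, 0x18, 0x16, 0x17, 0x18, 0x18, 0x18, 0x18, 0x18, 0x19, 0x1f,
    0xb, 0x19, 0x18, 0x18, 0x18, 0x18, 0x19, 0x17, 0x18, 0x18, 0x18, 0x1e, 0x1f, 0x18, 0x18, 0x18,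
    0x19, 0x2a, 0x18, 0x18, 0x1a, 0x18, 0x6, 0x15]

/-- Representatives of the homology, in degree three. -/
def torsionThree : Matrix (Fin 2) (Fin 56) ℤ :=
  digitMatrix 6 3 [
    0x107bdbbfe0e03c8e3cdbfdd4289a011999999, 0x107c00b32a53ae1719bc07133ab0011999999]

/-- Invariants of the dual action, in degree three. -/
def freePartThree : Matrix (Fin 56) (Fin 6) ℤ :=
  digitMatrix 10 6 [
    0xa2ce9, 0xbb2ca, 0xa0e8c, 0xa2bcf, 0xa3012, 0xa257d, 0xa533a, 0xa2c8e, 0x8a575, 0xa2c1f,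
    0xa2c2b, 0x89af5, 0xa0526, 0x85a30, 0xd646c, 0xa2bcf, 0xa284c, 0xa32cc, 0xa2588, 0xa2eee,
    0xa2c2a, 0xa2ce9, 0xbb2ca, 0xa0e8c, 0xa2eef, 0xa3012, 0xa533a, 0xa2c8e, 0xa2c34, 0xa2c1f,
    0x89af5, 0x8c5e2, 0x85a30, 0xa2966, 0xa284c, 0xa2c2a, 0xa2ce9, 0xbb2ca, 0xa257d, 0xa2eef,
    0xa533a, 0xa2c2b, 0xa2c34, 0xd646c, 0x8c5e2, 0xa2c2a, 0xa2ce9, 0xa3012, 0xa257d, 0xa2c1f,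
    0xa2c2b, 0xa2c2a, 0xa2eef, 0xa3012, 0xa2c2a, 0xa2c2a]

/-- A partial inverse of the invariants, in degree three. -/
def freeLiftThree : Matrix (Fin 6) (Fin 56) ℤ :=
  digitMatrix 2 0 [
    0x4000000000000, 0x40000000000, 0x8000000, 0x20000000000000, 0x10000000000, 0x2000000000]

/-- Primitives of multiples of the representatives, in degree three. -/
def torsionLiftThree : Matrix (Fin 2) (Fin 56) ℤ :=
  digitMatrix 9 4 [
    0x16e0682130dac0bdee2afdb69f7d366cbc4651326f5f7,
    0x16e034b92b1d56378a068a2b296adadafcfebe4951c69]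

/-- Quotients of residues of boundaries, in degree three. -/
def residueQuotThree : Matrix (Fin 56) (Fin 2) ℤ :=
  digitMatrix 5 2 [
    0xc, 0xc, 0xc, 0xc, 0xc, 0xc, 0xc, 0xc, 0xc, 0xc, 0xc, 0xc, 0xc, 0xc, 0xc, 0xc, 0xc, 0xc, 0xc,
    0xc, 0xc, 0xc, 0xc, 0xc, 0xc, 0xc, 0xc, 0xc, 0xc, 0xc, 0xc, 0xc, 0xc, 0xc, 0xc, 0xc, 0xc, 0xc,
    0xc, 0xc, 0xc, 0xc, 0x8, 0xc, 0xc, 0xc, 0xc, 0xc, 0xb, 0xc, 0x4, 0x8, 0xc, 0x6, 0xf, 0xd]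

/-- A basis of the invariants, in degree four. -/
def invariantsFour : Matrix (Fin 8) (Fin 70) ℤ :=
  digitMatrix 20 11 [
    0x35af95bb8e67f776a4d10cb3a6b066071b381941c895946348bb993994f82576bad3b14d97aa,
    0x35af95bcd786a9dc984bec6bdb98e2cee62022972c3e4320fdd49f15d3f8d536a0d434b188eb,
    0x35af95d3ffc3d3bb99f2eb261ac87fa73eb463bf4e19ee6a74776fee130ec5e50d79435e50d7,
    0x35af95bbc1dd776163b5ca334efb92acb8b5a5c50fc696c2db5446959670d6f6eff32fb4649b,
    0x35afbf835d20dd1ebce753c8876904613738a90e18e8801c3dbee4ce1984ee8cf2ecb84ae82a,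
    0x35b28f46f4f9345a2bd2c130792a48893fccd630a59392d631f844631988e49528bb0c4d786a,
    0x35eaeea44d8affdd67945019778ea2b33e1cd6fe684135de763c512a601084347a1e520b18c3,
    0x3a5286008f91a4a500ce7c23bd024b137af67ec42184ff588ea26839cb943d4349b0fbc26158]

/-- Coordinates of the invariants, in degree four. -/
def coordinatesFour : Matrix (Fin 70) (Fin 8) ℤ :=
  digitMatrix 2 0 [
    0x0, 0x0, 0x0, 0x0, 0x0, 0x0, 0x0, 0x0, 0x0, 0x0, 0x0, 0x0, 0x0, 0x0, 0x0, 0x0, 0x0, 0x0, 0x0,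
    0x0, 0x0, 0x0, 0x0, 0x0, 0x0, 0x0, 0x0, 0x0, 0x0, 0x0, 0x0, 0x0, 0x0, 0x0, 0x0, 0x0, 0x0, 0x0,
    0x0, 0x0, 0x0, 0x0, 0x0, 0x0, 0x0, 0x0, 0x0, 0x0, 0x0, 0x0, 0x0, 0x0, 0x0, 0x0, 0x0, 0x0, 0x0,
    0x1, 0x0, 0x8, 0x0, 0x0, 0x0, 0x2, 0x4, 0x0, 0x10, 0x20, 0x40, 0x80]

/-- Coordinates of the orbit sums, in degree four. -/
def orbitSumFour : Matrix (Fin 70) (Fin 8) ℤ :=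
  digitMatrix 11 4 [
    0xc666696, 0x19f9ee5, 0x51c8814, 0x22f0c6, 0x7c54732, 0x89fc98d, 0x515273b, 0x3d57fc7,
    0x3d58132, 0x5233a47, 0x773f4ed, 0x3f08874, 0x4fa296e, 0x5083c7a, 0x78efd9a, 0x1f816cf,
    0x4cb4478, 0x3d58132, 0x3d57fc7, 0x56d9f25, 0x42dbf73, 0x7520044, 0x5014f13, 0x55267af,
    0x67e36fb, 0x4c4102a, 0x3f089df, 0x3f08874, 0x5014f13, 0x501507e, 0x51c592b, 0x552a158,
    0x4fa296e, 0x40b9121, 0x62d1e5f, 0xc666696, 0x19f9ee5, 0x76ccf48, 0x22f0c6, 0x89fc98d,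
    0x7aa0647, 0x3d57fc7, 0x3f089df, 0x773f4ed, 0x78efd9a, 0x1f816cf, 0x7aa0647, 0x3d58132,
    0x3d54789, 0x42dbf73, 0x67e36fb, 0x773f4ed, 0x3f089df, 0x51c592b, 0x40b9121, 0xc666696,
    0x7c54732, 0x76ccf48, 0x3d58132, 0x7aa0647, 0x78efd9a, 0x3d57fc7, 0x7aa0647, 0x67e36fb,
    0x51c592b, 0x22f0c6, 0x7c54732, 0x78efd9a, 0x67e36fb, 0x78efd9a]

/-- A primitive of the norm, in degree four. -/
def primitiveFour : Matrix (Fin 70) (Fin 70) ℤ :=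
  digitMatrix 28 12 [
    0xcb293a924f14b3645f7472beb5f7b396bed1195fa63e7c6907b1ab115d8a3a857258dc8584a319b92656,
    0xa2924be5fc3fdf7dc09fe6f7099f1d235886143df83fc26907d4edd7a303053fd0a4c107ecee09e962b0,
    0xa291d306e430c6b9fbcb0409e451f9827b31850f8ad176d919ad2cdf639d4aa77f2f8ab60f904cf3f78c,
    0x6bf2dfc4e3a773c94827541b0868c179594b4c6954d1aeea048c3d29b67e7a121b6dc7b41da825b2c29c,
    0x97700d73fd7300825a768a5e01b9a2eeb737dbbd007605a37630fe5614e4d5f5987ae6dc2c537a1b05dc,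
    0xa2853073ef8f5683b81608a5dc712b984ea1a57f591deb2b4b28b3cde232a1c8390d990abef58a3d731c,
    0xa29ea2f2acb32d1da7871c4633cfc1b563e3b42c921b09108c6e66abd0d0f048b5c20bf936c0477b735a,
    0xa21ecff13131d464533019f7a8488a964f1e48e72908c498bdd90f67db33cd093e9c7ded07ea22ff471c,
    0xa21ed0176597a74d3580db76e9cf968ef13e7338ca613b708d6c8fa446b67588a631b7fd65ed33ebc71c,
    0xa2857fd8d3806df3c4e346edc34190b394b681a548f62491aee5d8739d2d8c9523c6bef65f8a3fe0fda2,
    0xa289744f6fefca48ccb2baf61bf72f79f09c5d1ee5faba1e5d586419aee241207eb227e955fd4211c71c,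
    0xa2964060973c41bc670a28b3430db23d00dddfd1c110118ead29e629dece7ce196cd31de2b3a19f1c71c,
    0xa116cd5ed789327669e47622c9e3781decc6e2f72317d4b8dd6f379c203a300380054a25dbd2558e959c,
    0xa12f9ce611aadeb419430500b6f552198067eb052e42743f986bcf24e1248a2cdea695cb2cf08b6764dc,
    0xca3e994bc594afd0cce33d219d3cb66b892c8d09ad1ca17d13c47c21e156bcfcde385af897fcfc71c71c,
    0xa12bd0ac2f56564cf5fb35f931b76161557c910054a71099ebbe7fd0a55e878de9e749cad87872fd321e,
    0xa3f84df19e9af50851fd8e5763235d5c9c0fd58d384ca151866c427f0827a815983b5017bccd51b1071c,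
    0x95f91f99c134ac4e72428479ead7e3452d49145e7226c9ef55010a709890a0e2cb11b9ebe9ba7b31c71c,
    0x95f91f737f70fac882f74cd7b938240cb23d601dd7c2e6782a238e9570d18d8e5377525815986ae1c71c,
    0xa12b814498d4ac651139e253d68eb0c703b3bd394b9479d768cd350c5a067a38d40e014c3533aa4e8407,
    0xa1a31a250f4dac9430122fe76561040904928ea40d2c1be11fa96faa37920c556aa9403e1e40fd8d3e9c,
    0xa30945fcaade87e6ead97d824b72ffb8e1c6daacc11215ce3f0a872cb6c111a3e9153f5ba7dc4541e0dc,
    0xa3096ce35ab7f860faf46007319d9a52fae2b04864c9351dc94e70908fe611ba4a8a38f413d6e4f7c71c,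
    0xa1a31b702abc366cd7349113ed6c437f59520f6cb5fe2bab5b09d07c0813219757b0535defa47a79471c,
    0xb019ba69f32f29b38d07aa4b72794fd07b74bd5ea4d9a292a90fa33bceaff12b31da3a5638764c71c71c,
    0xa404f416c1425a2ced8de05d1d0154b53061e6926b3ba8091494cb09160805c89b42a4b0ed3620883d8d,
    0xa29640528ab14a1fd16e51e15c6f7958b6795d1e189e24bc09c53b7c42c897a42006e4f827f38fb8871c,
    0xa296409ef37ceff1960855a4497f169db2a985608f37309eee1be1fd68a5d1e182973ae7c6f5182ec71c,
    0xa3096d13aa799b951de48eed48270ca97a1917d6b0cbb38a0a4e131c1bf75e69853aa625a8288db1c71c,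
    0xa3096cc726f238893f4a3bd7e9968346e1c0447b945a3b20ecc042e8aa768f9ede9987cdd3b69e01c71c,
    0xa291fca74cb8a1c816f3231e859a1454c00196cc6cdfa31d94df58576ccaccc883ba971c71c71c71c71c,
    0xa18e67a20ff8f68d5c3d0917d5022282a82f7cd5e55c5db3437205219116399b31180faebe463384891c,
    0xa300b8619627ce920db1ef6a9d7345ae0deb9b1252a23a64a5a54d941f2141d8bb8b5d1fc58c065e599c,
    0xa47402721fab5eac11f7a73b04caef11495c610ee0f0028927340f9b318d8cabebb4e17297fcfc71c71c,
    0xd7576ec3f1d3866a60954d347312907ef4600260b263d09a8f34ca0c529936e7a2eb02deab17ec71c71c,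
    0x7b60799835c2933bd91932c3497dde790149440efb34c2a45faa4c9784039f27df834f440c045703dfd9,
    0xc9c3ad610191f9784eabb21c6438911f0cd76a758b003911ccef5cc1b36b9d3b0f83ea01d9b324d2a245,
    0xca368bd63b5cd9d54cb27a45f06297d6b684ceb2e58ab2776a7cec7080237efce069d2da691bb7392b5c,
    0xa19efa59f33a5fdd1a9dcc9358da2e21055fc3d9fb28c3a88fd2ed180fca8a773bb8742d69a0eaa2ae9c,
    0x7b477c19f966167cb0e0f77b93fc2f57a30d201bc56f8c8fceb5733e08db18f4f46fcfc934d4d7f55b1c,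
    0x88605191a8bad57255571428859ecbbab79ad8d066972c0b9d09f5df3719aaa8ecb529c10a7feb75871c,
    0xafaad1f8d01ea3ae613eed1fa400872ac57c8f77dc23cafb00698158f0855395cce110c1f4eb792b071c,
    0xafaad22ca9fa72edc21f446523596efac61e43549b681d85c6ace979d913e718e275b90f1a618e01c71c,
    0x886051766b2cbb6265325ebefa13c747dd98d513f28e17438d8983d15db1fc96a0bb7acaf4b449a1c71c,
    0xaf9e05eabe79567b9dc2232f6fd11e38c62ba464281ed4b4155a2bc8ba95e6aaadacdcc312406c71c71c,
    0xc6ea107a7e16d1c17c8399b0e82ada5ea5953e75ac8bea1285c8999670181bc5943887bdef3c84e771f7,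
    0xa0abb28cfedeaa0ce8ce384573a6e58e1871207410177bad692afbe54fa1bb6add677aacbdac4f41c71c,
    0xa385217b2bbb80c85af588ff2813aee429e9170dd59aba443f7658e97f90828e815d8e28619b8b31c71c,
    0xb095c11904fee6d0f687618d515e6984e025a1af1de62fd0f8bc227df8ce4a10284b19e0e70dc97c295c,
    0xadbc242fceef34726537f62c72c2c13dfbe312b14de4bd6536b3de8584da169fadad7be0bc99eb84335c,
    0xa216480086500acadcb3e80b29b55430ced75a14afd4884f8ffee50f8aa2d7edf49869894b913c71c71c,
    0x886051b8c606abf005d2dd8788d8bceaeecf73a6d54e2a964d84ea344704d7110b9b54fd8ca28d6e071c,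
    0xafaad1abf2dfd42af28098ab8e2314f7031bff32ea80eb22c5a03825667bd41c21dce31c14d89fb8871c,
    0xa291fc811852a6f7f197547bc71de35f464352eb1d388d1ab984812e4d6e16c5b528f71c71c71c71c71c,
    0xb1112369b9e7991890c4feece9728ba45fbfe66a70ec3858761d1cad26cac69de91a2bc584e20c71c71c,
    0x2b97b89e1c70731352bdf2c7dd04095b43c16ebe5aed19b2ff0c69e781cf556a906dc2029365944e9953,
    0x6050d132374e75e8807caa780d223b48a6eab7ceabcd077e7798034036f8584bcdeb35bed8ddec8387dc,
    0xb01a0f620edc330e6738f1c09a3cdf021296e77ca2207dbaed6cd92ee26ef37b9b66feefc6ddb942369c,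
    0xbd36d3da3aa5504106e6e48164472dcce93e6eaab141ed664a2f9640b79f3edf914c7da742cf00b4c71c,
    0x6d484da89f4731ae5e953c7b4cab038744a798bbca840acd680592eaee8b425768e3341730b5cb75871c,
    0x94fd7289b75dfd266ea1093d4265866d842b8382104495efe47cc66774d139587cc88b5a38764c71c71c,
    0xb1112382bd4a995c9f14f327b08434c489ac70f25843e8ad3c0053ba207b4de884d4df5522f28ae1c71c,
    0x8593aea3f56b0648f20c60983ab45a55b7d69db2366b73abbbb4d29c578de35059958502e3e22f41c71c,
    0x9412d5971970ebe22c6025d67de0200aeadfefd71ba3af6e2f5acf4b31a26497ac1d62735eac2c71c71c,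
    0xa291fc5ae3ecac27cc3f69aa03f2bd5f64b0f478e677f293c6f17bcf9b1c71c71c71c71c71c71c71c71c,
    0x10cf72f84126037def65078427c87db83f697c734e891ef8d41351b8f953a19f30c4dcd200192747c7f1c,
    0x44c13311543c309ce10efab378424b2e52de1e4c6f13f309748189ffe77ace376ea35d302f23258d945c,
    0x7a5cdf28b04edc3dc8731482cba13f6242eab866edd1454432281f0e4e1063064be439f15eac2c71c71c,
    0x860f6331c47827d8edc3cd04c08b20215827a70f09b1656757a5d0c17511f14163a25b5d71c71c71c71c,
    0x5fe2afef237d2c71cd27c44c84fc900d3d860274dbd89978b77dceb5274f8cb41affe88884e20c71c71c]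

end Tables

/-! ### Verification of the certificates, degree by degree. -/

section Degrees

theorem isMinorIndex_tupleOne : IsMinorIndex tupleOne :=
  isMinorIndex_of_strictMono (by decide +kernel) (by decide +kernel)

theorem isMinorIndex_tupleTwo : IsMinorIndex tupleTwo :=
  isMinorIndex_of_strictMono (by decide +kernel) (by decide +kernel)

theorem isMinorIndex_tupleThree : IsMinorIndex tupleThree :=
  isMinorIndex_of_strictMono (by decide +kernel) (by decide +kernel)

theorem isMinorIndex_tupleFour : IsMinorIndex tupleFour :=
  isMinorIndex_of_strictMono (by decide +kernel) (by decide +kernel)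

/-- This and the next three statements identify the compound matrices of `formsOne` with the sparse
tables. They are checked entrywise through the Laplace expansion. -/
theorem minors_tupleOne : minors tupleOne formsOne = formsOne := by
  have h : ∀ i j : Fin 8,
      laplace 1 (formsOne.submatrix (tupleOne i) (tupleOne j)) - formsOne i j = 0 := by
    decide +kernel
  exact Matrix.ext fun i j => (det_eq_laplace _).trans (sub_eq_zero.1 (h i j))

theorem minors_tupleTwo : minors tupleTwo formsOne = formsTwo := by
  have h : ∀ i j : Fin 28,
      laplace 2 (formsOne.submatrix (tupleTwo i) (tupleTwo j)) - formsTwo i j = 0 := by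
    decide +kernel
  exact Matrix.ext fun i j => (det_eq_laplace _).trans (sub_eq_zero.1 (h i j))

theorem minors_tupleThree : minors tupleThree formsOne = formsThree := by
  have h : ∀ i j : Fin 56,
      laplace 3 (formsOne.submatrix (tupleThree i) (tupleThree j)) - formsThree i j = 0 := by
    decide +kernel
  exact Matrix.ext fun i j => (det_eq_laplace _).trans (sub_eq_zero.1 (h i j))

theorem minors_tupleFour : minors tupleFour formsOne = formsFour := by
  have h : ∀ i j : Fin 70,
      laplace 4 (formsOne.submatrix (tupleFour i) (tupleFour j)) - formsFour i j = 0 := by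
    decide +kernel
  exact Matrix.ext fun i j => (det_eq_laplace _).trans (sub_eq_zero.1 (h i j))

/-- The action on linear forms has no nonzero invariants, so the correction term of the certificate
has no columns. In degree three it has six. -/
theorem homology_one (hA : formsOne ^ 9 = 1) :
    IsHomologyMap (cyclicNorm 9 formsOne) (formsOne - 1) (modMap 3 residueOne) :=
  isHomologyMap_odd (by norm_num) hA (H := homotopyOne) (S := torsionOne) (S' := torsionLiftOne)
    (P' := residueQuotOne) (r := (0 : Matrix (Fin 8) (Fin 0) ℤ)) (Q := 0) (by decide +kernel)
    (by decide +kernel) (by decide +kernel) (by decide +kernel) (by decide +kernel)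

theorem orbitSumTwo_mul : orbitSumTwo * invariantsTwo + formsTwo * primitiveTwo =
    ((9 : ℕ) : ℤ) • 1 + primitiveTwo := by
  have h : ∀ i j : Fin 28, (orbitSumTwo * invariantsTwo) i j +
      ((formsTwoRows.getD i []).map fun p => p.2 * primitiveTwo p.1 j).sum -
      (((9 : ℕ) : ℤ) • 1 + primitiveTwo) i j = 0 := by
    decide +kernel
  refine Matrix.ext fun i j => Eq.trans ?_ (sub_eq_zero.1 (h i j))
  rw [Matrix.add_apply, formsTwo, sparseMatrix_mul_apply]

theorem homology_two (hA : formsTwo ^ 9 = 1) :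
    IsHomologyMap (formsTwo - 1) (cyclicNorm 9 formsTwo) (modMap 3 (coordinatesTwo * residueTwo)) :=
  isHomologyMap_even (by norm_num) hA orbitSumTwo_mul (by decide +kernel) (by decide +kernel)
    (by decide +kernel) (G := homotopyTwo) (P' := residueQuotTwo) (S := torsionTwo)
    (S' := torsionLiftTwo) (by decide +kernel) (by decide +kernel) (by decide +kernel)
    (by decide +kernel)

theorem homotopyThree_mul : homotopyThree * formsThree + residueThree * torsionThree +
    freePartThree * freeLiftThree = homotopyThree + 1 := by
  have h : ∀ i j : Fin 56, ((formsThreeCols.getD j []).map fun p => p.2 * homotopyThree i p.1).sum +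
      (residueThree * torsionThree) i j + (freePartThree * freeLiftThree) i j -
      (homotopyThree + 1) i j = 0 := by
    decide +kernel
  refine Matrix.ext fun i j => Eq.trans ?_ (sub_eq_zero.1 (h i j))
  rw [Matrix.add_apply, Matrix.add_apply, formsThree, mul_sparseMatrix_transpose_apply]

theorem torsionLiftThree_mul :
    torsionLiftThree * formsThree = torsionLiftThree + ((3 : ℕ) : ℤ) • torsionThree := by
  have h : ∀ (i : Fin 2) (j : Fin 56),
      ((formsThreeCols.getD j []).map fun p => p.2 * torsionLiftThree i p.1).sum -
      (torsionLiftThree + ((3 : ℕ) : ℤ) • torsionThree) i j = 0 := by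
    decide +kernel
  refine Matrix.ext fun i j => Eq.trans ?_ (sub_eq_zero.1 (h i j))
  rw [formsThree, mul_sparseMatrix_transpose_apply]

theorem homology_three (hA : formsThree ^ 9 = 1) :
    IsHomologyMap (cyclicNorm 9 formsThree) (formsThree - 1) (modMap 3 residueThree) :=
  isHomologyMap_odd (by norm_num) hA homotopyThree_mul (by decide +kernel) torsionLiftThree_mul
    (P' := residueQuotThree) (by decide +kernel) (by decide +kernel)

theorem orbitSumFour_mul : orbitSumFour * invariantsFour + formsFour * primitiveFour =
    ((9 : ℕ) : ℤ) • 1 + primitiveFour := by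
  have h : ∀ i j : Fin 70, (orbitSumFour * invariantsFour) i j +
      ((formsFourRows.getD i []).map fun p => p.2 * primitiveFour p.1 j).sum -
      (((9 : ℕ) : ℤ) • 1 + primitiveFour) i j = 0 := by
    decide +kernel
  refine Matrix.ext fun i j => Eq.trans ?_ (sub_eq_zero.1 (h i j))
  rw [Matrix.add_apply, formsFour, sparseMatrix_mul_apply]

theorem isKernelBasis_four : IsKernelBasis (formsFour - 1) invariantsFour coordinatesFour :=
  isKernelBasis_of_eq (by norm_num) orbitSumFour_mul (by decide +kernel) (by decide +kernel)

end Degrees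

/-! ### Splitting off the free part of the cohomology of Γ. -/

section Generic

variable {L : Type} [CommGroup L] {m : ℕ} [NeZero m] (φ : Multiplicative (ZMod m) →* MulAut L)
  {ι J : Type} [DecidableEq ι] [Fintype J] [DecidableEq J] (K : Coords L ι) {n : ℕ}
  (t : J → Fin n → ι) (ht : IsMinorIndex t)
  (hb : Function.Bijective (twistedAltMap (n := n) φ K t))

include ht hb in
-- Translating m times by the generator is the identity on cohomology. Since the coordinates are
-- bijective, the matrix relation follows without computing any power.
theorem minors_actMatrix_pow :
    minors t (K.actMatrix φ (Multiplicative.ofAdd 1)) ^ m = 1 := by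
  have h (x) := iterate_eq_vecMul_pow (J := J) (twistedAltMap φ K t)
    (fun i => rightTranslationMap φ n (Multiplicative.ofAdd 1 ^ i))
    (minors t (K.actMatrix φ (Multiplicative.ofAdd 1)))
    (fun x => by rw [pow_zero, rightTranslationMap_one])
    (fun i x => by
      rw [pow_succ', rightTranslationMap_mul, twistedAltMap_rightTranslation φ K t ht hb.1]) m x
  have h1 : (Multiplicative.ofAdd (1 : ZMod m)) ^ m = 1 := by
    rw [← ofAdd_nsmul, nsmul_eq_mul, mul_one, ZMod.natCast_self, ofAdd_zero]
  refine Matrix.ext fun i j => ?_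
  obtain ⟨x, hx⟩ := hb.2 (Pi.single i 1)
  have h2 := h x
  rw [h1, rightTranslationMap_one, hx, Matrix.single_one_vecMul] at h2
  rw [Matrix.one_eq_pi_single]
  exact (congrFun h2 j).symm

/-- An extension of a subgroup of finite index of a free abelian group of finite rank. -/
theorem exists_addEquiv_prod_of_smul_mem {A I : Type} [AddCommGroup A] [Fintype I] [DecidableEq I]
    (q : A →+ (I → ℤ)) {d : ℤ} (hd : d ≠ 0) (hq : ∀ c, ∃ a, q a = d • c) :
    Nonempty (A ≃+ q.ker × (I → ℤ)) := by
  let S : Submodule ℤ (I → ℤ) := LinearMap.range q.toIntLinearMap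
  have h1 : Module.finrank ℤ S ≤ Module.finrank ℤ (I → ℤ) := S.finrank_le
  let f : (I → ℤ) →ₗ[ℤ] S := LinearMap.codRestrict S (d • LinearMap.id) fun c => by
    obtain ⟨a, ha⟩ := hq c
    exact ⟨a, ha⟩
  -- The range lies between d·ℤᴵ and ℤᴵ, so it is free of full rank and the extension splits.
  have h2 : Module.finrank ℤ (I → ℤ) ≤ Module.finrank ℤ S :=
    LinearMap.finrank_le_finrank_of_injective (f := f) fun x y h =>
      smul_right_injective (I → ℤ) hd (congrArg Subtype.val h)
  let e : S ≃ₗ[ℤ] (I → ℤ) := LinearEquiv.ofFinrankEq S (I → ℤ) (le_antisymm h1 h2)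
  refine exists_addEquiv_prod q.ker.subtype
    (e.toLinearMap.toAddMonoidHom.comp q.toIntLinearMap.rangeRestrict.toAddMonoidHom)
    q.ker.subtype_injective (e.surjective.comp q.toIntLinearMap.surjective_rangeRestrict)
    (fun a => ?_) (fun b hb => ?_)
  · have h : q.toIntLinearMap.rangeRestrict a.1 = 0 := Subtype.ext a.2
    exact (congrArg e h).trans (map_zero e)
  · have h : q.toIntLinearMap.rangeRestrict b = 0 := e.injective (hb.trans (map_zero e).symm)
    exact ⟨⟨b, congrArg Subtype.val h⟩, rfl⟩

include ht hb in
/-- The integral cohomology is the sum of a free group and of the kernel of the map to the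
cohomology of the module of functions. -/
theorem exists_addEquiv_ker_prod {I : Type} [Fintype I] [DecidableEq I] {B : Matrix I J ℤ}
    {E : Matrix J I ℤ}
    (hB : IsKernelBasis (minors t (K.actMatrix φ (Multiplicative.ofAdd 1)) - 1) B E) :
    Nonempty (intCohomology (L ⋊[φ] Multiplicative (ZMod m)) n ≃+
      (coeffMap (constMap φ) n).ker × (I → ℤ)) := by
  let q : intCohomology (L ⋊[φ] Multiplicative (ZMod m)) n →+ (I → ℤ) :=
    (Matrix.vecMulLinear E).toAddMonoidHom.comp
      ((twistedAltMap φ K t).comp (coeffMap (constMap φ) n))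
  -- Classes coming from the constants are fixed by translation, so their coordinates are recovered
  -- from the basis B of invariants.
  have hq (x) : Matrix.vecMul (q x) B = twistedAltMap φ K t (coeffMap (constMap φ) n x) := by
    refine hB.eq_of_mul_eq_zero _ ?_
    change Matrix.vecMul (twistedAltMap φ K t (coeffMap (constMap φ) n x)) _ = 0
    rw [← twistedAltMap_diffMap φ K t ht hb, ← augDiff_comp, coeffMap_comp,
      ← coeffMap_comp (constMap φ), (constSequence φ).zero, coeffMap_zero, map_zero, map_zero]
  have hk : q.ker = (coeffMap (constMap φ) n).ker := by
    ext x
    rw [AddMonoidHom.mem_ker, AddMonoidHom.mem_ker]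
    constructor
    · intro h
      apply hb.1
      rw [← hq, h, Matrix.zero_vecMul, map_zero]
    · intro h
      change Matrix.vecMul (twistedAltMap φ K t (coeffMap (constMap φ) n x)) E = 0
      rw [h, map_zero, Matrix.zero_vecMul]
  rw [← hk]
  refine exists_addEquiv_prod_of_smul_mem q (d := (m : ℤ)) (by exact_mod_cast NeZero.ne m)
    fun c => ?_
  obtain ⟨y, hy⟩ := hb.2 (Matrix.vecMul c B)
  -- The preimage of m·c is a transfer: mapped to Fun it becomes the norm of y, and the norm
  -- multiplies an invariant class by m.
  refine ⟨coeffMap (sumMap φ) n y, ?_⟩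
  change Matrix.vecMul (twistedAltMap φ K t (coeffMap (constMap φ) n (coeffMap (sumMap φ) n y))) E
      = _
  rw [← coeffMap_comp]
  refine (congrArg (Matrix.vecMul · E) (twistedAltMap_normMap φ K t ht hb y)).trans ?_
  have h1 : ∀ i : ℕ, B * minors t (K.actMatrix φ (Multiplicative.ofAdd 1)) ^ i = B := fun i => by
    have h2 : B * minors t (K.actMatrix φ (Multiplicative.ofAdd 1)) = B := by
      have := hB.mul_eq_zero
      rwa [Matrix.mul_sub, Matrix.mul_one, sub_eq_zero] at this
    induction i with
    | zero => rw [pow_zero, Matrix.mul_one]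
    | succ i ih => rw [pow_succ, ← Matrix.mul_assoc, ih, h2]
  have h3 : B * cyclicNorm m (minors t (K.actMatrix φ (Multiplicative.ofAdd 1))) = (m : ℤ) • B := by
    rw [cyclicNorm, Matrix.mul_sum, Finset.sum_congr rfl fun i _ => h1 i, Finset.sum_const,
      Finset.card_range, natCast_zsmul]
  rw [hy, Matrix.vecMul_vecMul c, h3, Matrix.vecMul_smul, Matrix.smul_vecMul, Matrix.vecMul_vecMul,
    hB.mul_eq_one, Matrix.vecMul_one]

end Generic

/-! ### The lattice in adapted coordinates and the bound 3⁸. -/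

section Lattice

/-- The forms of the adapted basis. -/
def adaptedForms : Matrix (Fin 8) (Fin 8) ℤ :=
  !![0, 0, 0, 1, 0, 0, 0, 0;
    -1, -1, 0, 0, -1, 0, -1, 0;
    0, 0, 0, 0, 1, 1, 1, 1;
    0, 0, 1, 0, 0, -1, 1, 0;
    0, 1, 0, 0, 0, 1, 0, 0;
    0, 0, 0, 0, 0, 0, 0, 1;
    0, 0, 0, 0, 1, 1, 0, 1;
    0, 0, 0, 0, 0, -1, 1, 0]

/-- The basis dual to the adapted forms. -/
def adaptedBasis : Matrix (Fin 8) (Fin 8) ℤ :=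
  !![0, -1, 1, 0, -1, 1, -2, -2;
    0, 0, -1, 0, 1, 0, 1, 1;
    0, 0, 0, 1, 0, 0, 0, -1;
    1, 0, 0, 0, 0, 0, 0, 0;
    0, 0, -1, 0, 0, -1, 2, 1;
    0, 0, 1, 0, 0, 0, -1, -1;
    0, 0, 1, 0, 0, 0, -1, 0;
    0, 0, 0, 0, 0, 1, 0, 0]

theorem adaptedForms_mul_adaptedBasis : adaptedForms * adaptedBasis = 1 := by decide +kernel

/-- The adapted forms X₀, …, X₅ are successive translates of X₀ under the inverse of M, and X₆, X₇,
-X₆-X₇ is an orbit of length three. The next translate of X₅ is -X₀-X₃-X₆+X₇. The dual lattice is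
thus an extension of ℤ[ζ₉] by ℤ[ζ₃], and the term -X₆+X₇ is nonzero modulo 3, so it does not split.
-/
theorem formsOne_mul : formsOne * adaptedForms * holonomyMatrix = adaptedForms := by decide +kernel

/-- The adapted coordinates of the lattice. -/
def latticeCoords : Coords Lattice (Fin 8) where
  X a := AddMonoidHom.toMultiplicative
    ((Pi.evalAddMonoidHom (fun _ => ℤ) a).comp (Matrix.mulVecLin adaptedForms).toAddMonoidHom)
  e b := Multiplicative.ofAdd fun i => adaptedBasis i b
  dual a b := (congrFun (congrFun adaptedForms_mul_adaptedBasis a) b).trans Matrix.one_apply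

/-- `Coords.actMatrix` is defined through the inverse of the generator, which acts by M⁸. -/
theorem actMatrix_latticeCoords :
    latticeCoords.actMatrix holonomyAction (Multiplicative.ofAdd 1) = formsOne := by
  have h1 : formsOne * adaptedForms = adaptedForms * holonomyMatrix ^ 8 := by
    conv_rhs => rw [← formsOne_mul]
    rw [Matrix.mul_assoc _ holonomyMatrix, ← pow_succ', holonomyMatrix_pow, Matrix.mul_one]
  have h2 : adaptedForms * holonomyMatrix ^ 8 * adaptedBasis = formsOne := by
    rw [← h1, Matrix.mul_assoc, adaptedForms_mul_adaptedBasis, Matrix.mul_one]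
  refine Eq.trans (Matrix.ext fun a b => ?_) h2
  rw [Matrix.mul_assoc]
  rfl

theorem exists_cohomology_lattice (n : ℕ) (N : ℕ) (hN : Nat.choose 8 n = N) :
    Nonempty (intCohomology Lattice n ≃+ (Fin N → ℤ)) := by
  subst hN
  exact cohomology_lattice 8 n

theorem latticeCoords_bijective {n N : ℕ} (hN : Nat.choose 8 n = N) {t : Fin N → Fin n → Fin 8}
    (ht : IsMinorIndex t) :
    Function.Bijective (altMap (n := n) fun j a => latticeCoords.e (t j a)) ∧
    Function.Bijective (twistedAltMap (n := n) holonomyAction latticeCoords t) := by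
  obtain ⟨E⟩ := exists_cohomology_lattice n N hN
  exact ⟨altMap_bijective latticeCoords t ht E rfl, twistedAltMap_bijective holonomyAction
    latticeCoords t ht ((shapiro holonomyAction n).trans E) rfl⟩

/-- The empty tuple. -/
def tupleZero (_ : Fin 1) : Fin 0 → Fin 8 := Fin.elim0

theorem isMinorIndex_tupleZero : IsMinorIndex tupleZero := fun i j => by
  rw [if_pos (Subsingleton.elim i j)]
  exact Matrix.det_isEmpty

theorem minors_tupleZero : minors tupleZero formsOne = 1 := by
  ext i j
  rw [Subsingleton.elim i j, Matrix.one_apply_eq]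
  exact Matrix.det_isEmpty (A := formsOne.submatrix (tupleZero j) (tupleZero j))

/-- The action on H⁰ is trivial, so the norm is multiplication by 9. This is the only Tate group
among the four that has an element of order 9. -/
theorem homology_zero :
    IsHomologyMap ((1 : Matrix (Fin 1) (Fin 1) ℤ) - 1) (cyclicNorm 9 1)
      (modMap 9 (1 : Matrix (Fin 1) (Fin 1) ℤ)) := by
  have h : cyclicNorm 9 (1 : Matrix (Fin 1) (Fin 1) ℤ) = ((9 : ℕ) : ℤ) • 1 := by
    rw [cyclicNorm, Finset.sum_congr rfl fun i _ => one_pow i, Finset.sum_const, Finset.card_range,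
      natCast_zsmul]
  rw [h]
  refine ⟨fun w _ hp => ?_, fun v => ?_, fun b => ?_⟩
  · obtain ⟨u, hu⟩ := modMap_eq_zero hp
    refine ⟨u, ?_⟩
    rw [Matrix.vecMul_smul, Matrix.vecMul_one, ← hu, Matrix.vecMul_one]
  · exact modMap_vecMul (P' := 1) (Matrix.mul_one _) v
  · exact ⟨_, by rw [sub_self, Matrix.vecMul_zero], modMap_lift (Matrix.mul_one _) b⟩

/-- The action of the generator on the alternating forms of given degree. -/
structure IsActionMatrix {n N : ℕ} (t : Fin N → Fin n → Fin 8) (A : Matrix (Fin N) (Fin N) ℤ) :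
    Prop where
  isMinorIndex : IsMinorIndex t
  minors_eq : minors t (latticeCoords.actMatrix holonomyAction (Multiplicative.ofAdd 1)) = A
  alt_bijective : Function.Bijective (altMap (n := n) fun j a => latticeCoords.e (t j a))
  bijective : Function.Bijective (twistedAltMap (n := n) holonomyAction latticeCoords t)

theorem isActionMatrix {n N : ℕ} (hN : Nat.choose 8 n = N) {t : Fin N → Fin n → Fin 8}
    {A : Matrix (Fin N) (Fin N) ℤ} (ht : IsMinorIndex t) (hA : minors t formsOne = A) :
    IsActionMatrix t A where
  isMinorIndex := ht
  minors_eq := by rw [actMatrix_latticeCoords, hA]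
  alt_bijective := (latticeCoords_bijective hN ht).1
  bijective := (latticeCoords_bijective hN ht).2

namespace IsActionMatrix

variable {n N : ℕ} {t : Fin N → Fin n → Fin 8} {A : Matrix (Fin N) (Fin N) ℤ}
  (h : IsActionMatrix t A)

include h

theorem pow_eq_one : A ^ 9 = 1 := by
  rw [← h.minors_eq]
  exact minors_actMatrix_pow holonomyAction latticeCoords t h.isMinorIndex h.bijective

variable {B : Type} [AddCommGroup B] {p : (Fin N → ℤ) →+ B}

theorem exists_diffMap_eq (hp : IsHomologyMap (cyclicNorm 9 A) (A - 1) p)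
    (x : groupCohomology (funRep holonomyAction) n)
    (h1 : coeffMap (normMap holonomyAction) n x = 0)
    (h2 : p.comp (twistedAltMap holonomyAction latticeCoords t) x = 0) :
    ∃ v, coeffMap (diffMap holonomyAction (Multiplicative.ofAdd 1)) n v = x := by
  obtain ⟨v, hv⟩ := hp.exact (twistedAltMap holonomyAction latticeCoords t x) (by
    rw [← h.minors_eq, ← twistedAltMap_normMap holonomyAction latticeCoords t h.isMinorIndex
      h.bijective, h1, map_zero]) h2
  obtain ⟨y, rfl⟩ := h.bijective.2 v
  refine ⟨y, h.bijective.1 ?_⟩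
  rw [twistedAltMap_diffMap holonomyAction latticeCoords t h.isMinorIndex h.bijective, h.minors_eq,
    hv]

theorem exists_normMap_eq (hp : IsHomologyMap (A - 1) (cyclicNorm 9 A) p)
    (x : groupCohomology (funRep holonomyAction) n)
    (h1 : coeffMap (diffMap holonomyAction (Multiplicative.ofAdd 1)) n x = 0)
    (h2 : p.comp (twistedAltMap holonomyAction latticeCoords t) x = 0) :
    ∃ v, coeffMap (normMap holonomyAction) n v = x := by
  obtain ⟨v, hv⟩ := hp.exact (twistedAltMap holonomyAction latticeCoords t x) (by
    rw [← h.minors_eq, ← twistedAltMap_diffMap holonomyAction latticeCoords t h.isMinorIndex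
      h.bijective, h1, map_zero]) h2
  obtain ⟨y, rfl⟩ := h.bijective.2 v
  refine ⟨y, h.bijective.1 ?_⟩
  rw [twistedAltMap_normMap holonomyAction latticeCoords t h.isMinorIndex h.bijective, h.minors_eq,
    hv]

end IsActionMatrix

theorem isActionMatrix_zero : IsActionMatrix tupleZero 1 :=
  isActionMatrix rfl isMinorIndex_tupleZero minors_tupleZero

theorem isActionMatrix_one : IsActionMatrix tupleOne formsOne :=
  isActionMatrix rfl isMinorIndex_tupleOne minors_tupleOne

theorem isActionMatrix_two : IsActionMatrix tupleTwo formsTwo :=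
  isActionMatrix (by decide) isMinorIndex_tupleTwo minors_tupleTwo

theorem isActionMatrix_three : IsActionMatrix tupleThree formsThree :=
  isActionMatrix (by decide) isMinorIndex_tupleThree minors_tupleThree

theorem isActionMatrix_four : IsActionMatrix tupleFour formsFour :=
  isActionMatrix (by decide) isMinorIndex_tupleFour minors_tupleFour

/-- Each of the Tate groups of C in H⁰(L), …, H³(L) has order nine. -/
theorem ker_constMap_holonomy :
    {x | coeffMap (constMap holonomyAction) 4 x = 0}.Finite ∧
    {x | coeffMap (constMap holonomyAction) 4 x = 0}.ncard ≤ 3 ^ 8 := by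
  have h := ker_constMap_four holonomyAction _ _ _ _
    (isActionMatrix_zero.exists_normMap_eq homology_zero)
    (isActionMatrix_one.exists_diffMap_eq (homology_one isActionMatrix_one.pow_eq_one))
    (isActionMatrix_two.exists_normMap_eq (homology_two isActionMatrix_two.pow_eq_one))
    (isActionMatrix_three.exists_diffMap_eq (homology_three isActionMatrix_three.pow_eq_one))
  refine ⟨h.1, h.2.trans (le_of_eq ?_)⟩
  simp

theorem cohomology_four_split : Nonempty (intCohomology CrystalGroup 4 ≃+
    (coeffMap (constMap holonomyAction) 4).ker × (Fin 8 → ℤ)) := by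
  refine exists_addEquiv_ker_prod holonomyAction latticeCoords tupleFour isMinorIndex_tupleFour
    isActionMatrix_four.bijective (B := invariantsFour) (E := coordinatesFour) ?_
  rw [isActionMatrix_four.minors_eq]
  exact isKernelBasis_four

end Lattice

/-! ### The sum of the groups Hⁱ(C, Hʲ(L)). -/

section SpectralSum

theorem nonempty_directSum_addEquiv {H : (Finset.HasAntidiagonal.antidiagonal 4) → Type}
    [∀ p, AddCommGroup (H p)] {X₀ X₁ X₂ X₃ X₄ : Type} [AddCommGroup X₀] [AddCommGroup X₁]
    [AddCommGroup X₂] [AddCommGroup X₃] [AddCommGroup X₄]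
    (e₀ : H ⟨(0, 4), by decide⟩ ≃+ X₀) (e₁ : H ⟨(1, 3), by decide⟩ ≃+ X₁)
    (e₂ : H ⟨(2, 2), by decide⟩ ≃+ X₂) (e₃ : H ⟨(3, 1), by decide⟩ ≃+ X₃)
    (e₄ : H ⟨(4, 0), by decide⟩ ≃+ X₄) :
    Nonempty ((DirectSum (Finset.HasAntidiagonal.antidiagonal 4) fun p => H p) ≃+
      X₀ × X₁ × X₂ × X₃ × X₄) := by
  let f : (∀ p, H p) →+ X₀ × X₁ × X₂ × X₃ × X₄ :=
    AddMonoidHom.mk' (fun x => (e₀ (x _), e₁ (x _), e₂ (x _), e₃ (x _), e₄ (x _))) fun x y => by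
      simp
  have hp : ∀ p : Finset.HasAntidiagonal.antidiagonal 4, p = ⟨(0, 4), by decide⟩ ∨
      p = ⟨(1, 3), by decide⟩ ∨ p = ⟨(2, 2), by decide⟩ ∨ p = ⟨(3, 1), by decide⟩ ∨
      p = ⟨(4, 0), by decide⟩ := by decide
  refine ⟨(DirectSum.addEquivProd _).trans (AddEquiv.ofBijective f ⟨?_, ?_⟩)⟩
  · rw [injective_iff_map_eq_zero]
    intro x hx
    simp only [f, AddMonoidHom.mk'_apply, Prod.mk_eq_zero, EmbeddingLike.map_eq_zero_iff] at hx
    obtain ⟨h0, h1, h2, h3, h4⟩ := hx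
    funext p
    obtain rfl | rfl | rfl | rfl | rfl := hp p <;> assumption
  · rintro ⟨x0, x1, x2, x3, x4⟩
    let x : ∀ p, H p := Function.update (Function.update (Function.update (Function.update
      (Function.update 0 _ (e₀.symm x0)) _ (e₁.symm x1)) _ (e₂.symm x2)) _ (e₃.symm x3)) _
      (e₄.symm x4)
    refine ⟨x, ?_⟩
    simp [f, x, Function.update_of_ne]

variable {n N : ℕ} {t : Fin N → Fin n → Fin 8} {A : Matrix (Fin N) (Fin N) ℤ}
  (h : IsActionMatrix t A)

include h in
theorem IsActionMatrix.exists_addEquiv : ∃ W : cohomologyRep holonomyAction n ≃+ (Fin N → ℤ),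
    ∀ x, W ((cohomologyRep holonomyAction n).ρ (Multiplicative.ofAdd 1) x) =
      Matrix.vecMul (W x) A := by
  refine ⟨AddEquiv.ofBijective (altMap (n := n) fun j a => latticeCoords.e (t j a))
    h.alt_bijective, fun x => ?_⟩
  refine (altMap_pullback holonomyAction latticeCoords t h.isMinorIndex h.alt_bijective.1
    (Multiplicative.ofAdd 1) x).trans ?_
  rw [h.minors_eq]
  rfl

/-- The certificates that bound the torsion of H⁴(Γ, ℤ) also compute these groups, because right
translations and pull-backs have the same matrices. Only the invariants of H⁴(L) are used in
addition. -/
theorem cohomologySum_four : Nonempty (cohomologySum holonomyAction 4 ≃+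
    (Fin 8 → ℤ) × (Fin 2 → ZMod 3) × (Fin 2 → ZMod 3) × (Fin 2 → ZMod 3) × (Fin 1 → ZMod 9)) := by
  obtain ⟨W₀, h₀⟩ := isActionMatrix_zero.exists_addEquiv
  obtain ⟨W₁, h₁⟩ := isActionMatrix_one.exists_addEquiv
  obtain ⟨W₂, h₂⟩ := isActionMatrix_two.exists_addEquiv
  obtain ⟨W₃, h₃⟩ := isActionMatrix_three.exists_addEquiv
  obtain ⟨W₄, h₄⟩ := isActionMatrix_four.exists_addEquiv
  obtain ⟨e₀⟩ := cohomology_zero _ W₄ _ _ _ h₄ isKernelBasis_four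
  obtain ⟨e₁⟩ := cohomology_odd _ W₃ _ _ h₃ (homology_three isActionMatrix_three.pow_eq_one) 1
    (by decide)
  obtain ⟨e₂⟩ := cohomology_even _ W₂ _ _ h₂ (homology_two isActionMatrix_two.pow_eq_one) 2
    (by decide)
  obtain ⟨e₃⟩ := cohomology_odd _ W₁ _ _ h₁ (homology_one isActionMatrix_one.pow_eq_one) 3
    (by decide)
  obtain ⟨e₄⟩ := cohomology_even _ W₀ _ _ h₀ homology_zero 4 (by decide)
  exact nonempty_directSum_addEquiv
    (H := fun p => groupCohomology (cohomologyRep holonomyAction p.1.2) p.1.1) e₀ e₁ e₂ e₃ e₄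

theorem cohomologySum_holonomy : Nonempty (cohomologySum holonomyAction 4 ≃+
    (Fin 8 → ℤ) × ZMod 9 × (Fin 6 → ZMod 3)) := by
  obtain ⟨e⟩ := cohomologySum_four
  let f : (Fin 8 → ℤ) × (Fin 2 → ZMod 3) × (Fin 2 → ZMod 3) × (Fin 2 → ZMod 3) × (Fin 1 → ZMod 9) ≃+
      (Fin 8 → ℤ) × ZMod 9 × (Fin 6 → ZMod 3) :=
    { toFun := fun x => (x.1, x.2.2.2.2 0, ![x.2.1 0, x.2.1 1, x.2.2.1 0, x.2.2.1 1, x.2.2.2.1 0,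
        x.2.2.2.1 1])
      invFun := fun y => (y.1, ![y.2.2 0, y.2.2 1], ![y.2.2 2, y.2.2 3], ![y.2.2 4, y.2.2 5],
        ![y.2.1])
      left_inv := fun x => by
        refine Prod.ext rfl (Prod.ext ?_ (Prod.ext ?_ (Prod.ext ?_ ?_))) <;> funext i <;>
          fin_cases i <;> rfl
      right_inv := fun y => by
        refine Prod.ext rfl (Prod.ext rfl ?_)
        funext i
        fin_cases i <;> rfl
      map_add' := fun x y => by
        refine Prod.ext rfl (Prod.ext rfl ?_)
        funext i
        fin_cases i <;> rfl }
  exact ⟨e.trans f⟩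

end SpectralSum

/-! ### Bocksteins and their values on finite cyclic subgroups. -/

section Bockstein

variable {G : Type} [Group G]

theorem cohomClass_nsmul {A : Rep ℤ G} {n : ℕ} (f : (Fin n → G) → A)
    (hf : inhomogeneousCochains.d A n f = 0) (m : ℕ) :
    ∃ h, m • cohomClass f hf = cohomClass (m • f) h := by
  have h : inhomogeneousCochains.d A n (m • f) = 0 := by rw [map_nsmul, hf, smul_zero]
  refine ⟨h, ?_⟩
  unfold cohomClass
  rw [← map_nsmul]
  congr 1
  apply (ModuleCat.mono_iff_injective (iCocycles A n)).1 inferInstance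
  rw [map_nsmul, iCocycles_mk, iCocycles_mk]

/-- The identity satisfied by inhomogeneous three-cocycles with trivial coefficients. -/
def IsThreeCocycle {R : Type} [CommRing R] (h : G → G → G → R) : Prop :=
  ∀ x y z w, h y z w - h (x * y) z w + h x (y * z) w - h x y (z * w) + h x y z = 0

theorem d_three_apply (h : (Fin 3 → G) → ℤ) (γ : Fin 4 → G) :
    inhomogeneousCochains.d (Rep.trivial ℤ G ℤ) 3 h γ =
      h ![γ 1, γ 2, γ 3] - h ![γ 0 * γ 1, γ 2, γ 3] + h ![γ 0, γ 1 * γ 2, γ 3] -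
        h ![γ 0, γ 1, γ 2 * γ 3] + h ![γ 0, γ 1, γ 2] := by
  have e0 : (fun i : Fin 3 => γ i.succ) = ![γ 1, γ 2, γ 3] := by
    funext i; fin_cases i <;> rfl
  have e1 : Fin.contractNth 0 (· * ·) γ = ![γ 0 * γ 1, γ 2, γ 3] := by
    funext i; fin_cases i <;> rfl
  have e2 : Fin.contractNth 1 (· * ·) γ = ![γ 0, γ 1 * γ 2, γ 3] := by
    funext i; fin_cases i <;> rfl
  have e3 : Fin.contractNth 2 (· * ·) γ = ![γ 0, γ 1, γ 2 * γ 3] := by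
    funext i; fin_cases i <;> rfl
  have e4 : Fin.contractNth 3 (· * ·) γ = ![γ 0, γ 1, γ 2] := by
    funext i; fin_cases i <;> rfl
  rw [inhomogeneousCochains.d_hom_apply, e0]
  change h ![γ 1, γ 2, γ 3] + ∑ i : Fin 4, (-1 : ℤ) ^ ((i : ℕ) + 1) *
    h (Fin.contractNth i (· * ·) γ) = _
  rw [Fin.sum_univ_four, e1, e2, e3, e4]
  change _ + ((-1 : ℤ) ^ 1 * _ + (-1 : ℤ) ^ 2 * _ + (-1 : ℤ) ^ 3 * _ + (-1 : ℤ) ^ 4 * _) = _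
  ring

/-- The sum of the values of a four-cochain that detects classes on the cyclic group generated by
an element of order dividing `n`. -/
def cyclicSum (m : ℕ) (γ : G) (n q : ℕ) : ((Fin 4 → G) → ℤ) →+ ZMod m where
  toFun f := ((q * ∑ i ∈ Finset.range n, ∑ j ∈ Finset.range n, f ![γ ^ i, γ, γ ^ j, γ] : ℤ) : ZMod
      m)
  map_zero' := by simp
  map_add' f g := by
    simp only [Pi.add_apply, Finset.sum_add_distrib, mul_add, Int.cast_add]

theorem sum_range_shift {B : Type} [AddCommGroup B] {γ : G} {n : ℕ} (hγ : γ ^ n = 1) (f : G → B) :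
    ∑ i ∈ Finset.range n, f (γ ^ (i + 1)) = ∑ i ∈ Finset.range n, f (γ ^ i) := by
  have h1 := Finset.sum_range_succ (fun i => f (γ ^ i)) n
  rw [Finset.sum_range_succ', hγ, pow_zero] at h1
  exact add_right_cancel h1

/-- Four of the five terms of the coboundary cancel in pairs after cyclic reindexing of i or j. The
remaining term does not depend on i, whence the factor n. -/
theorem sum_d_three {γ : G} {n : ℕ} (hγ : γ ^ n = 1) (h : (Fin 3 → G) → ℤ) :
    ∑ i ∈ Finset.range n, ∑ j ∈ Finset.range n,
      inhomogeneousCochains.d (Rep.trivial ℤ G ℤ) 3 h ![γ ^ i, γ, γ ^ j, γ] =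
      n * ∑ j ∈ Finset.range n, h ![γ, γ ^ j, γ] := by
  have e (i j : ℕ) : inhomogeneousCochains.d (Rep.trivial ℤ G ℤ) 3 h ![γ ^ i, γ, γ ^ j, γ] =
      h ![γ, γ ^ j, γ] - h ![γ ^ (i + 1), γ ^ j, γ] + h ![γ ^ i, γ ^ (j + 1), γ] -
        h ![γ ^ i, γ, γ ^ (j + 1)] + h ![γ ^ i, γ, γ ^ j] := by
    rw [d_three_apply, pow_succ γ i, pow_succ' γ j]
    have : γ * γ ^ j = γ ^ j * γ := (pow_mul_comm' γ j).symm
    simp only [Matrix.cons_val]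
    rw [this]
  simp only [e, Finset.sum_add_distrib, Finset.sum_sub_distrib, Finset.sum_const, Finset.card_range]
  rw [sum_range_shift hγ (fun x => ∑ j ∈ Finset.range n, h ![x, γ ^ j, γ]),
    Finset.sum_congr rfl fun i _ => sum_range_shift hγ (fun x => h ![γ ^ i, x, γ]),
    Finset.sum_congr rfl fun i _ => sum_range_shift hγ (fun x => h ![γ ^ i, γ, x]), nsmul_eq_mul]
  ring

variable {m : ℕ} {γ : G} {n q : ℕ} (hγ : γ ^ n = 1) (hq : n * q = m)

include hγ hq in
-- On a coboundary the double sum is a multiple of n. The factor q turns this into a multiple of m,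
-- which corresponds to embedding ℤ/n in ℤ/m.
theorem cyclicSum_d (k : ℕ) (hk : k + 1 = 4) (h : (Fin k → G) → ℤ) :
    cyclicSum m γ n q ((inhomogeneousCochains (Rep.trivial ℤ G ℤ)).d k 4 h) = 0 := by
  obtain rfl : k = 3 := by omega
  rw [inhomogeneousCochains.d_def]
  change ((q * ∑ i ∈ Finset.range n, ∑ j ∈ Finset.range n,
    inhomogeneousCochains.d (Rep.trivial ℤ G ℤ) 3 h ![γ ^ i, γ, γ ^ j, γ] : ℤ) : ZMod m) = 0
  rw [sum_d_three hγ, ← mul_assoc, mul_comm (q : ℤ), ← Nat.cast_mul, hq, Int.cast_mul,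
    Int.cast_natCast, ZMod.natCast_self, zero_mul]

/-- The functional on the fourth cohomology attached to an element of finite order. -/
def cyclicValue : intCohomology G 4 →+ ZMod m :=
  descend (A := Rep.trivial ℤ G ℤ) (cyclicSum m γ n q) (cyclicSum_d hγ hq)

/-- The Bockstein of a three-cocycle with finite coefficients. -/
theorem exists_bockstein {m : ℕ} [NeZero m] (h : G → G → G → ZMod m) (hh : IsThreeCocycle h) :
    ∃ x : intCohomology G 4, m • x = 0 ∧ ∀ (γ : G) (n q : ℕ) (hγ : γ ^ n = 1) (hq : n * q = m),
      cyclicValue hγ hq x = ∑ j ∈ Finset.range n, h γ (γ ^ j) γ := by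
  let H : (Fin 3 → G) → ℤ := fun γ => ((h (γ 0) (γ 1) (γ 2)).val : ℤ)
  have hH (x y z : G) : ((H ![x, y, z] : ℤ) : ZMod m) = h x y z := by
    change (((h x y z).val : ℤ) : ZMod m) = h x y z
    rw [Int.cast_natCast, ZMod.natCast_zmod_val]
  have hd (γ : Fin 4 → G) : (m : ℤ) ∣ inhomogeneousCochains.d (Rep.trivial ℤ G ℤ) 3 H γ := by
    rw [d_three_apply, ← ZMod.intCast_zmod_eq_zero_iff_dvd]
    push_cast [hH]
    exact hh _ _ _ _
  choose f hf using hd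
  -- The integral lift of the cocycle has a coboundary divisible by m, and the quotient f represents
  -- the Bockstein. It is a cocycle because cochains are torsion free, and m·f is a coboundary.
  have hf' : inhomogeneousCochains.d (Rep.trivial ℤ G ℤ) 3 H = m • f := by
    funext γ
    rw [hf, Pi.smul_apply, nsmul_eq_mul]
  have hm : (m : ℤ) ≠ 0 := by exact_mod_cast NeZero.ne m
  have hdd : inhomogeneousCochains.d (Rep.trivial ℤ G ℤ) 4
      (inhomogeneousCochains.d (Rep.trivial ℤ G ℤ) 3 H) = 0 :=
    congr($(inhomogeneousCochains.d_comp_d (A := Rep.trivial ℤ G ℤ) 3) H)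
  have hz : inhomogeneousCochains.d (Rep.trivial ℤ G ℤ) 4 f = 0 := by
    rw [hf', map_nsmul] at hdd
    funext γ
    have h1 : m • inhomogeneousCochains.d (Rep.trivial ℤ G ℤ) 4 f γ = 0 := congrFun hdd γ
    rw [nsmul_eq_mul] at h1
    exact (mul_eq_zero.1 h1).resolve_left (by exact_mod_cast NeZero.ne m)
  refine ⟨cohomClass (A := Rep.trivial ℤ G ℤ) f hz, ?_, fun γ n q hγ hq => ?_⟩
  · obtain ⟨h1, h2⟩ := cohomClass_nsmul (A := Rep.trivial ℤ G ℤ) f hz m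
    refine h2.trans ?_
    have h3 : ∀ (g : (Fin 4 → G) → ℤ) (e : g = inhomogeneousCochains.d (Rep.trivial ℤ G ℤ) 3 H)
        (hg : inhomogeneousCochains.d (Rep.trivial ℤ G ℤ) 4 g = 0),
        cohomClass (A := Rep.trivial ℤ G ℤ) g hg = 0 := by
      rintro g rfl hg
      exact cohomClass_eq_zero _ hg
    exact h3 _ hf'.symm h1
  · refine (descend_cohomClass (A := Rep.trivial ℤ G ℤ) (cyclicSum m γ n q) (cyclicSum_d hγ hq)
      f hz).trans ?_
    have hn : (n : ℤ) ≠ 0 := by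
      rintro h0
      rw [Nat.cast_eq_zero] at h0
      rw [h0, zero_mul] at hq
      exact NeZero.ne m hq.symm
    -- After multiplication by n both sides are the double sum of the coboundary of the lift, since
    -- n·q·f = m·f.
    have h1 : (q : ℤ) * ∑ i ∈ Finset.range n, ∑ j ∈ Finset.range n, f ![γ ^ i, γ, γ ^ j, γ] =
        ∑ j ∈ Finset.range n, H ![γ, γ ^ j, γ] := by
      apply mul_left_cancel₀ hn
      rw [← sum_d_three hγ, ← mul_assoc, ← Nat.cast_mul, hq, Finset.mul_sum]
      simp only [Finset.mul_sum, hf]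
    change (((q : ℤ) * ∑ i ∈ Finset.range n, ∑ j ∈ Finset.range n, f ![γ ^ i, γ, γ ^ j, γ] : ℤ) :
      ZMod m) = _
    rw [h1, Int.cast_sum]
    exact Finset.sum_congr rfl fun j _ => hH _ _ _

end Bockstein

/-! ### Constructions of cocycles on semidirect products. -/

section Cocycles

variable {G R : Type} [Group G] [CommRing R]

/-- The identity satisfied by inhomogeneous two-cocycles with trivial coefficients. -/
def IsTwoCocycle (p : G → G → R) : Prop :=
  ∀ x y z, p y z - p (x * y) z + p x (y * z) - p x y = 0

theorem IsTwoCocycle.cup {p : G → G → R} (hp : IsTwoCocycle p) {κ : G → R}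
    (hκ : ∀ x y, κ (x * y) = κ x + κ y) : IsThreeCocycle fun x y z => κ x * p y z := by
  intro x y z w
  linear_combination (-κ x) * hp y z w - p z w * hκ x y

variable {L C : Type} [CommGroup L] [Group C] {φ : C →* MulAut L}

theorem isTwoCocycle_bilinear {ω : L → L → R} (h₁ : ∀ a b c, ω (a * b) c = ω a c + ω b c)
    (h₂ : ∀ a b c, ω a (b * c) = ω a b + ω a c) (hω : ∀ g a b, ω (φ g a) (φ g b) = ω a b) :
    IsTwoCocycle fun x y : L ⋊[φ] C => ω x.left (φ x.right y.left) := by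
  intro x y z
  simp only [SemidirectProduct.mul_left, SemidirectProduct.mul_right, map_mul, MulAut.mul_apply,
    h₁, h₂, hω]
  ring

theorem isTwoCocycle_right {p : C → C → R} (hp : IsTwoCocycle p) :
    IsTwoCocycle fun x y : L ⋊[φ] C => p x.right y.right := fun _ _ _ => hp _ _ _

theorem left_mul_of_invariant {ε : L → R} (h : ∀ a b, ε (a * b) = ε a + ε b)
    (hε : ∀ g a, ε (φ g a) = ε a) (x y : L ⋊[φ] C) : ε (x * y).left = ε x.left + ε y.left := by
  rw [SemidirectProduct.mul_left, h, hε]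

end Cocycles

section Cyclic

variable {L : Type} [CommGroup L] {m : ℕ} [NeZero m] {φ : Multiplicative (ZMod m) →* MulAut L}

/-- The sum of the first `k` translates of a function under the generator. -/
def partialSum (φ : Multiplicative (ZMod m) →* MulAut L) {R : Type} [AddCommMonoid R] (c : L → R)
    (k : ℕ) (l : L) : R :=
  ∑ i ∈ Finset.range k, c (φ (Multiplicative.ofAdd (i : ZMod m)) l)

variable {R : Type} [CommRing R] {c : L → R}

theorem partialSum_add (k n : ℕ) (l : L) : partialSum φ c (k + n) l =
    partialSum φ c k (φ (Multiplicative.ofAdd (n : ZMod m)) l) + partialSum φ c n l := by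
  rw [add_comm, partialSum, Finset.sum_range_add, add_comm]
  congr 1
  refine Finset.sum_congr rfl fun i _ => ?_
  rw [← MulAut.mul_apply, ← map_mul, ← ofAdd_add, Nat.cast_add, add_comm]

/-- The vanishing of the full orbit sum allows the number of summands to be read modulo m. The
partial sums then form a one-cocycle of the cyclic group with values in functions on L. -/
theorem partialSum_val_add (hc : ∀ l, partialSum φ c m l = 0) (a b : ZMod m) (l : L) :
    partialSum φ c (a + b).val l =
      partialSum φ c a.val (φ (Multiplicative.ofAdd b) l) + partialSum φ c b.val l := by
  have h (n : ℕ) : partialSum φ c (n % m) l = partialSum φ c n l := by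
    conv_rhs => rw [← Nat.mod_add_div n m]
    induction n / m with
    | zero => rfl
    | succ d ih => rw [mul_add, mul_one, add_comm (m * d), ← add_assoc, add_right_comm,
        partialSum_add, ZMod.natCast_self, hc, add_zero, ofAdd_zero, map_one, MulAut.one_apply, ←
            ih]
  rw [ZMod.val_add, h, partialSum_add, ZMod.natCast_val, ZMod.cast_id]

/-- The predicate carries both a group element and a natural exponent, for statements in which the
number of summands of `partialSum` also appears. -/
theorem induct_cyclic {P : Multiplicative (ZMod m) → ℕ → Prop} (h0 : P 1 0)
    (hs : ∀ k : ℕ, P (Multiplicative.ofAdd (k : ZMod m)) k →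
      P (Multiplicative.ofAdd 1 * Multiplicative.ofAdd (k : ZMod m)) (k + 1))
    (g : Multiplicative (ZMod m)) : P g g.toAdd.val := by
  have h (k : ℕ) : P (Multiplicative.ofAdd (k : ZMod m)) k := by
    induction k with
    | zero => rwa [Nat.cast_zero, ofAdd_zero]
    | succ k ih =>
      have := hs k ih
      rwa [← ofAdd_add, add_comm, ← Nat.cast_succ] at this
  have := h g.toAdd.val
  rwa [ZMod.natCast_val, ZMod.cast_id, ofAdd_toAdd] at this

/-- The data of a three-cocycle of `L ⋊ ℤ/m` modulo `m` whose restriction to `L` is trilinear. -/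
structure IsTrilinearDatum (φ : Multiplicative (ZMod m) →* MulAut L) (E N : L → L → L → ZMod m)
    (b : L → L → ZMod m) (c : L → ZMod m) : Prop where
  add₁ : ∀ p p' q r, E (p * p') q r = E p q r + E p' q r
  add₂ : ∀ p q q' r, E p (q * q') r = E p q r + E p q' r
  add₃ : ∀ p q r r', E p q (r * r') = E p q r + E p q r'
  shift : ∀ p q r, E (φ (Multiplicative.ofAdd 1) p) (φ (Multiplicative.ofAdd 1) q)
    (φ (Multiplicative.ofAdd 1) r) = E p q r + N p q r
  invariant : ∀ p q r, N (φ (Multiplicative.ofAdd 1) p) (φ (Multiplicative.ofAdd 1) q)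
    (φ (Multiplicative.ofAdd 1) r) = N p q r
  coboundary : ∀ p q r, b q r - b (p * q) r + b p (q * r) - b p q = - N p q r
  defect : ∀ p q, b p q - b (φ (Multiplicative.ofAdd 1) p) (φ (Multiplicative.ofAdd 1) q) =
    c p + c q - c (p * q)
  sum_eq_zero : ∀ p, partialSum φ c m p = 0

/-- The three-cocycle attached to a trilinear datum. -/
def trilinearCocycle (φ : Multiplicative (ZMod m) →* MulAut L) (E : L → L → L → ZMod m)
    (b : L → L → ZMod m) (c : L → ZMod m) (x y z : L ⋊[φ] Multiplicative (ZMod m)) : ZMod m :=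
  x.right.toAdd * (b y.left (φ y.right z.left) + partialSum φ c y.right.toAdd.val z.left) +
    E x.left (φ x.right y.left) (φ x.right (φ y.right z.left))

namespace IsTrilinearDatum

variable {E N : L → L → L → ZMod m} {b : L → L → ZMod m} {c : L → ZMod m}
  (h : IsTrilinearDatum φ E N b c)

include h

theorem invariant' (g : Multiplicative (ZMod m)) (p q r : L) :
    N (φ g p) (φ g q) (φ g r) = N p q r := by
  refine induct_cyclic (P := fun g _ => N (φ g p) (φ g q) (φ g r) = N p q r) ?_ (fun k hk => ?_) g
  · simp only [map_one, MulAut.one_apply]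
  · rw [map_mul, MulAut.mul_apply, MulAut.mul_apply, MulAut.mul_apply, h.invariant, hk]

theorem shift' (g : Multiplicative (ZMod m)) (p q r : L) :
    E (φ g p) (φ g q) (φ g r) = E p q r + g.toAdd * N p q r := by
  have := induct_cyclic (P := fun g k => E (φ g p) (φ g q) (φ g r) = E p q r + k * N p q r) ?_
    (fun k hk => ?_) g
  · rwa [ZMod.natCast_val, ZMod.cast_id] at this
  · simp only [map_one, MulAut.one_apply]
    push_cast
    ring
  · rw [map_mul, MulAut.mul_apply, MulAut.mul_apply, MulAut.mul_apply, h.shift, hk, h.invariant']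
    push_cast
    ring

/-- The single-step defects telescope along the powers of the generator. -/
theorem defect' (g : Multiplicative (ZMod m)) (p q : L) :
    b p q - b (φ g p) (φ g q) = partialSum φ c g.toAdd.val p + partialSum φ c g.toAdd.val q -
      partialSum φ c g.toAdd.val (p * q) := by
  refine induct_cyclic (P := fun g k => b p q - b (φ g p) (φ g q) = partialSum φ c k p +
    partialSum φ c k q - partialSum φ c k (p * q)) ?_ (fun k hk => ?_) g
  · simp [partialSum]
  · rw [map_mul, MulAut.mul_apply, MulAut.mul_apply]
    have h1 := h.defect (φ (Multiplicative.ofAdd (k : ZMod m)) p)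
      (φ (Multiplicative.ofAdd (k : ZMod m)) q)
    have h2 (l : L) : partialSum φ c (k + 1) l =
      partialSum φ c k l + c (φ (Multiplicative.ofAdd (k : ZMod m)) l) := Finset.sum_range_succ _ _
    rw [h2, h2, h2, map_mul]
    linear_combination hk + h1

/-- Adding the partial sums of c to b absorbs the failure of b to be invariant. The result is a
two-cochain on the whole semidirect product whose coboundary is still -N. -/
theorem isTwoCochain (x y z : L ⋊[φ] Multiplicative (ZMod m)) :
    (b y.left (φ y.right z.left) + partialSum φ c y.right.toAdd.val z.left) -
      (b (x * y).left (φ (x * y).right z.left) +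
        partialSum φ c (x * y).right.toAdd.val z.left) +
      (b x.left (φ x.right (y * z).left) + partialSum φ c x.right.toAdd.val (y * z).left) -
      (b x.left (φ x.right y.left) + partialSum φ c x.right.toAdd.val y.left) =
    - N x.left (φ x.right y.left) (φ x.right (φ y.right z.left)) := by
  simp only [SemidirectProduct.mul_left, SemidirectProduct.mul_right, map_mul, MulAut.mul_apply,
    toAdd_mul]
  rw [partialSum_val_add h.sum_eq_zero, ofAdd_toAdd]
  have h1 := h.defect' x.right y.left (φ y.right z.left)
  have h2 := h.coboundary x.left (φ x.right y.left) (φ x.right (φ y.right z.left))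
  linear_combination h1 + h2

/-- E alone is not a cocycle, since acting by g changes it by g·N. The product of the residue of x
with the two-cochain of coboundary -N has exactly the opposite defect. -/
theorem isThreeCocycle : IsThreeCocycle (trilinearCocycle φ E b c) := by
  intro x y z w
  have h1 := h.isTwoCochain y z w
  have h2 := h.shift' x.right y.left (φ y.right z.left) (φ y.right (φ z.right w.left))
  simp only [trilinearCocycle, SemidirectProduct.mul_left, SemidirectProduct.mul_right, map_mul,
    MulAut.mul_apply, toAdd_mul, h.add₁, h.add₂, h.add₃] at h1 h2 ⊢
  linear_combination (-x.right.toAdd) * h1 - h2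

end IsTrilinearDatum

end Cyclic

/-! ### The explicit polynomials behind the exotic cocycle. -/

section Polynomials

/-- The generator in the adapted coordinates. -/
def turn (p : Fin 8 → ℤ) : Fin 8 → ℤ :=
  ![-p 2 - p 5 + 2 * p 6 + p 7, p 0, p 1, p 2, p 3, p 4, -p 6 - p 7, p 6]

/-- The orbit of the first adapted coordinate. -/
def longOrbit (p : Fin 8 → ℤ) : Fin 9 → ℤ :=
  ![p 0, p 1, p 2, p 3, p 4, p 5, -p 0 - p 3 - p 6 + p 7, -p 1 - p 4 - p 6 - 2 * p 7,
    -p 2 - p 5 + 2 * p 6 + p 7]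

/-- The orbit of the seventh adapted coordinate. -/
def shortOrbit (p : Fin 8 → ℤ) : Fin 9 → ℤ :=
  ![p 6, p 7, -p 6 - p 7, p 6, p 7, -p 6 - p 7, p 6, p 7, -p 6 - p 7]

theorem longOrbit_turn (p : Fin 8 → ℤ) (k : Fin 9) :
    longOrbit (turn p) k = longOrbit p (k - 1) := by
  fin_cases k <;> simp [longOrbit, turn] <;> ring

theorem shortOrbit_turn (p : Fin 8 → ℤ) (k : Fin 9) :
    shortOrbit (turn p) k = shortOrbit p (k - 1) := by
  fin_cases k <;> simp [shortOrbit, turn]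

/-- The translates of a trilinear form. -/
def trilinearForm (k : Fin 9) (p q r : Fin 8 → ℤ) : ℤ :=
  longOrbit p k * (2 * longOrbit q (k + 1) * (shortOrbit r k + shortOrbit r (k + 1)) +
    4 * longOrbit q (k + 2) * shortOrbit r (k + 1) + 2 * longOrbit q (k + 3) * shortOrbit r k -
    longOrbit q (k + 2) * (2 * longOrbit r (k + 5) + 4 * longOrbit r (k + 6)))

theorem trilinearForm_turn (k : Fin 9) (p q r : Fin 8 → ℤ) :
    trilinearForm k (turn p) (turn q) (turn r) = trilinearForm (k - 1) p q r := by
  simp only [trilinearForm, longOrbit_turn, shortOrbit_turn, sub_add_eq_add_sub]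

/-- A cochain whose coboundary is the negative of the norm of the trilinear form. -/
def quadraticCochain (p q : Fin 8 → ℤ) : ℤ :=
  q 1 * (4 * p 0 * p 4 + 4 * p 3 * p 4) +
  q 2 * (-2 * p 0 ^ 2 + 4 * p 1 * p 5 - 2 * p 2 * p 6 + 4 * p 4 * p 5 - 2 * p 5 * p 6 +
  2 * p 5 * p 7 - 4 * p 6 * p 7 + 2 * p 7 ^ 2) +
  q 3 * (2 * p 0 * p 6 + 4 * p 0 * p 7 - 2 * p 1 ^ 2 - 4 * p 2 * p 3 - 4 * p 2 * p 6 +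
  4 * p 2 * p 7 - 4 * p 5 * p 6 + 4 * p 5 * p 7 - 8 * p 6 * p 7 - 2 * p 7 ^ 2) +
  q 4 * (4 * p 0 * p 1 + 4 * p 0 * p 4 + 4 * p 0 * p 6 + 8 * p 0 * p 7 + 4 * p 1 * p 3 -
  4 * p 1 * p 6 - 2 * p 1 * p 7 - 2 * p 2 ^ 2) +
  q 5 * (4 * p 0 * p 3 + 4 * p 1 * p 2 + 4 * p 1 * p 5 - 8 * p 1 * p 6 - 4 * p 1 * p 7 +
  4 * p 2 * p 4 + 2 * p 3 ^ 2) +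
  q 6 * (-p 0 ^ 2 + 4 * p 0 * p 1 - 4 * p 0 * p 3 + 6 * p 0 * p 4 + 2 * p 0 * p 6 +
  10 * p 0 * p 7 - 4 * p 1 * p 2 + 2 * p 1 * p 3 - 4 * p 1 * p 4 - 10 * p 1 * p 5 +
  10 * p 1 * p 6 + 2 * p 1 * p 7 - 4 * p 2 * p 3 - 2 * p 2 * p 4 - 2 * p 2 * p 5 -
  10 * p 2 * p 6 - 6 * p 2 * p 7 - 5 * p 3 ^ 2 + 4 * p 3 * p 4 - 4 * p 3 * p 5 - 8 * p 3 * p 6 -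
  4 * p 4 * p 5 + 2 * p 4 * p 6 - 2 * p 4 * p 7 + p 5 ^ 2 - 2 * p 5 * p 6 - 4 * p 5 * p 7 +
  3 * p 6 ^ 2 + 6 * p 6 * p 7) +
  q 7 * (4 * p 0 * p 1 + 2 * p 0 * p 2 + 10 * p 0 * p 4 + 4 * p 0 * p 5 + 6 * p 0 * p 7 -
  p 1 ^ 2 + 2 * p 1 * p 3 - 4 * p 1 * p 5 - 6 * p 1 * p 7 + p 2 ^ 2 + 2 * p 2 * p 3 -
  2 * p 2 * p 5 - 6 * p 2 * p 6 - 2 * p 3 ^ 2 + 4 * p 3 * p 4 + 6 * p 3 * p 5 - 12 * p 3 * p 6 -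
  p 4 ^ 2 + 2 * p 4 * p 6 - 2 * p 4 * p 7 + p 5 ^ 2 + 4 * p 5 * p 6 - 4 * p 5 * p 7 -
  3 * p 6 ^ 2 + 6 * p 6 * p 7) +
  p 0 * (-4 * q 0 * q 2 + 4 * q 1 * q 4 + q 2 ^ 2 + 2 * q 2 * q 5 - 4 * q 2 * q 6 -
  2 * q 2 * q 7 + 4 * q 3 * q 5 - 6 * q 3 * q 6 + 2 * q 4 ^ 2 + 4 * q 4 * q 6 + 8 * q 4 * q 7 +
  6 * q 6 * q 7 + 3 * q 7 ^ 2) +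
  p 1 * (-2 * q 0 * q 3 - 4 * q 1 * q 3 + 4 * q 2 * q 5 - q 3 ^ 2 - 4 * q 4 * q 6 -
  2 * q 4 * q 7 + 2 * q 5 ^ 2 - 8 * q 5 * q 6 - 4 * q 5 * q 7 + 3 * q 6 ^ 2 - 3 * q 7 ^ 2) +
  p 2 * (-2 * q 1 * q 4 - 4 * q 2 * q 4 - 2 * q 2 * q 6 - 2 * q 3 ^ 2 - 4 * q 3 * q 6 +
  4 * q 3 * q 7 - q 4 ^ 2 - 5 * q 6 ^ 2 - 6 * q 6 * q 7) +
  p 3 * (4 * q 0 * q 5 + 4 * q 1 * q 4 + q 2 ^ 2 - 4 * q 2 * q 6 - 2 * q 2 * q 7 +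
  4 * q 3 * q 5 - 8 * q 3 * q 6 - 4 * q 3 * q 7 - q 5 ^ 2 - 4 * q 6 ^ 2 - 6 * q 6 * q 7) +
  p 4 * (-q 0 ^ 2 - 2 * q 0 * q 3 - 2 * q 0 * q 6 + 2 * q 0 * q 7 - 4 * q 1 * q 6 +
  4 * q 1 * q 7 + 4 * q 2 * q 5 - 3 * q 6 ^ 2 + 3 * q 7 ^ 2) +
  p 5 * (-q 1 ^ 2 - 2 * q 1 * q 4 - 2 * q 1 * q 6 - 4 * q 1 * q 7 - 6 * q 2 * q 6 -
  6 * q 2 * q 7 - 4 * q 3 * q 6 + 4 * q 3 * q 7 + 3 * q 6 ^ 2 + 6 * q 6 * q 7) +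
  p 6 * (-4 * q 2 * q 6 - 6 * q 2 * q 7 - 8 * q 3 * q 6 - 12 * q 3 * q 7 + 3 * q 7 ^ 2) +
  p 7 * (-q 2 ^ 2 + 6 * q 2 * q 7)

/-- The norm of the trilinear form is exact on L, already over ℤ. This is what makes the weighted
sum of its translates invariant up to a coboundary. -/
theorem quadraticCochain_coboundary (p q r : Fin 8 → ℤ) :
    quadraticCochain q r - quadraticCochain (p + q) r + quadraticCochain p (q + r) -
      quadraticCochain p q = - ∑ k, trilinearForm k p q r := by
  simp only [Fin.sum_univ_succ, Finset.univ_eq_empty, Finset.sum_empty]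
  simp [trilinearForm, longOrbit, shortOrbit, quadraticCochain, Fin.succ]
  ring

/-- A function whose coboundary measures the defect of invariance of the quadratic cochain. -/
def cubicFunction (p : Fin 8 → ℤ) : ℤ :=
  -4 * p 0 * p 3 * p 5 + 8 * p 0 * p 3 * p 6 + 4 * p 0 * p 3 * p 7 + p 1 ^ 2 * p 6 +
  p 1 ^ 2 * p 7 - 2 * p 1 * p 2 ^ 2 - 4 * p 1 * p 2 * p 5 + 8 * p 1 * p 2 * p 6 +
  4 * p 1 * p 2 * p 7 + 4 * p 1 * p 4 * p 6 + 2 * p 1 * p 4 * p 7 - 2 * p 1 * p 5 ^ 2 +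
  8 * p 1 * p 5 * p 6 + 4 * p 1 * p 5 * p 7 - 2 * p 1 * p 6 ^ 2 - 4 * p 1 * p 6 * p 7 -
  2 * p 1 * p 7 ^ 2 + p 2 ^ 2 * p 7 - 4 * p 2 * p 4 * p 5 + 8 * p 2 * p 4 * p 6 +
  4 * p 2 * p 4 * p 7 + 10 * p 2 * p 6 ^ 2 + 10 * p 2 * p 6 * p 7 - 4 * p 2 * p 7 ^ 2 -
  2 * p 3 ^ 2 * p 5 + 4 * p 3 ^ 2 * p 6 + 2 * p 3 ^ 2 * p 7 + 8 * p 3 * p 6 ^ 2 +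
  4 * p 3 * p 6 * p 7 - 2 * p 3 * p 7 ^ 2 + 3 * p 6 - 3 * p 6 ^ 3 - 6 * p 6 ^ 2 * p 7 -
  3 * p 6 * p 7 ^ 2

theorem quadraticCochain_defect (p q : Fin 8 → ℤ) :
    quadraticCochain p q - quadraticCochain (turn p) (turn q) =
      cubicFunction p + cubicFunction q - cubicFunction (p + q) := by
  simp [turn, quadraticCochain, cubicFunction]
  ring

theorem ext_orbit {p q : Fin 8 → ℤ} (h1 : ∀ i, longOrbit p i = longOrbit q i)
    (h2 : ∀ i, shortOrbit p i = shortOrbit q i) : p = q := by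
  funext i
  fin_cases i
  exacts [h1 0, h1 1, h1 2, h1 3, h1 4, h1 5, h2 0, h2 1]

theorem turn_iterate_nine (p : Fin 8 → ℤ) : turn^[9] p = p := by
  have h (i : Fin 9) : i - 1 - 1 - 1 - 1 - 1 - 1 - 1 - 1 - 1 = i := by decide +revert
  have h1 (i : Fin 9) : longOrbit (turn^[9] p) i = longOrbit p i := by
    simp only [Function.iterate_succ_apply', longOrbit_turn, h, Function.iterate_zero, id_eq]
  have h2 (i : Fin 9) : shortOrbit (turn^[9] p) i = shortOrbit p i := by
    simp only [Function.iterate_succ_apply', shortOrbit_turn, h, Function.iterate_zero, id_eq]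
  exact ext_orbit h1 h2

theorem turn_add (p q : Fin 8 → ℤ) : turn (p + q) = turn p + turn q := by
  funext i
  fin_cases i <;> simp [turn] <;> ring

theorem turn_iterate_add (k : ℕ) (p q : Fin 8 → ℤ) :
    turn^[k] (p + q) = turn^[k] p + turn^[k] q := by
  induction k with
  | zero => rfl
  | succ k ih => rw [Function.iterate_succ_apply', ih, turn_add, Function.iterate_succ_apply',
      Function.iterate_succ_apply']

/-- The defect identity telescopes around an orbit of length nine, so the orbit sum of the cubic
function is additive in p. It is then enough that it vanishes on the eight basis vectors. -/
theorem sum_cubicFunction (p : Fin 8 → ℤ) :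
    ∑ k ∈ Finset.range 9, cubicFunction (turn^[k] p) = 0 := by
  have h (p q : Fin 8 → ℤ) : ∑ k ∈ Finset.range 9, cubicFunction (turn^[k] (p + q)) =
      ∑ k ∈ Finset.range 9, cubicFunction (turn^[k] p) +
        ∑ k ∈ Finset.range 9, cubicFunction (turn^[k] q) := by
    have h1 := Finset.sum_range_sub' (fun k => quadraticCochain (turn^[k] p) (turn^[k] q)) 9
    rw [turn_iterate_nine, turn_iterate_nine, Function.iterate_zero, id_eq, id_eq, sub_self] at h1
    simp only [Function.iterate_succ_apply', quadraticCochain_defect, ← turn_iterate_add,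
      Finset.sum_sub_distrib, Finset.sum_add_distrib] at h1
    linarith
  have hs : ∀ i : Fin 8, ∑ k ∈ Finset.range 9, cubicFunction (turn^[k] (Pi.single i 1)) = 0 := by
    decide +kernel
  refine congrFun (congrArg DFunLike.coe (AddMonoidHom.functions_ext' ℤ
    (AddMonoidHom.mk' (fun p => ∑ k ∈ Finset.range 9, cubicFunction (turn^[k] p)) h :
      (Fin 8 → ℤ) →+ ℤ) 0 fun i => ?_)) p
  ext
  exact hs i

/-- An invariant alternating form. -/
def alternatingForm (p q : Fin 8 → ℤ) : ℤ :=
  p 0 * (-q 2 - q 3 - q 4) +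
  p 1 * (-q 3 - q 4 - q 5) +
  p 2 * (q 0 + q 3 - q 4 - q 5 + q 6 - q 7) +
  p 3 * (q 0 + q 1 - q 2 - q 5 + 2 * q 6 + q 7) +
  p 4 * (q 0 + q 1 + q 2) +
  p 5 * (q 1 + q 2 + q 3) +
  p 6 * (-q 2 - 2 * q 3) +
  p 7 * (q 2 - q 3)

theorem alternatingForm_turn (p q : Fin 8 → ℤ) :
    alternatingForm (turn p) (turn q) = alternatingForm p q := by
  simp [alternatingForm, turn]
  ring

end Polynomials

/-! ### Six three-cocycles modulo nine and the elements that detect them. -/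

section Cocycles

/-- The adapted coordinates of a vector. -/
def adapted (l : Lattice) : Fin 8 → ℤ := adaptedForms.mulVec l.toAdd

theorem adapted_mul (l l' : Lattice) : adapted (l * l') = adapted l + adapted l' :=
  Matrix.mulVec_add _ _ _

/-- Both sides are additive, so they are compared on a basis. -/
theorem adapted_action (l : Lattice) :
    adapted (holonomyAction (Multiplicative.ofAdd 1) l) = turn (adapted l) := by
  let f : (Fin 8 → ℤ) →+ (Fin 8 → ℤ) :=
    (Matrix.mulVecLin adaptedForms).toAddMonoidHom.comp
      (Matrix.mulVecLin (holonomyMatrix ^ 1)).toAddMonoidHom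
  let g : (Fin 8 → ℤ) →+ (Fin 8 → ℤ) :=
    (AddMonoidHom.mk' turn turn_add).comp (Matrix.mulVecLin adaptedForms).toAddMonoidHom
  have h : ∀ i, adaptedForms.mulVec ((holonomyMatrix ^ 1).mulVec (Pi.single i 1)) =
      turn (adaptedForms.mulVec (Pi.single i 1)) := by decide +kernel
  have hfg : f = g := AddMonoidHom.functions_ext' _ _ _ fun i => AddMonoidHom.ext_int (h i)
  exact congrArg (fun f : (Fin 8 → ℤ) →+ (Fin 8 → ℤ) => f l.toAdd) hfg

theorem adapted_action_natCast (k : ℕ) (l : Lattice) :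
    adapted (holonomyAction (Multiplicative.ofAdd (k : ZMod 9)) l) = turn^[k] (adapted l) := by
  induction k with
  | zero => rw [Nat.cast_zero, ofAdd_zero, map_one]; rfl
  | succ k ih => rw [Nat.cast_succ, add_comm, ofAdd_add, map_mul, MulAut.mul_apply, adapted_action,
      ih, Function.iterate_succ_apply']

theorem trilinearForm_add₁ (k p p' q r) :
    trilinearForm k (p + p') q r = trilinearForm k p q r + trilinearForm k p' q r := by
  have h (k) : longOrbit (p + p') k = longOrbit p k + longOrbit p' k := by
    fin_cases k <;> simp [longOrbit] <;> ring
  simp only [trilinearForm, h]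
  ring

theorem trilinearForm_add₂ (k p q q' r) :
    trilinearForm k p (q + q') r = trilinearForm k p q r + trilinearForm k p q' r := by
  have h (k) : longOrbit (q + q') k = longOrbit q k + longOrbit q' k := by
    fin_cases k <;> simp [longOrbit] <;> ring
  simp only [trilinearForm, h]
  ring

theorem trilinearForm_add₃ (k p q r r') :
    trilinearForm k p q (r + r') = trilinearForm k p q r + trilinearForm k p q r' := by
  have h (k) : longOrbit (r + r') k = longOrbit r k + longOrbit r' k := by
    fin_cases k <;> simp [longOrbit] <;> ring
  have h' (k) : shortOrbit (r + r') k = shortOrbit r k + shortOrbit r' k := by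
    fin_cases k <;> simp [shortOrbit] <;> ring
  simp only [trilinearForm, h, h']
  ring

/-- The residue of an index. -/
def weight (k : Fin 9) : ZMod 9 := k

theorem weight_eq (k : Fin 9) : weight k = weight (k - 1) + 1 := by
  decide +revert

/-- The weighted sum of the translates of the trilinear form. -/
def weightedForm (p q r : Fin 8 → ℤ) : ZMod 9 :=
  ∑ k : Fin 9, weight k * ((trilinearForm k p q r : ℤ) : ZMod 9)

/-- The norm of the trilinear form. -/
def normForm (p q r : Fin 8 → ℤ) : ZMod 9 :=
  ∑ k : Fin 9, ((trilinearForm k p q r : ℤ) : ZMod 9)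

theorem normForm_turn (p q r : Fin 8 → ℤ) : normForm (turn p) (turn q) (turn r) = normForm p q r :=
    by
  unfold normForm
  simp only [trilinearForm_turn]
  exact Equiv.sum_comp (Equiv.subRight (1 : Fin 9))
    fun k => ((trilinearForm k p q r : ℤ) : ZMod 9)

/-- Shifting the index raises every weight by one. This is consistent around the cycle because the
weights are taken modulo nine. -/
theorem weightedForm_turn (p q r : Fin 8 → ℤ) :
    weightedForm (turn p) (turn q) (turn r) = weightedForm p q r + normForm p q r := by
  unfold weightedForm normForm
  simp only [trilinearForm_turn]
  rw [← Finset.sum_add_distrib]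
  have h := Equiv.sum_comp (Equiv.subRight (1 : Fin 9))
    fun k => (weight k + 1) * ((trilinearForm k p q r : ℤ) : ZMod 9)
  refine Eq.trans ?_ (h.trans (Finset.sum_congr rfl fun k _ => by rw [add_mul, one_mul]))
  exact Finset.sum_congr rfl fun k _ => by rw [weight_eq k]; rfl

theorem isTrilinearDatum : IsTrilinearDatum holonomyAction
    (fun p q r => weightedForm (adapted p) (adapted q) (adapted r))
    (fun p q r => normForm (adapted p) (adapted q) (adapted r))
    (fun p q => (quadraticCochain (adapted p) (adapted q) : ℤ))
    (fun p => (cubicFunction (adapted p) : ℤ)) where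
  add₁ p p' q r := by
    simp only [weightedForm, adapted_mul, trilinearForm_add₁, Int.cast_add, mul_add,
      Finset.sum_add_distrib]
  add₂ p q q' r := by
    simp only [weightedForm, adapted_mul, trilinearForm_add₂, Int.cast_add, mul_add,
      Finset.sum_add_distrib]
  add₃ p q r r' := by
    simp only [weightedForm, adapted_mul, trilinearForm_add₃, Int.cast_add, mul_add,
      Finset.sum_add_distrib]
  shift p q r := by rw [adapted_action, adapted_action, adapted_action, weightedForm_turn]
  invariant p q r := by rw [adapted_action, adapted_action, adapted_action, normForm_turn]
  coboundary p q r := by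
    have h := quadraticCochain_coboundary (adapted p) (adapted q) (adapted r)
    rw [adapted_mul, adapted_mul, normForm]
    exact_mod_cast congrArg (Int.cast : ℤ → ZMod 9) h
  defect p q := by
    have h := quadraticCochain_defect (adapted p) (adapted q)
    rw [adapted_mul, adapted_action, adapted_action]
    exact_mod_cast congrArg (Int.cast : ℤ → ZMod 9) h
  sum_eq_zero p := by
    simp only [partialSum, adapted_action_natCast]
    exact_mod_cast congrArg (Int.cast : ℤ → ZMod 9) (sum_cubicFunction (adapted p))

/-- A three-cocycle modulo nine that is trilinear on the lattice. -/
def exoticCocycle : CrystalGroup → CrystalGroup → CrystalGroup → ZMod 9 :=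
  trilinearCocycle holonomyAction
    (fun p q r => weightedForm (adapted p) (adapted q) (adapted r))
    (fun p q => (quadraticCochain (adapted p) (adapted q) : ℤ))
    (fun p => (cubicFunction (adapted p) : ℤ))

/-- An element of the group in adapted coordinates. -/
def element (v : Fin 8 → ℤ) (k : ZMod 9) : CrystalGroup :=
  ⟨Multiplicative.ofAdd (adaptedBasis.mulVec v), Multiplicative.ofAdd k⟩

end Cocycles

section Cocycles

/-- The carry cocycle of the cyclic group of order nine. -/
def carry (a b : Holonomy) : ZMod 9 :=
  if a.toAdd.val + b.toAdd.val < 9 then 0 else 1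

theorem isTwoCocycle_carry : IsTwoCocycle carry := by
  have h : ∀ x y z : ZMod 9, carry (.ofAdd y) (.ofAdd z) - carry (.ofAdd (x + y)) (.ofAdd z) +
      carry (.ofAdd x) (.ofAdd (y + z)) - carry (.ofAdd x) (.ofAdd y) = 0 := by decide +kernel
  exact fun x y z => h x.toAdd y.toAdd z.toAdd

/-- The residue of the holonomy. -/
def holonomyResidue (x : CrystalGroup) : ZMod 9 := x.right.toAdd

theorem holonomyResidue_mul (x y : CrystalGroup) :
    holonomyResidue (x * y) = holonomyResidue x + holonomyResidue y := rfl

theorem invariant_of_turn {B : Type} {f : (Fin 8 → ℤ) → (Fin 8 → ℤ) → B}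
    (hf : ∀ p q, f (turn p) (turn q) = f p q) (g : Holonomy) (a b : Lattice) :
    f (adapted (holonomyAction g a)) (adapted (holonomyAction g b)) =
      f (adapted a) (adapted b) := by
  refine induct_cyclic (P := fun g _ => f (adapted (holonomyAction g a))
    (adapted (holonomyAction g b)) = f (adapted a) (adapted b)) ?_ (fun k hk => ?_) g
  · rw [map_one, MulAut.one_apply, MulAut.one_apply]
  · rw [map_mul, MulAut.mul_apply, MulAut.mul_apply, adapted_action, adapted_action, hf, hk]

/-- The two-cochain of a form on the lattice. -/
def formTwoCochain (f : (Fin 8 → ℤ) → (Fin 8 → ℤ) → ℤ) (x y : CrystalGroup) : ZMod 9 :=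
  (f (adapted x.left) (adapted (holonomyAction x.right y.left)) : ℤ)

theorem isTwoCocycle_formTwoCochain {f : (Fin 8 → ℤ) → (Fin 8 → ℤ) → ℤ}
    (h₁ : ∀ p p' q, f (p + p') q = f p q + f p' q) (h₂ : ∀ p q q', f p (q + q') = f p q + f p q')
    (hf : ∀ p q, f (turn p) (turn q) = f p q) : IsTwoCocycle (formTwoCochain f) :=
  isTwoCocycle_bilinear (φ := holonomyAction)
    (ω := fun a b => ((f (adapted a) (adapted b) : ℤ) : ZMod 9))
    (fun a b c => by rw [adapted_mul, h₁, Int.cast_add])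
    (fun a b c => by rw [adapted_mul, h₂, Int.cast_add])
    (fun g a b => by rw [invariant_of_turn hf])

theorem isTwoCocycle_alternatingForm : IsTwoCocycle (formTwoCochain alternatingForm) :=
  isTwoCocycle_formTwoCochain (fun p p' q => by simp only [alternatingForm, Pi.add_apply]; ring)
    (fun p q q' => by simp only [alternatingForm, Pi.add_apply]; ring) alternatingForm_turn

/-- The invariant alternating form of rank two. -/
def planeForm (p q : Fin 8 → ℤ) : ℤ := p 6 * q 7 - p 7 * q 6

theorem isTwoCocycle_planeForm : IsTwoCocycle (formTwoCochain planeForm) :=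
  isTwoCocycle_formTwoCochain (fun p p' q => by simp only [planeForm, Pi.add_apply]; ring)
    (fun p q q' => by simp only [planeForm, Pi.add_apply]; ring)
    (fun p q => by
      change (-p 6 - p 7) * q 6 - p 6 * (-q 6 - q 7) = p 6 * q 7 - p 7 * q 6
      ring)

/-- A linear form that is invariant modulo nine. -/
def residueForm (p : Fin 8 → ℤ) : ZMod 9 :=
  ((3 * (p 0 + p 1 + p 2) + 6 * (p 3 + p 4 + p 5) + 3 * p 7 : ℤ) : ZMod 9)

theorem residueForm_turn (p : Fin 8 → ℤ) : residueForm (turn p) = residueForm p := by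
  refine (ZMod.intCast_eq_intCast_iff_dvd_sub _ _ 9).2 ⟨p 5 - p 6, ?_⟩
  change 3 * (p 0 + p 1 + p 2) + 6 * (p 3 + p 4 + p 5) + 3 * p 7 - (3 * (-p 2 - p 5 + 2 * p 6 + p 7
      +
    p 0 + p 1) + 6 * (p 2 + p 3 + p 4) + 3 * p 6) = 9 * (p 5 - p 6)
  ring

/-- The homomorphism to `ℤ/9` given by the invariant linear form. -/
def latticeResidue (x : CrystalGroup) : ZMod 9 := residueForm (adapted x.left)

theorem latticeResidue_mul (x y : CrystalGroup) :
    latticeResidue (x * y) = latticeResidue x + latticeResidue y :=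
  left_mul_of_invariant (ε := fun a => residueForm (adapted a))
    (fun a b => by
      simp only [residueForm, adapted_mul, Pi.add_apply]
      push_cast
      ring)
    (fun g a => invariant_of_turn (f := fun p _ => residueForm p) (fun p _ => residueForm_turn p)
      g a 1) x y

/-- The elements on which classes are detected. -/
def detector : Fin 6 → CrystalGroup :=
  ![element 0 1, element (Pi.single 0 1) 1, element (Pi.single 6 1) 1, element (Pi.single 6 2) 1,
    element (Pi.single 5 1) 3, element (Pi.single 5 (-1)) 3]

/-- The orders of the detecting elements. -/
def detectorOrder : Fin 6 → ℕ := ![9, 9, 9, 9, 3, 3]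

/-- The indices of the detecting subgroups. -/
def detectorIndex : Fin 6 → ℕ := ![1, 1, 1, 1, 3, 3]

/-- Since 1 + M + ⋯ + M⁸ = 0, every element with residue 1 has order nine. For residue 3 the vectors
are multiples of a basis vector on which the last two forms vanish, and these are killed by 1 + M³ +
M⁶. -/
theorem detector_pow (i : Fin 6) : detector i ^ detectorOrder i = 1 := by
  have h : ∀ i, (detector i ^ detectorOrder i).left.toAdd = 0 ∧
      (detector i ^ detectorOrder i).right.toAdd = 0 := by decide +kernel
  exact SemidirectProduct.ext (h i).1 (h i).2

theorem detectorOrder_mul : ∀ i, detectorOrder i * detectorIndex i = 9 := by decide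

/-- The values of a three-cochain on the detecting elements. -/
def detectorValues (h : CrystalGroup → CrystalGroup → CrystalGroup → ZMod 9) (i : Fin 6) : ZMod 9 :=
  ∑ j ∈ Finset.range (detectorOrder i), h (detector i) (detector i ^ j) (detector i)

/-- Along the powers of a detecting element exactly one carry occurs, so each value is the residue
itself. -/
theorem values_carry : ∀ i, detectorValues
    (fun x y z => holonomyResidue x * carry y.right z.right) i = ![1, 1, 1, 1, 3, 3] i := by
  decide +kernel

/-- The detectors 2 and 3 take equal values on each of the five other cocycles, while here they
differ by the unit 1 modulo 9. Only these entries and the zero at detector 0 are used. -/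
theorem values_exotic : detectorValues exoticCocycle 0 = 0 ∧
    detectorValues exoticCocycle 2 = 5 ∧ detectorValues exoticCocycle 3 = 4 := by
  decide +kernel

theorem values_alternatingForm : ∀ i, detectorValues
    (fun x y z => holonomyResidue x * formTwoCochain alternatingForm y z) i =
      ![0, 0, 0, 0, 6, 6] i := by
  decide +kernel

theorem values_planeForm : ∀ i, detectorValues
    (fun x y z => holonomyResidue x * formTwoCochain planeForm y z) i =
      ![0, 0, 3, 3, 0, 0] i := by
  decide +kernel

theorem values_latticeResidue : ∀ i, detectorValues
    (fun x y z => latticeResidue x * carry y.right z.right) i = ![0, 3, 0, 0, 6, 3] i := by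
  decide +kernel

theorem values_latticeResidue_alternatingForm : ∀ i, detectorValues
    (fun x y z => latticeResidue x * formTwoCochain alternatingForm y z) i =
      ![0, 0, 0, 0, 3, 6] i := by
  decide +kernel

end Cocycles

/-! ### The torsion of H⁴(Γ, ℤ). -/

section Torsion

/-- Evaluation of classes on the detecting elements. -/
def detectorMap : intCohomology CrystalGroup 4 →+ (Fin 6 → ZMod 9) :=
  AddMonoidHom.mk' (fun x i => cyclicValue (detector_pow i) (detectorOrder_mul i) x)
    fun x y => funext fun _ => map_add _ x y

/-- The target H⁴(Γ, Fun) ≅ H⁴(L) is torsion free. -/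
theorem mem_ker_of_nsmul_eq_zero {x : intCohomology CrystalGroup 4} (hx : 9 • x = 0) :
    x ∈ (coeffMap (constMap holonomyAction) 4).ker := by
  rw [AddMonoidHom.mem_ker]
  apply isActionMatrix_four.bijective.1
  rw [map_zero]
  have h := congrArg (fun x => twistedAltMap holonomyAction latticeCoords tupleFour
    (coeffMap (constMap holonomyAction) 4 x)) hx
  simp only [map_nsmul, map_zero] at h
  exact (smul_eq_zero.1 h).resolve_left (by norm_num)

theorem exists_torsion {h : CrystalGroup → CrystalGroup → CrystalGroup → ZMod 9}
    (hh : IsThreeCocycle h) : ∃ x : (coeffMap (constMap holonomyAction) 4).ker,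
      detectorMap x = detectorValues h := by
  obtain ⟨x, h1, h2⟩ := exists_bockstein h hh
  exact ⟨⟨x, mem_ker_of_nsmul_eq_zero h1⟩,
    funext fun i => h2 _ _ _ (detector_pow i) (detectorOrder_mul i)⟩

/-- A set-theoretic lift of μ through Ψ is injective, hence bijective by counting. It follows that Ψ
is injective and that the lift is additive. In particular the orders of the chosen lifts need not be
known in advance. -/
theorem nonempty_addEquiv_of_card_le {T D V : Type} [AddCommGroup T] [AddCommGroup D]
    [AddCommGroup V] [Finite T] (hc : Nat.card T ≤ Nat.card D) (Ψ : T →+ V) (μ : D →+ V)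
    (hμ : Function.Injective μ) (h : ∀ d, ∃ t, Ψ t = μ d) : Nonempty (T ≃+ D) := by
  choose s hs using h
  have hinj : Function.Injective s := fun d d' e => hμ (by rw [← hs, ← hs, e])
  have : Finite D := Finite.of_injective s hinj
  have hb : Function.Bijective s := (Nat.bijective_iff_injective_and_card s).2
    ⟨hinj, le_antisymm (Nat.card_le_card_of_injective s hinj) hc⟩
  have hΨ : Function.Injective Ψ := fun t t' e => by
    obtain ⟨d, rfl⟩ := hb.2 t
    obtain ⟨d', rfl⟩ := hb.2 t'
    rw [hs, hs] at e
    rw [hμ e]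
  refine ⟨(AddEquiv.ofBijective (AddMonoidHom.mk' s fun d d' => hΨ ?_) hb).symm⟩
  rw [map_add, hs, hs, hs, map_add]

/-- Multiplication by three from `ℤ/3` to `ℤ/9`. -/
def triple : ZMod 3 →+ ZMod 9 := AddMonoidHom.mk' (fun b => 3 * (b.val : ZMod 9)) (by decide)

theorem triple_apply (b : ZMod 3) : triple b = 3 * (b.val : ZMod 9) := rfl

theorem triple_eq_zero : ∀ b, triple b = 0 → b = 0 := by decide

theorem two_mul_triple_eq_zero : ∀ b, 2 * triple b = 0 → b = 0 := by decide

/-- The torsion classes that are constructed, as seen on the detecting elements. -/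
def torsionValues (v : Fin 6 → ZMod 9) : (Fin 2 → ZMod 9) × (Fin 4 → ZMod 3) →+ (Fin 6 → ZMod 9) :=
  AddMonoidHom.mk' (fun d => d.1 0 • ![1, 1, 1, 1, 3, 3] + d.1 1 • v +
    triple (d.2 0) • ![0, 0, 0, 0, 2, 2] + triple (d.2 1) • ![0, 0, 1, 1, 0, 0] +
    triple (d.2 2) • ![0, 1, 0, 0, 2, 1] + triple (d.2 3) • ![0, 0, 0, 0, 1, 2])
    fun d d' => by
      simp only [Prod.fst_add, Prod.snd_add, Pi.add_apply, map_add, add_smul]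
      abel

theorem torsionValues_injective {v : Fin 6 → ZMod 9} (h₀ : v 0 = 0) (h₂ : v 2 = 5) (h₃ : v 3 = 4) :
    Function.Injective (torsionValues v) := by
  refine (injective_iff_map_eq_zero _).2 fun d hd => ?_
  have h (i : Fin 6) : d.1 0 * ![1, 1, 1, 1, 3, 3] i + d.1 1 * v i +
      triple (d.2 0) * ![0, 0, 0, 0, 2, 2] i + triple (d.2 1) * ![0, 0, 1, 1, 0, 0] i +
      triple (d.2 2) * ![0, 1, 0, 0, 2, 1] i + triple (d.2 3) * ![0, 0, 0, 0, 1, 2] i = 0 :=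
    congrFun hd i
  have e0 := h 0
  have e1 := h 1
  have e2 := h 2
  have e3 := h 3
  have e4 := h 4
  have e5 := h 5
  rw [h₀] at e0
  rw [h₂] at e2
  rw [h₃] at e3
  simp only [Matrix.cons_val, mul_zero, mul_one, add_zero] at e0 e1 e2 e3 e4 e5
  -- The difference of the detectors 2 and 3 isolates the coefficient of the exotic class, as 5 - 4
  -- = 1.
  have a1 : d.1 1 = 0 := by linear_combination e2 - e3
  simp only [e0, a1, zero_mul, zero_add] at e1 e2 e3 e4 e5
  have b1 := triple_eq_zero _ e2
  have b2 := triple_eq_zero _ e1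
  rw [b2, map_zero] at e4 e5
  have b3 : d.2 3 = 0 := triple_eq_zero _ (by linear_combination e5 - e4)
  rw [b3, map_zero] at e4
  have b0 : d.2 0 = 0 := two_mul_triple_eq_zero _ (by linear_combination e4)
  refine Prod.ext (funext fun i => ?_) (funext fun i => ?_) <;> fin_cases i
  exacts [e0, a1, b0, b1, b2, b3]

/-- The Bocksteins of the residue times the carry cocycle and of the exotic cocycle account for ℤ₉².
The other four cup products account for ℤ₃⁴, since their values on the detectors are multiples of
three. The order of this group, 9²·3⁴ = 3⁸, equals the upper bound. -/
theorem ker_constMap_equiv : Nonempty ((coeffMap (constMap holonomyAction) 4).ker ≃+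
    (Fin 2 → ZMod 9) × (Fin 4 → ZMod 3)) := by
  have : Finite (coeffMap (constMap holonomyAction) 4).ker := ker_constMap_holonomy.1.to_subtype
  obtain ⟨x₁, h₁⟩ := exists_torsion ((isTwoCocycle_right isTwoCocycle_carry).cup
      holonomyResidue_mul)
  obtain ⟨x₂, h₂⟩ := exists_torsion (h := exoticCocycle) isTrilinearDatum.isThreeCocycle
  obtain ⟨y₀, k₀⟩ := exists_torsion (isTwoCocycle_alternatingForm.cup holonomyResidue_mul)
  obtain ⟨y₁, k₁⟩ := exists_torsion (isTwoCocycle_planeForm.cup holonomyResidue_mul)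
  obtain ⟨y₂, k₂⟩ := exists_torsion ((isTwoCocycle_right isTwoCocycle_carry).cup latticeResidue_mul)
  obtain ⟨y₃, k₃⟩ := exists_torsion (isTwoCocycle_alternatingForm.cup latticeResidue_mul)
  refine nonempty_addEquiv_of_card_le ?_
    (detectorMap.comp (coeffMap (constMap holonomyAction) 4).ker.subtype) (torsionValues
        (detectorValues exoticCocycle))
    (torsionValues_injective values_exotic.1 values_exotic.2.1 values_exotic.2.2) fun d => ?_
  · refine (Nat.card_coe_set_eq {x | coeffMap (constMap holonomyAction) 4 x = 0}).le.trans
      (ker_constMap_holonomy.2.trans ?_)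
    simp
  · refine ⟨(d.1 0).val • x₁ + (d.1 1).val • x₂ + (d.2 0).val • y₀ + (d.2 1).val • y₁ +
      (d.2 2).val • y₂ + (d.2 3).val • y₃, ?_⟩
    have e (a : ZMod 9) (v : Fin 6 → ZMod 9) : a.val • v = a • v := by
      rw [← Nat.cast_smul_eq_nsmul (ZMod 9), ZMod.natCast_val, ZMod.cast_id]
    have e' (b : ZMod 3) (v w : Fin 6 → ZMod 9) (hv : ∀ i, v i = 3 * w i) :
        b.val • v = triple b • w := by
      funext i
      rw [Pi.smul_apply, Pi.smul_apply, hv, nsmul_eq_mul, smul_eq_mul, triple_apply]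
      ring
    simp only [map_add, map_nsmul, AddMonoidHom.comp_apply, AddSubgroup.subtype_apply, h₁, h₂, k₀,
        k₁, k₂, k₃, e]
    rw [funext values_carry, e' _ _ ![0, 0, 0, 0, 2, 2], e' _ _ ![0, 0, 1, 1, 0, 0],
      e' _ _ ![0, 1, 0, 0, 2, 1], e' _ _ ![0, 0, 0, 0, 1, 2]]
    · rfl
    · intro i; rw [values_latticeResidue_alternatingForm]; decide +revert
    · intro i; rw [values_latticeResidue]; decide +revert
    · intro i; rw [values_planeForm]; decide +revert
    · intro i; rw [values_alternatingForm]; decide +revert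

theorem cohomology_four : Nonempty (intCohomology CrystalGroup 4 ≃+
    (Fin 8 → ℤ) × (Fin 2 → ZMod 9) × (Fin 4 → ZMod 3)) := by
  obtain ⟨e⟩ := cohomology_four_split
  obtain ⟨f⟩ := ker_constMap_equiv
  exact ⟨e.trans ((f.prodCongr (AddEquiv.refl _)).trans AddEquiv.prodComm)⟩

end Torsion

/-! ### The crystallographic action. -/

section Isometries

variable {n m : ℕ}

/-- The real matrix underlying an integral matrix. -/
abbrev realMatrix : Matrix (Fin n) (Fin n) ℤ →+* Matrix (Fin n) (Fin n) ℝ :=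
  (Int.castRingHom ℝ).mapMatrix

/-- An integral matrix of finite order is orthogonal for some scalar product. -/
theorem exists_invariant_norm [NeZero m] {A : Matrix (Fin n) (Fin n) ℤ} (hA : A ^ m = 1) :
    ∃ e : (Fin n → ℝ) ≃ₗ[ℝ] EuclideanSpace ℝ (Fin n),
      ∀ v, ‖e ((realMatrix A).mulVec v)‖ = ‖e v‖ := by
  -- Recording all translates Aᵏv embeds ℝⁿ in a larger Euclidean space. The induced norm is the
  -- average of the standard one over the finite group, and an orthonormal basis of the image brings
  -- it back to dimension n.
  let f : (Fin n → ℝ) →ₗ[ℝ] EuclideanSpace ℝ (Fin m × Fin n) :=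
    { toFun := fun v => WithLp.toLp 2 fun p => ((realMatrix A) ^ (p.1 : ℕ)).mulVec v p.2
      map_add' := fun v w => by
        ext p
        simp [Matrix.mulVec_add]
      map_smul' := fun c v => by
        ext p
        simp [Matrix.mulVec_smul] }
  have hf (v) (p : Fin m × Fin n) : f v p = ((realMatrix A) ^ (p.1 : ℕ)).mulVec v p.2 := rfl
  have hR : (realMatrix A) ^ m = 1 := by rw [← map_pow, hA, map_one]
  have hinj : Function.Injective f := fun v w h => by
    funext i
    have h1 := congrArg (fun x : EuclideanSpace ℝ (Fin m × Fin n) => x (0, i)) h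
    simpa [hf] using h1
  have hnorm (v) : ‖f v‖ ^ 2 = ∑ k ∈ Finset.range m, ∑ i, (((realMatrix A) ^ k).mulVec v i) ^ 2 :=
      by
    rw [EuclideanSpace.real_norm_sq_eq, Fintype.sum_prod_type, Finset.sum_range]
    rfl
  have hinv (v) : ‖f ((realMatrix A).mulVec v)‖ = ‖f v‖ := by
    rw [← sq_eq_sq₀ (norm_nonneg _) (norm_nonneg _), hnorm, hnorm]
    -- Applying A shifts the sum over k by one step, which changes nothing because Aᵐ = 1.
    have h1 := Finset.sum_range_succ (fun k => ∑ i, (((realMatrix A) ^ k).mulVec v i) ^ 2) m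
    rw [Finset.sum_range_succ', hR, pow_zero] at h1
    rw [← add_right_cancel h1]
    simp only [Matrix.mulVec_mulVec, pow_succ]
  let g : (Fin n → ℝ) ≃ₗ[ℝ] LinearMap.range f := LinearEquiv.ofInjective f hinj
  have hr : Module.finrank ℝ (LinearMap.range f) = n := by
    rw [← g.finrank_eq, Module.finrank_fin_fun]
  let b := (stdOrthonormalBasis ℝ (LinearMap.range f)).reindex (finCongr hr)
  refine ⟨g.trans b.repr.toLinearEquiv, fun v => ?_⟩
  change ‖b.repr (g _)‖ = ‖b.repr (g v)‖
  rw [b.repr.norm_map, b.repr.norm_map]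
  exact hinv v

variable [NeZero m] {A : Matrix (Fin n) (Fin n) ℤ} (hA : A ^ m = 1)

/-- The real vector underlying a lattice element. -/
def realVector (l : Multiplicative (Fin n → ℤ)) : Fin n → ℝ := fun i => (l.toAdd i : ℝ)

theorem realVector_mul (l l' : Multiplicative (Fin n → ℤ)) :
    realVector (l * l') = realVector l + realVector l' :=
  funext fun _ => Int.cast_add _ _

theorem realVector_injective : Function.Injective (realVector (n := n)) := fun l l' h =>
  congrArg Multiplicative.ofAdd (funext fun i => Int.cast_injective (congrFun h i) :
    l.toAdd = l'.toAdd)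

/-- The affine action of the semidirect product. -/
def affine (γ : Multiplicative (Fin n → ℤ) ⋊[matrixAction A hA] Multiplicative (ZMod m))
    (v : Fin n → ℝ) : Fin n → ℝ :=
  realVector γ.left + (realMatrix (A ^ γ.right.toAdd.val)).mulVec v

theorem affine_one (v : Fin n → ℝ) : affine hA 1 v = v := by
  have h : realVector (1 : Multiplicative (Fin n → ℤ)) = 0 := funext fun _ => Int.cast_zero
  rw [affine, SemidirectProduct.one_left, SemidirectProduct.one_right, toAdd_one, ZMod.val_zero,
    pow_zero, map_one, Matrix.one_mulVec, h, zero_add]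

theorem affine_mul (γ γ' : Multiplicative (Fin n → ℤ) ⋊[matrixAction A hA] Multiplicative (ZMod m))
    (v : Fin n → ℝ) : affine hA (γ * γ') v = affine hA γ (affine hA γ' v) := by
  have h : realVector (matrixAction A hA γ.right γ'.left) =
      (realMatrix (A ^ γ.right.toAdd.val)).mulVec (realVector γ'.left) :=
    funext fun i => RingHom.map_mulVec (Int.castRingHom ℝ) (A ^ γ.right.toAdd.val)
      γ'.left.toAdd i
  rw [affine, affine, affine, SemidirectProduct.mul_left, SemidirectProduct.mul_right,
    realVector_mul, h, toAdd_mul, pow_val_add hA, map_mul, Matrix.mulVec_add, Matrix.mulVec_mulVec,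
    add_assoc]

variable {e : (Fin n → ℝ) ≃ₗ[ℝ] EuclideanSpace ℝ (Fin n)}
  (he : ∀ v, ‖e ((realMatrix A).mulVec v)‖ = ‖e v‖)

include he in
theorem norm_pow (k : ℕ) (v : Fin n → ℝ) : ‖e ((realMatrix (A ^ k)).mulVec v)‖ = ‖e v‖ := by
  induction k with
  | zero => rw [pow_zero, map_one, Matrix.one_mulVec]
  | succ k ih => rw [pow_succ', map_mul, ← Matrix.mulVec_mulVec, he, ih]

/-- The action of the semidirect product by isometries. -/
def isometryAction : Multiplicative (Fin n → ℤ) ⋊[matrixAction A hA] Multiplicative (ZMod m) →*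
    (EuclideanSpace ℝ (Fin n) ≃ᵢ EuclideanSpace ℝ (Fin n)) where
  toFun γ := IsometryEquiv.mk'
    (fun x => e (affine hA γ (e.symm x))) (fun x => e (affine hA γ⁻¹ (e.symm x)))
    (fun x => by rw [e.symm_apply_apply, ← affine_mul, mul_inv_cancel, affine_one,
      e.apply_symm_apply])
    (Isometry.of_dist_eq fun x y => by
      rw [dist_eq_norm, dist_eq_norm, ← map_sub, affine, affine, add_sub_add_left_eq_sub,
        ← Matrix.mulVec_sub, norm_pow he, ← map_sub, e.apply_symm_apply])
  map_one' := by
    ext1 x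
    change e (affine hA 1 (e.symm x)) = x
    rw [affine_one, e.apply_symm_apply]
  map_mul' γ γ' := by
    ext1 x
    change e (affine hA (γ * γ') (e.symm x)) = e (affine hA γ (e.symm (e (affine hA γ' (e.symm
        x)))))
    rw [affine_mul, e.symm_apply_apply]

theorem isometryAction_apply
    (γ : Multiplicative (Fin n → ℤ) ⋊[matrixAction A hA] Multiplicative (ZMod m))
    (x : EuclideanSpace ℝ (Fin n)) :
    isometryAction hA he γ x = e (affine hA γ (e.symm x)) := rfl

/-- The value at the origin determines the translation vector, and comparing with the other points
forces the linear part to be the identity. Faithfulness of the powers of A then gives trivial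
holonomy. -/
theorem isometryAction_mem_translations (hf : ∀ k : ZMod m, A ^ k.val = 1 → k = 0)
    (γ : Multiplicative (Fin n → ℤ) ⋊[matrixAction A hA] Multiplicative (ZMod m)) :
    isometryAction hA he γ ∈ translations n ↔ γ.right = 1 := by
  constructor
  · rintro ⟨w, hw⟩
    have h0 := hw 0
    rw [isometryAction_apply, map_zero, affine, Matrix.mulVec_zero, add_zero, add_zero] at h0
    have h1 (v : Fin n → ℝ) : (realMatrix (A ^ γ.right.toAdd.val)).mulVec v =
        (1 : Matrix (Fin n) (Fin n) ℝ).mulVec v := by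
      have h2 := hw (e v)
      rw [isometryAction_apply, e.symm_apply_apply, affine, map_add, h0] at h2
      rw [Matrix.one_mulVec]
      exact e.injective (add_left_cancel h2)
    have h2 : realMatrix (A ^ γ.right.toAdd.val) = realMatrix 1 := by
      rw [map_one]
      exact Matrix.ext_of_mulVec_single fun i => h1 _
    exact hf _ (Matrix.map_injective Int.cast_injective h2)
  · intro h
    refine ⟨e (realVector γ.left), fun x => ?_⟩
    rw [isometryAction_apply, affine, h, toAdd_one, ZMod.val_zero, pow_zero, map_one,
      Matrix.one_mulVec, map_add, e.apply_symm_apply]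

theorem isometryAction_injective (hf : ∀ k : ZMod m, A ^ k.val = 1 → k = 0) :
    Function.Injective (isometryAction hA he) := by
  refine (injective_iff_map_eq_one _).2 fun γ hγ => ?_
  have h1 : γ.right = 1 := (isometryAction_mem_translations hA he hf γ).1
    (hγ ▸ (translations n).one_mem)
  have h2 : isometryAction hA he γ 0 = 0 := by rw [hγ]; rfl
  rw [isometryAction_apply, map_zero, affine, Matrix.mulVec_zero, add_zero] at h2
  refine SemidirectProduct.ext (realVector_injective ?_) h1
  rw [e.map_eq_zero_iff.1 h2]
  exact funext fun _ => Int.cast_zero.symm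

theorem isCrystallographic_range : IsCrystallographic n (isometryAction hA he).range where
  properlyDiscontinuous K hK := by
    obtain ⟨C, hC⟩ := hK.isBounded.exists_norm_le
    let E := e.toContinuousLinearEquiv
    let R : ℤ := ⌈‖(E.symm : EuclideanSpace ℝ (Fin n) →L[ℝ] (Fin n → ℝ))‖ * (C + C)⌉
    have hfin : Set.Finite {γ : Multiplicative (Fin n → ℤ) ⋊[matrixAction A hA]
        Multiplicative (ZMod m) | ∀ i, γ.left.toAdd i ∈ Set.Icc (-R) R} := by
      have h1 : (Set.Icc (fun _ => -R) (fun _ => R) : Set (Fin n → ℤ)).Finite := Set.finite_Icc _ _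
      refine ((h1.prod (Set.finite_univ (α := ZMod m))).image fun p =>
        (⟨Multiplicative.ofAdd p.1, Multiplicative.ofAdd p.2⟩ : Multiplicative (Fin n → ℤ)
          ⋊[matrixAction A hA] Multiplicative (ZMod m))).subset fun γ hγ => ?_
      exact ⟨(γ.left.toAdd, γ.right.toAdd), ⟨⟨fun i => (hγ i).1, fun i => (hγ i).2⟩, trivial⟩, rfl⟩
    refine (hfin.image (isometryAction hA he)).subset ?_
    rintro _ ⟨⟨γ, rfl⟩, _, ⟨x, hx, rfl⟩, hy⟩
    refine ⟨γ, fun i => ?_, rfl⟩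
    -- If γ moves a point of K into K, the translation part of γ is the difference of two vectors
    -- bounded by C, because the linear part preserves the norm. Only finitely many lattice vectors
    -- qualify.
    have h1 : realVector γ.left = E.symm (isometryAction hA he γ x -
        e ((realMatrix (A ^ γ.right.toAdd.val)).mulVec (e.symm x))) := by
      apply E.injective
      rw [E.apply_symm_apply, isometryAction_apply, affine, map_add, add_sub_cancel_right]
      rfl
    have h2 : ‖realVector γ.left‖ ≤
        ‖(E.symm : EuclideanSpace ℝ (Fin n) →L[ℝ] (Fin n → ℝ))‖ * (C + C) := by
      rw [h1]
      refine ((E.symm : EuclideanSpace ℝ (Fin n) →L[ℝ] (Fin n → ℝ)).le_opNorm _).trans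
        (mul_le_mul_of_nonneg_left ((norm_sub_le _ _).trans (add_le_add (hC _ hy) ?_))
          (norm_nonneg _))
      rw [norm_pow he, e.apply_symm_apply]
      exact hC x hx
    have h3 : |(γ.left.toAdd i : ℝ)| ≤ (R : ℝ) :=
      (norm_le_pi_norm (realVector γ.left) i).trans (h2.trans (Int.le_ceil _))
    exact abs_le.1 (by exact_mod_cast h3)
  cocompact := by
    refine ⟨e '' Set.Icc 0 1, isCompact_Icc.image e.toContinuousLinearEquiv.continuous, fun x => ?_⟩
    refine ⟨_, ⟨SemidirectProduct.inl (Multiplicative.ofAdd fun i => -⌊e.symm x i⌋), rfl⟩,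
      fun i => Int.fract (e.symm x i), ⟨fun i => Int.fract_nonneg _, fun i => (Int.fract_lt_one
          _).le⟩,
      ?_⟩
    rw [isometryAction_apply, affine, SemidirectProduct.right_inl, toAdd_one, ZMod.val_zero,
      pow_zero, map_one, Matrix.one_mulVec]
    congr 1
    funext i
    change Int.fract (e.symm x i) = ((-⌊e.symm x i⌋ : ℤ) : ℝ) + e.symm x i
    rw [Int.fract, Int.cast_neg]
    ring

end Isometries

/-! ### Conclusion: the order of M, the embedding and the two non-isomorphic groups. -/

theorem orderOf_holonomyMatrix : orderOf holonomyMatrix = 9 := by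
  have : Fact (Nat.Prime 3) := ⟨Nat.prime_three⟩
  have h : ¬ holonomyMatrix ^ 3 ^ 1 = 1 := by decide +kernel
  exact orderOf_eq_prime_pow h holonomyMatrix_pow

theorem exists_crystallographic_embedding : ∃ ι : CrystalGroup →*
    (EuclideanSpace ℝ (Fin 8) ≃ᵢ EuclideanSpace ℝ (Fin 8)),
    Function.Injective ι ∧ IsCrystallographic 8 ι.range ∧
    ∀ γ : CrystalGroup, ι γ ∈ translations 8 ↔
      γ ∈ (SemidirectProduct.inl : Lattice →* CrystalGroup).range := by
  obtain ⟨e, he⟩ := exists_invariant_norm holonomyMatrix_pow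
  have hf : ∀ k : ZMod 9, holonomyMatrix ^ k.val = 1 → k = 0 := fun k hk => by
    have h := orderOf_dvd_of_pow_eq_one hk
    rw [orderOf_holonomyMatrix] at h
    exact (ZMod.val_eq_zero k).1 (Nat.eq_zero_of_dvd_of_lt h (ZMod.val_lt k))
  exact ⟨isometryAction holonomyMatrix_pow he, isometryAction_injective _ he hf,
    isCrystallographic_range _ he, fun γ =>
      (isometryAction_mem_translations _ he hf γ).trans (mem_leftSubgroup holonomyAction γ).symm⟩

/-- Three times the torsion of the right-hand group is cyclic of order three, whereas on the left it
is ℤ₃². The images of the two generators of order nine therefore satisfy a nontrivial relation after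
multiplication by three, and the generators themselves satisfy none. -/
theorem isEmpty_addEquiv_torsion : IsEmpty ((Fin 8 → ℤ) × (Fin 2 → ZMod 9) × (Fin 4 → ZMod 3) ≃+
    (Fin 8 → ℤ) × ZMod 9 × (Fin 6 → ZMod 3)) := by
  refine ⟨fun f => ?_⟩
  let a (i : Fin 2) : (Fin 8 → ℤ) × (Fin 2 → ZMod 9) × (Fin 4 → ZMod 3) := (0, Pi.single i 1, 0)
  have ha (i) : 9 • a i = 0 := by
    refine Prod.ext (smul_zero 9) (Prod.ext (funext fun j => ?_) (smul_zero 9))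
    change 9 • (Pi.single i 1 : Fin 2 → ZMod 9) j = 0
    decide +revert
  have h1 (i) : (f (a i)).1 = 0 := by
    have h : 9 • f (a i) = 0 := by rw [← map_nsmul, ha, map_zero]
    have h' : 9 • (f (a i)).1 = 0 := congrArg Prod.fst h
    exact (smul_eq_zero.1 h').resolve_left (by norm_num)
  have h2 : ∀ u v : ZMod 9, ∃ i j : Fin 3, (i ≠ 0 ∨ j ≠ 0) ∧
      3 • ((i : ℕ) • u + (j : ℕ) • v) = 0 := by decide +kernel
  obtain ⟨i, j, hij, h⟩ := h2 (f (a 0)).2.1 (f (a 1)).2.1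
  have h3 : f (3 • ((i : ℕ) • a 0 + (j : ℕ) • a 1)) = 0 := by
    simp only [map_nsmul, map_add]
    refine Prod.ext ?_ (Prod.ext h (funext fun k => ?_))
    · change 3 • ((i : ℕ) • (f (a 0)).1 + (j : ℕ) • (f (a 1)).1) = 0
      rw [h1, h1, smul_zero, smul_zero, add_zero, smul_zero]
    · have h4 : ∀ x : ZMod 3, 3 • x = 0 := by decide
      exact h4 _
  have h4 := congrArg (fun x : (Fin 8 → ℤ) × (Fin 2 → ZMod 9) × (Fin 4 → ZMod 3) => x.2.1)
    (f.map_eq_zero_iff.1 h3)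
  have h5 (k : Fin 2) : 3 • ((i : ℕ) • (Pi.single 0 1 : Fin 2 → ZMod 9) k +
      (j : ℕ) • (Pi.single 1 1 : Fin 2 → ZMod 9) k) = 0 := congrFun h4 k
  have h6 : ∀ i j : Fin 3, (∀ k, 3 • ((i : ℕ) • (Pi.single 0 1 : Fin 2 → ZMod 9) k +
      (j : ℕ) • (Pi.single 1 1 : Fin 2 → ZMod 9) k) = 0) → i = 0 ∧ j = 0 := by decide +kernel
  exact hij.elim (· (h6 i j h5).1) (· (h6 i j h5).2)

theorem isEmpty_addEquiv_cohomologySum :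
    IsEmpty (intCohomology CrystalGroup 4 ≃+ cohomologySum holonomyAction 4) := by
  obtain ⟨e⟩ := cohomology_four
  obtain ⟨f⟩ := cohomologySum_holonomy
  exact ⟨fun g => isEmpty_addEquiv_torsion.false ((e.symm.trans g).trans f)⟩

end Crystal

end

theorem mainTheorem8 :
    -- the holonomy matrix generates a cyclic group of order exactly nine
    orderOf Crystal.holonomyMatrix = 9 ∧
    -- `ℤ⁸ ⋊ ℤ₉` is a crystallographic group of dimension eight with lattice of translations `ℤ⁸`
    (∃ ι : Crystal.CrystalGroup →*
        (EuclideanSpace ℝ (Fin 8) ≃ᵢ EuclideanSpace ℝ (Fin 8)),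
      Function.Injective ι ∧
      Crystal.IsCrystallographic 8 ι.range ∧
      ∀ γ : Crystal.CrystalGroup, ι γ ∈ Crystal.translations 8 ↔
        γ ∈ (SemidirectProduct.inl : Crystal.Lattice →* Crystal.CrystalGroup).range) ∧
    -- its fourth cohomology
    Nonempty (Crystal.intCohomology Crystal.CrystalGroup 4 ≃+
      (Fin 8 → ℤ) × (Fin 2 → ZMod 9) × (Fin 4 → ZMod 3)) ∧
    -- the sum of the `H^i(ℤ₉, H^j(ℤ⁸))` with `i + j = 4`
    Nonempty (Crystal.cohomologySum Crystal.holonomyAction 4 ≃+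
      (Fin 8 → ℤ) × ZMod 9 × (Fin 6 → ZMod 3)) ∧
    -- hence a counterexample
    IsEmpty (Crystal.intCohomology Crystal.CrystalGroup 4 ≃+
      Crystal.cohomologySum Crystal.holonomyAction 4) :=
  ⟨Crystal.orderOf_holonomyMatrix, Crystal.exists_crystallographic_embedding,
    Crystal.cohomology_four, Crystal.cohomologySum_holonomy,
    Crystal.isEmpty_addEquiv_cohomologySum⟩
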